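/- Let $\mathbb{K}$ be a field of characteristic zero, let $r,s\in\mathbb{N}$, and let $\mathcal{S}$ be a signature (a set of generators with arities) of profile $0^{r+1}s0\dots$, that is, $\mathcal{S}$ has exactly $s$ generators, all of arity $r+1$. **Definitions.** Let $\mathfrak{T}\mathcal{S}$ be the free nonsymmetric operad on $\mathcal{S}$: its elements are the planar rooted trees whose internal nodes with $n$ children are decorated by generators of arity $n$, the arity is the number of leaves, the composition $\mathfrak{t}[\mathfrak{s}_1,\dots,\mathfrak{s}_n]$ grafts $\mathfrak{s}_i$ onto the $i$-th leaf, the unit is the tree reduced to a leaf, and the degree is the number of internal nodes. Let $\mathsf{MAs}_{\mathcal{S}}$ be the quotient of $\mathfrak{T}\mathcal{S}$ by the smallest operad congruence $\equiv$ such that $\mathsf{g}\circ_i\mathsf{g}'\equiv\mathsf{g}'\circ_{i'}\mathsf{g}$ for all generators $\mathsf{g},\mathsf{g}'$ and all positions $i,i'$; the degree passes to the quotient. For an operad $\mathcal{O}$ with unit $\mathbf 1$, $\mathbf{N}\mathcal{O}$ is the $\mathbb{K}$-vector space with basis $(\mathsf{E}_w)$, $w$ running over the words on $\mathcal{O}\setminus\{\mathbf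 1\}$, with the product $\mathsf{E}_w\mathsf{E}_{w'}=\mathsf{E}_{ww'}$, the counit $\varepsilon(\mathsf{E}_w)=1$ if $w$ is empty and $0$ otherwise, and the coproduct $\Delta$ which is the algebra morphism such that, for $x\in\mathcal{O}\setminus\{\mathbf 1\}$, $$\Delta\mathsf{E}_x=\sum_{x=y[w_1,\dots,w_{n}]}\mathsf{E}_{\mathrm{rd}(y)}\otimes\mathsf{E}_{\mathrm{rd}(w_1\cdots w_{n})},$$ where the sum is over the factorizations of $x$ ($n$ being the arity of $y$) and $\mathrm{rd}$ deletes the letters $\mathbf 1$. By definition $\mathbf{FdB}_{r,s}=\mathbf{N}\,\mathsf{MAs}_{\mathcal{S}}$. It is embedded in $\mathbf{N}\,\mathfrak{T}\mathcal{S}$ by sending $\mathsf{E}_w$ to the sum of the $\mathsf{E}_{\mathfrak{f}}$ over all words $\mathfrak{f}$ of trees whose letters represent the letters of $w$. An $\mathcal{S}$-forest-like alphabet is a set $A$ with unary relations $\mathrm{R}$ (root) and $\mathrm{D}_{\mathsf{g}}$ ($\mathsf{g}\in\mathcal{S}$) and binary relations $\to_j$ ($j\ge1$). The disjoint sum $A+A'$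 is the disjoint union with the unions of the unary relations, and with $a_1\to_j a_2$ if this holds in $A$ or in $A'$, or if $a_1\in A$, $a_2\in A'$ and $a_2$ is a root letter of $A'$. Let $\mathbb{K}\langle A\rangle$ be the algebra of noncommutative polynomials on $A$ of finite degree with possibly infinite support. Let $\mathsf{r}_A:\mathbf{N}\,\mathfrak{T}\mathcal{S}\to\mathbb{K}\langle A\rangle$ be the linear map sending $\mathsf{E}_{\mathfrak{f}}$ to the sum of all words $w$ on $A$ whose length is the number of internal nodes of $\mathfrak{f}$ and such that, the nodes being numbered in preorder, $w_i\in\mathrm{R}$ if node $i$ is a root, $w_i\in\mathrm{D}_{\mathsf{g}}$ if node $i$ is decorated by $\mathsf{g}$, and $w_i\to_j w_{i'}$ if node $i'$ is the $j$-th child of node $i$. Restrict $\mathsf{r}_A$ to $\mathbf{N}\,\mathsf{MAs}_{\mathcal{S}}$ through the embedding. Let $\theta_{A,A'}$ be the linear map, compatible with infinite sums, that sends a word $w$ on $A\sqcup A'$ to $w_{|A}\otimes w_{|A'}$. Finally let $\mathbb{A}_{\mathcal{S},\mathbb{N}}=\{\mathbf{a}_{\mathsf{g},i}:\mathsf{g}\in\mathcal{S},\,i\in\mathbb{N}\}$,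 where every letter is a root, $\mathrm{D}_{\mathsf{g}}=\{\mathbf{a}_{\mathsf{g},i}:i\in\mathbb{N}\}$, and $\mathbf{a}_{\mathsf{g},i}\to_j\mathbf{a}_{\mathsf{g}',i'}$ if and only if $i<i'$. **Theorem.** 1. The operad $\mathsf{MAs}_{\mathcal{S}}$ is finitely factorizable and graded by the degree, each class of $\equiv$ is finite, and $\mathbf{FdB}_{r,s}=\mathbf{N}\,\mathsf{MAs}_{\mathcal{S}}$ is a Hopf algebra. 2. Put $\mathbb{A}=\mathbb{A}_{\mathcal{S},\mathbb{N}}$. The image $\mathsf{r}_{\mathbb{A}}(\mathbf{N}\,\mathsf{MAs}_{\mathcal{S}})$ is a subalgebra of $\mathbb{K}\langle\mathbb{A}\rangle$; it is a Hopf algebra for the coproduct sending $\mathsf{r}_{\mathbb{A}}(x)$ to $\theta_{\mathbb{A},\mathbb{A}}(\mathsf{r}_{\mathbb{A}+\mathbb{A}}(x))$, and $\mathsf{r}_{\mathbb{A}}$ is an isomorphism of Hopf algebras from $\mathbf{FdB}_{r,s}$ onto it. 3. The class of $\mathcal{S}$-forest-like alphabets, the disjoint sum, the maps $\mathsf{r}_A$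 and the alphabet $\mathbb{A}_{\mathcal{S},\mathbb{N}}$ form a polynomial realization of $\mathbf{FdB}_{r,s}$: the disjoint sum is associative (up to the canonical bijection), every $\mathsf{r}_A$ sends elements of degree $n$ to homogeneous polynomials of degree $n$, one has $\theta_{A,A'}(\mathsf{r}_{A+A'}(x))=(\mathsf{r}_A\otimes\mathsf{r}_{A'})(\Delta x)$ for all $A$, $A'$ and $x$, and $\mathsf{r}_{\mathbb{A}_{\mathcal{S},\mathbb{N}}}$ is injective. -/

import Mathlib

universe u u' v w w'
open scoped TensorProduct

/-- A nonsymmetric operad in sets: a set of operations `carrier` with an arity map, a unit and the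
full composition maps `y[z₁, …, z_n]`, `n = ar y`. -/
structure NSOperad where
  carrier : Type u
  ar : carrier → ℕ
  one : carrier
  comp : (y : carrier) → (Fin (ar y) → carrier) → carrier
  ar_one : ar one = 1
  ar_comp : ∀ y z, ar (comp y z) = ∑ i, ar (z i)
  one_comp : ∀ x, comp one (fun _ => x) = x
  comp_one : ∀ y, comp y (fun _ => one) = y
  assoc : ∀ (y : carrier) (z : Fin (ar y) → carrier) (w : Fin (ar (comp y z)) → carrier),
    comp (comp y z) w =
      comp y fun i => comp (z i) fun j =>
        w (Fin.cast (ar_comp y z).symm (finSigmaFinEquiv ⟨i, j⟩))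

namespace NSOperad

/-- The partial composition `x ∘ᵢ y = x[1, …, 1, y, 1, …, 1]`, with `y` in position `i`. -/
def pcomp (O : NSOperad.{u}) (x : O.carrier) (i : Fin (O.ar x)) (y : O.carrier) : O.carrier :=
  O.comp x fun k => if k = i then y else O.one

theorem comp_congr (O : NSOperad.{u}) {y y' : O.carrier} (h : y = y')
    (z : Fin (O.ar y) → O.carrier) (z' : Fin (O.ar y') → O.carrier)
    (hz : ∀ (i : Fin (O.ar y)) (i' : Fin (O.ar y')), (i : ℕ) = i' → z i = z' i') :
    O.comp y z = O.comp y' z' := by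
  subst h
  congr 1
  funext i
  exact hz i i rfl

/-- An operad congruence: an equivalence relation which is compatible with the arities and with the
composition maps. -/
structure Congruence (O : NSOperad.{u}) where
  rel : O.carrier → O.carrier → Prop
  iseqv : Equivalence rel
  ar_eq : ∀ {x y}, rel x y → O.ar x = O.ar y
  comp_rel : ∀ {y y'} (z : Fin (O.ar y) → O.carrier) (z' : Fin (O.ar y') → O.carrier), rel y y' →
    (∀ (i : Fin (O.ar y)) (i' : Fin (O.ar y')), (i : ℕ) = i' → rel (z i) (z' i')) →
    rel (O.comp y z) (O.comp y' z')

/-- The smallest relation containing `R` and satisfying the axioms of an operad congruence. -/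
inductive CongrGen (O : NSOperad.{u}) (R : O.carrier → O.carrier → Prop) :
    O.carrier → O.carrier → Prop
  | of {x y : O.carrier} : R x y → CongrGen O R x y
  | refl (x : O.carrier) : CongrGen O R x x
  | symm {x y : O.carrier} : CongrGen O R x y → CongrGen O R y x
  | trans {x y z : O.carrier} : CongrGen O R x y → CongrGen O R y z → CongrGen O R x z
  | comp {y y' : O.carrier} (z : Fin (O.ar y) → O.carrier) (z' : Fin (O.ar y') → O.carrier) :
      CongrGen O R y y' →
      (∀ (i : Fin (O.ar y)) (i' : Fin (O.ar y')), (i : ℕ) = i' → CongrGen O R (z i) (z' i')) →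
      CongrGen O R (O.comp y z) (O.comp y' z')

theorem sum_fin_eq {m n : ℕ} (h : m = n) (f : Fin m → ℕ) (g : Fin n → ℕ)
    (hfg : ∀ (i : Fin m) (i' : Fin n), (i : ℕ) = i' → f i = g i') : ∑ i, f i = ∑ i, g i := by
  subst h
  exact Finset.sum_congr rfl fun i _ => hfg i i rfl

/-- The operad congruence generated by an arity-preserving relation. -/
def congrGen (O : NSOperad.{u}) (R : O.carrier → O.carrier → Prop)
    (hR : ∀ x y, R x y → O.ar x = O.ar y) : O.Congruence where
  rel := CongrGen O R
  iseqv := ⟨.refl, .symm, .trans⟩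
  ar_eq := by
    intro x y h
    induction h with
    | of h => exact hR _ _ h
    | refl => rfl
    | symm _ ih => exact ih.symm
    | trans _ _ ih1 ih2 => exact ih1.trans ih2
    | comp z z' _ _ ih1 ih2 =>
      rw [O.ar_comp, O.ar_comp]
      exact sum_fin_eq ih1 _ _ ih2
  comp_rel := fun z z' h hz => .comp z z' h hz

namespace Congruence

variable {O : NSOperad.{u}} (C : O.Congruence)

/-- The equivalence relation underlying an operad congruence. -/
def toSetoid : Setoid O.carrier := ⟨C.rel, C.iseqv⟩

/-- The set of equivalence classes of an operad congruence. -/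
def Quo : Type u := Quotient C.toSetoid

/-- The equivalence class of an operation. -/
def cls (x : O.carrier) : C.Quo := Quotient.mk C.toSetoid x

/-- A representative of an equivalence class. -/
noncomputable def out (q : C.Quo) : O.carrier := Quotient.out q

theorem cls_out (q : C.Quo) : C.cls (C.out q) = q := Quotient.out_eq q

theorem cls_eq {x y : O.carrier} : C.cls x = C.cls y ↔ C.rel x y :=
  ⟨fun h => Quotient.exact (s := C.toSetoid) h, fun h => Quotient.sound (s := C.toSetoid) h⟩

theorem out_cls (x : O.carrier) : C.rel (C.out (C.cls x)) x := C.cls_eq.1 (C.cls_out _)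

/-- The arity of an equivalence class. -/
def quoAr : C.Quo → ℕ := Quotient.lift O.ar fun _ _ h => C.ar_eq h

theorem ar_out (q : C.Quo) : O.ar (C.out q) = C.quoAr q :=
  congrArg C.quoAr (C.cls_out q)

/-- The composition of equivalence classes, computed on representatives. -/
noncomputable def quoComp (q : C.Quo) (w : Fin (C.quoAr q) → C.Quo) : C.Quo :=
  C.cls (O.comp (C.out q) fun i => C.out (w (Fin.cast (C.ar_out q) i)))

/-- The composition of equivalence classes does not depend on the representatives. -/
theorem quoComp_cls (y : O.carrier) (z : Fin (O.ar y) → O.carrier)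
    (w : Fin (C.quoAr (C.cls y)) → C.Quo)
    (h : ∀ (i : Fin (C.quoAr (C.cls y))) (i' : Fin (O.ar y)), (i : ℕ) = i' → w i = C.cls (z i')) :
    C.quoComp (C.cls y) w = C.cls (O.comp y z) := by
  refine C.cls_eq.2 (C.comp_rel _ _ (C.out_cls y) fun i i' hi => ?_)
  rw [h _ i' (by simpa using hi)]
  exact C.out_cls _

theorem exists_rep (q : C.Quo) : ∃ x, q = C.cls x := ⟨_, (C.cls_out q).symm⟩

theorem quoAr_comp (q : C.Quo) (w : Fin (C.quoAr q) → C.Quo) :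
    C.quoAr (C.quoComp q w) = ∑ i, C.quoAr (w i) := by
  refine (O.ar_comp _ _).trans (sum_fin_eq (C.ar_out q) _ _ fun i i' h => ?_)
  rw [C.ar_out]
  congr 2
  exact Fin.ext h

/-- The quotient of an operad by an operad congruence. -/
noncomputable def quotient : NSOperad.{u} where
  carrier := C.Quo
  ar := C.quoAr
  one := C.cls O.one
  comp := C.quoComp
  ar_one := O.ar_one
  ar_comp := C.quoAr_comp
  one_comp := by
    intro q
    obtain ⟨x, rfl⟩ := C.exists_rep q
    rw [C.quoComp_cls O.one (fun _ => x) _ fun _ _ _ => rfl, O.one_comp]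
  comp_one := by
    intro q
    obtain ⟨x, rfl⟩ := C.exists_rep q
    rw [C.quoComp_cls x (fun _ => O.one) _ fun _ _ _ => rfl, O.comp_one]
  assoc := by
    intro q w v
    obtain ⟨y, rfl⟩ := C.exists_rep q
    have hw : w = fun i => C.cls (C.out (w i)) := funext fun i => (C.cls_out _).symm
    obtain ⟨z, hz⟩ : ∃ z : Fin (O.ar y) → O.carrier, (fun i => C.out (w i)) = z := ⟨_, rfl⟩
    have hw' : w = fun i => C.cls (z i) := by subst hz; exact hw
    clear hw hz
    subst hw'
    have e : C.quoComp (C.cls y) (fun i => C.cls (z i)) = C.cls (O.comp y z) :=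
      C.quoComp_cls y z _ fun i i' h => by rw [Fin.ext h]
    have har : O.ar (O.comp y z) = C.quoAr (C.quoComp (C.cls y) (fun i => C.cls (z i))) :=
      (congrArg C.quoAr e).symm
    have key : ∀ (q' : C.Quo) (hq : q' = C.cls (O.comp y z)) (v : Fin (C.quoAr q') → C.Quo),
        C.quoComp q' v = C.cls (O.comp (O.comp y z) fun i =>
          C.out (v (Fin.cast (congrArg C.quoAr hq).symm i))) := by
      intro q' hq v
      subst hq
      refine C.quoComp_cls _ _ _ fun i i' h => ?_
      rw [C.cls_out]
      congr 1
      exact Fin.ext h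
    refine (key _ e v).trans ((congrArg C.cls (O.assoc y z _)).trans ?_)
    symm
    refine C.quoComp_cls y _ _ fun i i' h => ?_
    obtain rfl : i = i' := Fin.ext h
    refine C.quoComp_cls (z i) _ _ fun j j' h => ?_
    obtain rfl : j = j' := Fin.ext h
    rw [C.cls_out]
    rfl

end Congruence

end NSOperad

/-! ## Terms -/

/-- Terms on a signature `S`, where `S n` is the set of generators of arity `n`: planar rooted trees
whose internal nodes with `n` children are decorated by elements of `S n`. -/
inductive STerm (S : ℕ → Type u) : Type u
  | leaf : STerm S
  | node {n : ℕ} (g : S n) (ts : Fin n → STerm S) : STerm S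

namespace STerm

variable {S : ℕ → Type u}

/-- The arity of a term: its number of leaves. -/
def ar : STerm S → ℕ
  | leaf => 1
  | node _ ts => ∑ i, ar (ts i)

/-- The degree of a term: its number of internal nodes. -/
def deg : STerm S → ℕ
  | leaf => 0
  | node _ ts => 1 + ∑ i, deg (ts i)

/-- Grafting `s i` onto the `i`-th leaf of `t`. -/
def graft : (t : STerm S) → (Fin t.ar → STerm S) → STerm S
  | leaf, s => s ⟨0, Nat.one_pos⟩
  | node g ts, s => node g fun i => graft (ts i) fun j => s (finSigmaFinEquiv ⟨i, j⟩)

/-- The term with a single internal node, decorated by `g`. -/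
def corolla {n : ℕ} (g : S n) : STerm S := node g fun _ => leaf

theorem sum_finSigma {m : ℕ} {n : Fin m → ℕ} (f : Fin (∑ i, n i) → ℕ) :
    ∑ p, f p = ∑ i, ∑ j, f (finSigmaFinEquiv ⟨i, j⟩) := by
  rw [← finSigmaFinEquiv.sum_comp, Fintype.sum_sigma]

theorem ar_graft (t : STerm S) (s : Fin t.ar → STerm S) : (graft t s).ar = ∑ i, (s i).ar := by
  induction t with
  | leaf => exact (Fin.sum_univ_one fun i : Fin 1 => (s i).ar).symm
  | node g ts ih =>
    refine (Finset.sum_congr rfl fun i _ => ih i _).trans ?_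
    exact (sum_finSigma (n := fun i => (ts i).ar) fun p => (s p).ar).symm

theorem deg_graft (t : STerm S) (s : Fin t.ar → STerm S) :
    (graft t s).deg = t.deg + ∑ i, (s i).deg := by
  induction t with
  | leaf =>
    refine Eq.trans ?_ (zero_add _).symm
    exact (Fin.sum_univ_one fun i : Fin 1 => (s i).deg).symm
  | node g ts ih =>
    refine (congrArg (1 + ·) (Finset.sum_congr rfl fun i _ => ih i _)).trans ?_
    rw [Finset.sum_add_distrib, ← add_assoc]
    refine congrArg (1 + ∑ i, (ts i).deg + ·) ?_
    exact (sum_finSigma (n := fun i => (ts i).ar) fun p => (s p).deg).symm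

theorem graft_leaf (t : STerm S) : graft t (fun _ => leaf) = t := by
  induction t with
  | leaf => rfl
  | node g ts ih =>
    change node g (fun i => graft (ts i) fun _ => leaf) = _
    simp_rw [ih]

theorem sum_fin_castLE {N : ℕ} (b : Fin N → ℕ) (p : ℕ) (hp : p ≤ N) :
    ∑ i : Fin p, b (Fin.castLE hp i) = ∑ i ∈ Finset.range p, if h : i < N then b ⟨i, h⟩ else 0 := by
  rw [Finset.sum_range]
  refine Finset.sum_congr rfl fun i _ => ?_
  rw [dif_pos (lt_of_lt_of_le i.2 hp)]
  rfl

/-- Comparison of the two ways of numbering the elements of an iterated sum. -/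
theorem finSigma_assoc {m : ℕ} {n : Fin m → ℕ} (a : Fin (∑ i, n i) → ℕ) (i : Fin m) (k : Fin (n i))
    (l : Fin (a (finSigmaFinEquiv ⟨i, k⟩))) (N : Fin m → ℕ)
    (hN : ∀ i, N i = ∑ k, a (finSigmaFinEquiv ⟨i, k⟩)) (l' : Fin (N i))
    (hl : (l' : ℕ) = finSigmaFinEquiv (n := fun k => a (finSigmaFinEquiv ⟨i, k⟩)) ⟨k, l⟩) :
    (finSigmaFinEquiv (n := N) ⟨i, l'⟩ : ℕ) =
      finSigmaFinEquiv (n := a) ⟨finSigmaFinEquiv ⟨i, k⟩, l⟩ := by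
  obtain rfl : N = _ := funext hN
  obtain rfl := Fin.ext hl
  set b : ℕ → ℕ := fun p => if h : p < ∑ i, n i then a ⟨p, h⟩ else 0 with hb
  have hoff : ∀ (i : Fin m), ∀ c, c ≤ n i →
      ∑ p ∈ Finset.range (∑ i' : Fin i, n (Fin.castLE i.2.le i') + c), b p =
      ∑ p ∈ Finset.range (∑ i' : Fin i, n (Fin.castLE i.2.le i')), b p +
        ∑ k ∈ Finset.range c, if h : k < n i then a (finSigmaFinEquiv ⟨i, ⟨k, h⟩⟩) else 0 := by
    intro i c hc
    rw [Finset.sum_range_add]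
    congr 1
    refine Finset.sum_congr rfl fun k hk => ?_
    have hk' : k < n i := lt_of_lt_of_le (Finset.mem_range.1 hk) hc
    rw [dif_pos hk']
    have hv := finSigmaFinEquiv_apply (n := n) ⟨i, ⟨k, hk'⟩⟩
    have hlt : ∑ i' : Fin i, n (Fin.castLE i.2.le i') + k < ∑ i, n i := by
      rw [← hv]; exact (finSigmaFinEquiv _).2
    simp only [hb]
    rw [dif_pos hlt]
    congr 1
    exact Fin.ext hv.symm
  have hfull : ∀ (c : ℕ) (hc : c ≤ m),
      ∑ p ∈ Finset.range (∑ i' : Fin c, n (Fin.castLE hc i')), b p =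
      ∑ i' : Fin c, ∑ k, a (finSigmaFinEquiv ⟨Fin.castLE hc i', k⟩) := by
    intro c
    induction c with
    | zero => intro _; simp
    | succ c ih =>
      intro hc
      rw [Fin.sum_univ_castSucc, Fin.sum_univ_castSucc]
      have h1 := hoff ⟨c, hc⟩ (n ⟨c, hc⟩) le_rfl
      refine h1.trans ?_
      congr 1
      · exact ih (Nat.le_of_succ_le hc)
      · rw [Finset.sum_range]
        refine Finset.sum_congr rfl fun k _ => ?_
        rw [dif_pos k.2]
        rfl
  rw [finSigmaFinEquiv_apply, finSigmaFinEquiv_apply, finSigmaFinEquiv_apply]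
  dsimp only
  rw [← add_assoc]
  congr 1
  rw [sum_fin_castLE a, sum_fin_castLE (fun k => a (finSigmaFinEquiv ⟨i, k⟩))]
  rw [finSigmaFinEquiv_apply]
  refine Eq.trans ?_ (hoff i k k.2.le).symm
  rw [hfull i i.2.le]

theorem graft_assoc (t : STerm S) (z : Fin t.ar → STerm S) (w : Fin (graft t z).ar → STerm S) :
    graft (graft t z) w = graft t fun i => graft (z i) fun j =>
      w (Fin.cast (ar_graft t z).symm (finSigmaFinEquiv ⟨i, j⟩)) := by
  induction t with
  | leaf =>
    change graft (z ⟨0, _⟩) w = graft (z ⟨0, _⟩) _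
    congr 1
    funext j
    congr 1
    refine Fin.ext ?_
    rw [Fin.val_cast]
    exact (finSigmaFinEquiv_one (n := fun i : Fin 1 => (z i).ar) ⟨0, j⟩).symm
  | node g ts ih =>
    change node g (fun i => graft (graft (ts i) _) _) = node g _
    congr 1
    funext i
    rw [ih]
    congr 1
    funext k
    congr 1
    funext l
    congr 1
    refine Fin.ext ?_
    exact finSigma_assoc (n := fun i => (ts i).ar) (fun p => (z p).ar) i k l _
      (fun i => ar_graft (ts i) _) _ rfl

end STerm

/-! ## Free operads and multi-multiassociative operads -/

/-- The free operad on the signature `S`. -/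
def freeOperad (S : ℕ → Type u) : NSOperad.{u} where
  carrier := STerm S
  ar := STerm.ar
  one := STerm.leaf
  comp := STerm.graft
  ar_one := rfl
  ar_comp := STerm.ar_graft
  one_comp := fun _ => rfl
  comp_one := STerm.graft_leaf
  assoc := STerm.graft_assoc

/-- `S` has profile `0^{r+1} s 0 0 …`: there are exactly `s` generators of arity `r + 1`, and no
generator of any other arity. -/
def HasProfile (S : ℕ → Type u) (r s : ℕ) : Prop :=
  ∀ n, Finite (S n) ∧ Nat.card (S n) = if n = r + 1 then s else 0

/-- The pairs `(g ∘ᵢ g', g' ∘ᵢ' g)` with `g`, `g'` generators. -/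
def masRel (S : ℕ → Type u) (x y : (freeOperad S).carrier) : Prop :=
  ∃ (n n' : ℕ) (g : S n) (g' : S n')
    (i : Fin ((freeOperad S).ar (STerm.corolla g))) (i' : Fin ((freeOperad S).ar (STerm.corolla g'))),
    x = (freeOperad S).pcomp (STerm.corolla g) i (STerm.corolla g') ∧
    y = (freeOperad S).pcomp (STerm.corolla g') i' (STerm.corolla g)

theorem NSOperad.ar_pcomp (O : NSOperad.{u}) (x : O.carrier) (i : Fin (O.ar x)) (y : O.carrier) :
    O.ar (O.pcomp x i y) + 1 = O.ar x + O.ar y := by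
  rw [NSOperad.pcomp, O.ar_comp, ← Finset.add_sum_erase _ _ (Finset.mem_univ i), if_pos rfl,
    Finset.sum_congr rfl (g := fun _ => 1)]
  · have := i.2
    simp
    omega
  · intro k hk
    rw [if_neg (Finset.ne_of_mem_erase hk), O.ar_one]

theorem masRel_ar (S : ℕ → Type u) (x y : (freeOperad S).carrier) (h : masRel S x y) :
    (freeOperad S).ar x = (freeOperad S).ar y := by
  obtain ⟨n, n', g, g', i, i', rfl, rfl⟩ := h
  have h1 := (freeOperad S).ar_pcomp (STerm.corolla g) i (STerm.corolla g')
  have h2 := (freeOperad S).ar_pcomp (STerm.corolla g') i' (STerm.corolla g)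
  omega

/-- The operad congruence generated by `g ∘ᵢ g' ≡ g' ∘ᵢ' g` for all generators `g`, `g'`. -/
def masCongr (S : ℕ → Type u) : (freeOperad S).Congruence :=
  (freeOperad S).congrGen (masRel S) (masRel_ar S)

/-- The multi-multiassociative operad on the signature `S`. -/
noncomputable def MAs (S : ℕ → Type u) : NSOperad.{u} := (masCongr S).quotient

theorem deg_pcomp_corolla {S : ℕ → Type u} {n n' : ℕ} (g : S n) (g' : S n')
    (i : Fin ((freeOperad S).ar (STerm.corolla g))) :
    STerm.deg ((freeOperad S).pcomp (STerm.corolla g) i (STerm.corolla g')) = 2 := by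
  have hc : ∀ {m : ℕ} (h : S m), (STerm.corolla h).deg = 1 := fun h =>
    (congrArg (1 + ·) (Finset.sum_eq_zero fun _ _ => rfl)).trans rfl
  have hs : ∀ {N : ℕ} (j : Fin N),
      ∑ k, STerm.deg (if k = j then STerm.corolla g' else STerm.leaf) = 1 := by
    intro N j
    rw [← Finset.add_sum_erase _ _ (Finset.mem_univ j), if_pos rfl, hc, Finset.sum_eq_zero fun k hk =>
      (congrArg STerm.deg (if_neg (Finset.ne_of_mem_erase hk))).trans rfl, add_zero]
  exact (STerm.deg_graft _ _).trans (congrArg₂ (· + ·) (hc g) (hs i))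

theorem masCongr_deg_aux {S : ℕ → Type u} {x y : (freeOperad S).carrier}
    (h : NSOperad.CongrGen (freeOperad S) (masRel S) x y) : STerm.deg x = STerm.deg y := by
  induction h with
  | of h =>
    obtain ⟨n, n', g, g', i, i', rfl, rfl⟩ := h
    exact (deg_pcomp_corolla g g' i).trans (deg_pcomp_corolla g' g i').symm
  | refl => rfl
  | symm _ ih => exact ih.symm
  | trans _ _ ih1 ih2 => exact ih1.trans ih2
  | comp z z' h _ ih1 ih2 =>
    refine (STerm.deg_graft _ _).trans (Eq.trans ?_ (STerm.deg_graft _ _).symm)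
    exact congrArg₂ (· + ·) ih1
      (NSOperad.sum_fin_eq ((masCongr S).ar_eq h) _ _ ih2)

theorem masCongr_deg {S : ℕ → Type u} {x y : STerm S} (h : (masCongr S).rel x y) :
    x.deg = y.deg := masCongr_deg_aux h

/-- The degree of an element of `MAs S`: the number of internal nodes of any representative. -/
def MAs.deg (S : ℕ → Type u) : (MAs S).carrier → ℕ :=
  Quotient.lift (s := (masCongr S).toSetoid) STerm.deg fun _ _ h => masCongr_deg h

/-- All equivalence classes of the congruence are finite. -/
def NSOperad.Congruence.FiniteType {O : NSOperad.{u}} (C : O.Congruence) : Prop :=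
  ∀ x, {y | C.rel x y}.Finite

/-! ## Natural Hopf algebras -/

namespace NSOperad

variable (K : Type v) [Field K] (O : NSOperad.{u})

/-- The factorizations `x = y[w₁, …, w_n]` of `x`. -/
def Factorization (x : O.carrier) : Type u :=
  {p : (y : O.carrier) × (Fin (O.ar y) → O.carrier) // O.comp p.1 p.2 = x}

/-- Every element has finitely many factorizations. -/
def FinitelyFactorizable : Prop := ∀ x, Finite (O.Factorization x)

/-- `dg` is a grading of the operad `O`. -/
def IsGrading (dg : O.carrier → ℕ) : Prop :=
  (∀ x, dg x = 0 ↔ x = O.one) ∧ ∀ y z, dg (O.comp y z) = dg y + ∑ i, dg (z i)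

/-- The elements of `O` that are not the unit. -/
abbrev NonUnit : Type u := {x : O.carrier // x ≠ O.one}

/-- Reduced words on `O`. -/
abbrev RedWord : Type u := FreeMonoid O.NonUnit

/-- The space with basis `E_w`, where `w` runs over the reduced words on `O`, with the product
`E_w · E_w' = E_{ww'}`. -/
abbrev Natural : Type (max u v) := MonoidAlgebra K O.RedWord

/-- The basis element `E_w`. -/
noncomputable def E {O : NSOperad.{u}} (w : O.RedWord) : O.Natural K := MonoidAlgebra.single w 1

open Classical in
/-- The reduced word obtained by deleting all the units in a word on `O`. -/
noncomputable def rd {O : NSOperad.{u}} (w : List O.carrier) : O.RedWord :=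
  FreeMonoid.ofList (w.filterMap fun x => if h : x ≠ O.one then some ⟨x, h⟩ else none)

/-- `∑ E_{rd y} ⊗ E_{rd w}` over the factorizations `x = y[w]` of `x`. -/
noncomputable def comulGen (x : O.carrier) : O.Natural K ⊗[K] O.Natural K :=
  ∑ᶠ p : O.Factorization x, E K (rd [p.1.1]) ⊗ₜ[K] E K (rd (List.ofFn p.1.2))

/-- The coproduct of the natural Hopf algebra. -/
noncomputable def comul : O.Natural K →ₐ[K] O.Natural K ⊗[K] O.Natural K :=
  MonoidAlgebra.lift K (O.Natural K ⊗[K] O.Natural K) O.RedWord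
    (FreeMonoid.lift fun x => O.comulGen K x.1)

/-- The counit of the natural Hopf algebra: `E_w` is sent to `1` if `w` is empty and to `0`
otherwise. -/
noncomputable def counit : O.Natural K →ₐ[K] K :=
  MonoidAlgebra.lift K K O.RedWord (FreeMonoid.lift fun _ => 0)

/-- The homogeneous component of degree `n` for the additive extension of `dg` to words. -/
noncomputable def homogeneous (dg : O.carrier → ℕ) (n : ℕ) : Submodule K (O.Natural K) :=
  Submodule.span K {x | ∃ w : O.RedWord, (w.toList.map fun y => dg y.1).sum = n ∧ x = E K w}

/-- The linear map `E_w ↦ ∑ E_f` from the natural Hopf algebra of a quotient `O/≡` to that of `O`,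
where `f` runs over the reduced words on `O` whose letters represent the letters of `w`. -/
noncomputable def quotEmbed {O : NSOperad.{u}} (C : O.Congruence) :
    C.quotient.Natural K →ₗ[K] O.Natural K :=
  (MonoidAlgebra.basis C.quotient.RedWord K).constr K fun w =>
    ∑ᶠ f ∈ {f : O.RedWord | f.toList.map (fun y => C.cls y.1) = w.toList.map Subtype.val}, E K f

end NSOperad

/-! ## Hopf algebras -/

section Hopf

variable {K : Type v} [Field K] {H : Type w} [Ring H] [Algebra K H] {H' : Type w'} [Ring H']
  [Algebra K H']

/-- The algebra `H` with the coproduct `Δ` and the counit `ε` is a Hopf algebra. -/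
structure IsHopfAlgebra (Δ : H →ₐ[K] H ⊗[K] H) (ε : H →ₐ[K] K) : Prop where
  coassoc : (Algebra.TensorProduct.assoc K K K H H H).toAlgHom.comp
      ((Algebra.TensorProduct.map Δ (.id K H)).comp Δ)
      = (Algebra.TensorProduct.map (.id K H) Δ).comp Δ
  rTensor_counit : (Algebra.TensorProduct.map ε (.id K H)).comp Δ
      = (Algebra.TensorProduct.lid K H).symm
  lTensor_counit : (Algebra.TensorProduct.map (.id K H) ε).comp Δ
      = (Algebra.TensorProduct.rid K K H).symm
  exists_antipode : ∃ α : H →ₗ[K] H,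
    LinearMap.mul' K H ∘ₗ α.rTensor H ∘ₗ Δ.toLinearMap = Algebra.linearMap K H ∘ₗ ε.toLinearMap ∧
    LinearMap.mul' K H ∘ₗ α.lTensor H ∘ₗ Δ.toLinearMap = Algebra.linearMap K H ∘ₗ ε.toLinearMap

/-- The bundled Hopf algebra given by `IsHopfAlgebra`. -/
@[reducible] noncomputable def IsHopfAlgebra.toHopfAlgebra {Δ : H →ₐ[K] H ⊗[K] H} {ε : H →ₐ[K] K}
    (h : IsHopfAlgebra Δ ε) : HopfAlgebra K H where
  toBialgebra := Bialgebra.ofAlgHom Δ ε h.coassoc h.rTensor_counit h.lTensor_counit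
  antipode := h.exists_antipode.choose
  mul_antipode_rTensor_comul := h.exists_antipode.choose_spec.1
  mul_antipode_lTensor_comul := h.exists_antipode.choose_spec.2

/-- The algebra isomorphism `φ` is compatible with the coproducts and with the counits. -/
structure IsHopfIso (Δ : H →ₐ[K] H ⊗[K] H) (ε : H →ₐ[K] K) (Δ' : H' →ₐ[K] H' ⊗[K] H')
    (ε' : H' →ₐ[K] K) (φ : H ≃ₐ[K] H') : Prop where
  map_comul : ∀ x, Δ' (φ x) = Algebra.TensorProduct.map φ.toAlgHom φ.toAlgHom (Δ x)
  map_counit : ∀ x, ε' (φ x) = ε x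

end Hopf

/-! ## Noncommutative polynomials with possibly infinite support -/

/-- Noncommutative series with variables in `A`: families of coefficients indexed by words. -/
def NCSeries (K : Type v) (A : Type u) : Type (max u v) := List A → K

namespace NCSeries

variable {K : Type v} [Field K] {A : Type u}

noncomputable instance : AddCommGroup (NCSeries K A) := inferInstanceAs (AddCommGroup (List A → K))

noncomputable instance : Module K (NCSeries K A) := inferInstanceAs (Module K (List A → K))

/-- The coefficient of a word in a series. -/
def coeff {K : Type v} {A : Type u} (f : NCSeries K A) (w : List A) : K := f w

@[ext] theorem ext {K : Type v} {A : Type u} {f g : NCSeries K A} (h : ∀ w, f.coeff w = g.coeff w) : f = g := funext h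

/-- The Cauchy product, extending the concatenation of words. -/
noncomputable instance : Mul (NCSeries K A) :=
  ⟨fun f g w => ∑ i ∈ Finset.range (w.length + 1), f (w.take i) * g (w.drop i)⟩

open Classical in
noncomputable instance : One (NCSeries K A) := ⟨fun w => if w = [] then 1 else 0⟩

theorem coeff_mul (f g : NCSeries K A) (w : List A) : (f * g).coeff w =
    ∑ i ∈ Finset.range (w.length + 1), f.coeff (w.take i) * g.coeff (w.drop i) := rfl

open Classical in
theorem coeff_one (w : List A) : (1 : NCSeries K A).coeff w = if w = [] then 1 else 0 := rfl

@[simp] theorem coeff_add (f g : NCSeries K A) (w : List A) :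
    (f + g).coeff w = f.coeff w + g.coeff w := rfl

@[simp] theorem coeff_zero (w : List A) : (0 : NCSeries K A).coeff w = 0 := rfl

@[simp] theorem coeff_smul (c : K) (f : NCSeries K A) (w : List A) :
    (c • f).coeff w = c * f.coeff w := rfl

theorem mul_assoc' (f g h : NCSeries K A) : f * g * h = f * (g * h) := by
  ext w
  simp only [coeff_mul, Finset.sum_mul, Finset.mul_sum]
  rw [Finset.sum_sigma', Finset.sum_sigma']
  refine Finset.sum_nbij' (fun p => ⟨p.2, p.1 - p.2⟩) (fun p => ⟨p.1 + p.2, p.1⟩) ?_ ?_ ?_ ?_ ?_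
  · rintro ⟨i, j⟩ h
    simp only [Finset.mem_sigma, Finset.mem_range, List.length_take, List.length_drop] at h ⊢
    omega
  · rintro ⟨i, j⟩ h
    simp only [Finset.mem_sigma, Finset.mem_range, List.length_take, List.length_drop] at h ⊢
    omega
  · rintro ⟨i, j⟩ h
    simp only [Finset.mem_sigma, Finset.mem_range, List.length_take] at h
    have : j + (i - j) = i := by omega
    simp [this]
  · rintro ⟨i, j⟩ h
    simp
  · rintro ⟨i, j⟩ h
    simp only [Finset.mem_sigma, Finset.mem_range, List.length_take] at h
    have h1 : j + (i - j) = i := by omega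
    have h2 : min j i = j := by omega
    rw [List.take_take, List.drop_take, List.drop_drop, h1, h2, mul_assoc]

theorem one_mul' (f : NCSeries K A) : 1 * f = f := by
  ext w
  rw [coeff_mul, Finset.sum_eq_single 0]
  · simp [coeff_one]
  · intro i hi h0
    rw [coeff_one, if_neg, zero_mul]
    intro h
    rw [List.take_eq_nil_iff] at h
    rcases h with h | h
    · exact h0 h
    · subst h
      simp at hi
      exact h0 hi
  · simp

theorem mul_one' (f : NCSeries K A) : f * 1 = f := by
  ext w
  rw [coeff_mul, Finset.sum_eq_single w.length]
  · simp [coeff_one]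
  · intro i hi h0
    rw [coeff_one, if_neg, mul_zero]
    intro h
    rw [List.drop_eq_nil_iff] at h
    rw [Finset.mem_range] at hi
    omega
  · simp

noncomputable instance : Ring (NCSeries K A) :=
  { (inferInstance : AddCommGroup (NCSeries K A)) with
    mul := (· * ·)
    one := 1
    mul_assoc := mul_assoc'
    one_mul := one_mul'
    mul_one := mul_one'
    zero_mul := fun f => by ext w; simp [coeff_mul]
    mul_zero := fun f => by ext w; simp [coeff_mul]
    left_distrib := fun f g h => by
      ext w; simp [coeff_mul, mul_add, Finset.sum_add_distrib]
    right_distrib := fun f g h => by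
      ext w; simp [coeff_mul, add_mul, Finset.sum_add_distrib] }

noncomputable instance : Algebra K (NCSeries K A) :=
  Algebra.ofModule
    (fun c f g => by ext w; simp [coeff_mul, Finset.mul_sum, mul_assoc])
    (fun c f g => by ext w; simp [coeff_mul, Finset.mul_sum, mul_left_comm])

end NCSeries

/-- The algebra `K⟨A⟩` of `A`-polynomials: the series of finite degree. -/
noncomputable def NCPoly (K : Type v) [Field K] (A : Type u) : Subalgebra K (NCSeries K A) where
  carrier := {f | ∃ d : ℕ, ∀ w : List A, d < w.length → f.coeff w = 0}
  mul_mem' := by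
    rintro f g ⟨d, hd⟩ ⟨e, he⟩
    refine ⟨d + e, fun w hw => ?_⟩
    rw [NCSeries.coeff_mul]
    refine Finset.sum_eq_zero fun i hi => ?_
    rw [Finset.mem_range] at hi
    by_cases h : d < i
    · rw [hd _ (by rw [List.length_take]; omega), zero_mul]
    · rw [he _ (by rw [List.length_drop]; omega), mul_zero]
  add_mem' := by
    rintro f g ⟨d, hd⟩ ⟨e, he⟩
    refine ⟨d + e, fun w hw => ?_⟩
    rw [NCSeries.coeff_add, hd w (by omega), he w (by omega), add_zero]
  algebraMap_mem' := by
    intro c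
    refine ⟨0, fun w hw => ?_⟩
    have hw' : w ≠ [] := by rintro rfl; simp at hw
    rw [Algebra.algebraMap_eq_smul_one, NCSeries.coeff_smul, NCSeries.coeff_one, if_neg hw',
      mul_zero]

namespace NCPoly

variable {K : Type v} [Field K] {A : Type u} {B : Type u'}

/-- A polynomial is homogeneous of degree `n` if it is supported on words of length `n`. -/
def IsHomogeneous (n : ℕ) (f : NCPoly K A) : Prop :=
  ∀ w : List A, w.length ≠ n → f.1.coeff w = 0

/-- The linear map sending a word `w` on `A ⊔ B` to `w_{|A} ⊗ w_{|B}`, extended to polynomials with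
infinite support. Its values are given by their coefficients on the pairs of words. -/
noncomputable def theta (f : NCPoly K (A ⊕ B)) (u : List A) (v : List B) : K :=
  ∑ᶠ w ∈ {w : List (A ⊕ B) | w.filterMap Sum.getLeft? = u ∧ w.filterMap Sum.getRight? = v},
    f.1.coeff w

/-- The coefficients of an element of `K⟨A⟩ ⊗ K⟨B⟩` on the pairs of words. -/
noncomputable def tensorCoeff :
    NCPoly K A ⊗[K] NCPoly K B →ₗ[K] (List A → List B → K) :=
  TensorProduct.lift (LinearMap.mk₂ K (fun f g u v => f.1.coeff u * g.1.coeff v)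
    (fun f f' g => by ext u v; simp [add_mul])
    (fun c f g => by ext u v; simp [mul_assoc])
    (fun f g g' => by ext u v; simp [mul_add])
    (fun c f g => by ext u v; simp [mul_left_comm]))

/-- An element of `K⟨A⟩ ⊗ K⟨B⟩` is determined by its coefficients. -/
theorem tensorCoeff_injective : Function.Injective (tensorCoeff (K := K) (A := A) (B := B)) := by
  classical
  rw [injective_iff_map_eq_zero]
  intro x hx
  let b := Module.Basis.ofVectorSpace K (NCPoly K B)
  obtain ⟨m, rfl⟩ := (TensorProduct.equivFinsuppOfBasisRight (M := NCPoly K A) b).symm.surjective x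
  suffices m = 0 by rw [this, map_zero]
  rw [TensorProduct.equivFinsuppOfBasisRight_symm_apply] at hx
  ext k u
  let c : List B → NCPoly K B →ₗ[K] K := fun v =>
    { toFun := fun f => f.1.coeff v, map_add' := fun _ _ => rfl, map_smul' := fun _ _ => rfl }
  have h : ∑ k ∈ m.support, (m k).1.coeff u • b k = 0 := by
    refine Subtype.ext (NCSeries.ext fun v => ?_)
    refine Eq.trans ?_ (congrFun (congrFun hx u) v)
    rw [Finsupp.sum, map_sum, Finset.sum_apply, Finset.sum_apply]
    refine (map_sum (c v) _ _).trans (Finset.sum_congr rfl fun k _ => ?_)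
    rw [map_smul]
    rfl
  by_cases hk : k ∈ m.support
  · exact linearIndependent_iff'.1 b.linearIndependent _ _ h k hk
  · rw [Finsupp.notMem_support_iff.1 hk]
    rfl

/-- Only finitely many words restrict to given words on `A` and on `B`. -/
theorem finite_theta (u : List A) (v : List B) :
    {w : List (A ⊕ B) | w.filterMap Sum.getLeft? = u ∧
      w.filterMap Sum.getRight? = v}.Finite := by
  induction u generalizing v with
  | nil =>
    induction v with
    | nil =>
      refine (Set.finite_singleton []).subset ?_
      rintro (_ | ⟨a | b, w⟩) ⟨h1, h2⟩ <;> simp at h1 h2 ⊢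
    | cons b v ihv =>
      refine (ihv.image (Sum.inr b :: ·)).subset ?_
      rintro (_ | ⟨a' | b', w⟩) ⟨h1, h2⟩ <;> simp_all
  | cons a u ihu =>
    induction v with
    | nil =>
      refine ((ihu []).image (Sum.inl a :: ·)).subset ?_
      rintro (_ | ⟨a' | b', w⟩) ⟨h1, h2⟩ <;> simp_all
    | cons b v ihv =>
      refine (((ihu (b :: v)).image (Sum.inl a :: ·)).union (ihv.image (Sum.inr b :: ·))).subset ?_
      rintro (_ | ⟨a' | b', w⟩) ⟨h1, h2⟩ <;> simp [List.filterMap_cons] at h1 h2 ⊢ <;> simp_all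

end NCPoly

/-! ## Forest-like alphabets and realizations -/

/-- An `S`-forest-like alphabet: a set with a unary root relation, a unary decoration relation for
each generator, and a binary `j`-edge relation for each `j ≥ 1`. -/
structure ForestAlphabet (S : ℕ → Type u) where
  carrier : Type u
  root : carrier → Prop
  deco : {n : ℕ} → S n → carrier → Prop
  edge : ℕ+ → carrier → carrier → Prop

namespace ForestAlphabet

variable {S : ℕ → Type u}

/-- The edge relations of the disjoint sum of two alphabets. -/
def sumEdge (A B : ForestAlphabet S) (j : ℕ+) : A.carrier ⊕ B.carrier → A.carrier ⊕ B.carrier → Prop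
  | .inl a, .inl a' => A.edge j a a'
  | .inr b, .inr b' => B.edge j b b'
  | .inl _, .inr b => B.root b
  | .inr _, .inl _ => False

/-- The disjoint sum of two alphabets. -/
def sum (A B : ForestAlphabet S) : ForestAlphabet S where
  carrier := A.carrier ⊕ B.carrier
  root := Sum.elim A.root B.root
  deco := fun g => Sum.elim (A.deco g) (B.deco g)
  edge := sumEdge A B

/-- The bijection `e` between two alphabets preserves and reflects all the relations. -/
structure IsIso (A B : ForestAlphabet S) (e : A.carrier ≃ B.carrier) : Prop where
  root_iff : ∀ a, B.root (e a) ↔ A.root a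
  deco_iff : ∀ {n : ℕ} (g : S n) (a : A.carrier), B.deco g (e a) ↔ A.deco g a
  edge_iff : ∀ (j : ℕ+) (a a' : A.carrier), B.edge j (e a) (e a') ↔ A.edge j a a'

/-- The alphabet of the letters `a_{g,i}`, with `g` a generator and `i` a natural number: all letters
are roots, `a_{g,i}` is decorated by `g` only, and there is a `j`-edge from `a_{g,i}` to `a_{g',i'}`
if and only if `i < i'`. -/
def lengthAlphabet (S : ℕ → Type u) : ForestAlphabet S where
  carrier := (Σ n, S n) × ℕ
  root := fun _ => True
  deco := fun {n} g a => a.1 = ⟨n, g⟩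
  edge := fun _ a a' => a.2 < a'.2

end ForestAlphabet

namespace STerm

variable {S : ℕ → Type u}

/-- The decorations of the internal nodes of a term, in preorder. -/
def nodes : STerm S → List (Σ n, S n)
  | leaf => []
  | node g ts => ⟨_, g⟩ :: (List.ofFn fun i => nodes (ts i)).flatten

/-- The position of the first internal node of the `i`-th child of `node g ts`, if there is one. -/
def offset {n : ℕ} (ts : Fin n → STerm S) (i : Fin n) : ℕ :=
  1 + ∑ k ∈ Finset.Iio i, (ts k).deg

/-- `t.Edge j a b` means that the internal node in position `b` of `t` is the `j`-th child of the
internal node in position `a`, positions being numbered from `0` in preorder. -/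
def Edge : STerm S → ℕ+ → ℕ → ℕ → Prop
  | leaf, _, _, _ => False
  | node _ ts, j, a, b => ∃ i,
      (ts i ≠ leaf ∧ (j : ℕ) = i + 1 ∧ a = 0 ∧ b = offset ts i) ∨
      (∃ a' b', Edge (ts i) j a' b' ∧ a = offset ts i + a' ∧ b = offset ts i + b')

end STerm

/-- Forests: words of terms. -/
abbrev SForest (S : ℕ → Type u) : Type u := List (STerm S)

namespace SForest

variable {S : ℕ → Type u}

/-- The degree of a forest: its number of internal nodes. -/
def deg (f : SForest S) : ℕ := (f.map STerm.deg).sum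

/-- The decorations of the internal nodes of a forest, in preorder. -/
def nodes (f : SForest S) : List (Σ n, S n) := f.flatMap STerm.nodes

/-- The internal node in position `a` of the forest is a root. -/
def IsRoot : SForest S → ℕ → Prop
  | [], _ => False
  | t :: f, a => (t ≠ STerm.leaf ∧ a = 0) ∨ ∃ a', IsRoot f a' ∧ a = t.deg + a'

/-- The internal node in position `b` of the forest is the `j`-th child of the internal node in
position `a`. -/
def Edge : SForest S → ℕ+ → ℕ → ℕ → Prop
  | [], _, _, _ => False
  | t :: f, j, a, b =>
      t.Edge j a b ∨ ∃ a' b', Edge f j a' b' ∧ a = t.deg + a' ∧ b = t.deg + b'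

/-- The word `w` is `f`-compatible. -/
structure Compatible (A : ForestAlphabet S) (w : List A.carrier) (f : SForest S) : Prop where
  length_eq : w.length = f.deg
  root : ∀ (i : ℕ) (a : A.carrier), f.IsRoot i → w[i]? = some a → A.root a
  deco : ∀ (i : ℕ) (a : A.carrier) (g : Σ n, S n), f.nodes[i]? = some g → w[i]? = some a →
    A.deco g.2 a
  edge : ∀ (i i' : ℕ) (j : ℕ+) (a a' : A.carrier), f.Edge j i i' → w[i]? = some a →
    w[i']? = some a' → A.edge j a a'

end SForest

/-- The forest underlying a reduced word on the free operad. -/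
def redForest {S : ℕ → Type u} (f : (freeOperad S).RedWord) : SForest S :=
  f.toList.map Subtype.val

open Classical in
/-- The sum of all the words on `A` that are `f`-compatible. -/
noncomputable def forestPoly (K : Type v) [Field K] {S : ℕ → Type u} (A : ForestAlphabet S)
    (f : SForest S) : NCPoly K A.carrier :=
  ⟨fun w => if SForest.Compatible A w f then 1 else 0, SForest.deg f, fun _ hw =>
    if_neg fun h => hw.ne' h.length_eq⟩

/-- The `A`-realization map on the natural Hopf algebra of the free operad. -/
noncomputable def realization (K : Type v) [Field K] {S : ℕ → Type u} (A : ForestAlphabet S) :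
    (freeOperad S).Natural K →ₗ[K] NCPoly K A.carrier :=
  (MonoidAlgebra.basis (freeOperad S).RedWord K).constr K fun f => forestPoly K A (redForest f)

/-- The `A`-realization map on the natural Hopf algebra of `MAs S`, the latter being embedded into
the natural Hopf algebra of the free operad. -/
noncomputable def masRealization (K : Type v) [Field K] {S : ℕ → Type u} (A : ForestAlphabet S) :
    (MAs S).Natural K →ₗ[K] NCPoly K A.carrier :=
  realization K A ∘ₗ NSOperad.quotEmbed K (masCongr S)

/-- The class of `S`-forest-like alphabets, the disjoint sum, the maps `r A` and the alphabet `𝔸`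
form a polynomial realization of the Hopf algebra `H`, with coproduct `Δ` and homogeneous components
`gr n`. -/
structure IsPolynomialRealization {K : Type v} [Field K] {S : ℕ → Type u} {H : Type w} [Ring H]
    [Algebra K H] (Δ : H →ₐ[K] H ⊗[K] H) (gr : ℕ → Submodule K H)
    (r : (A : ForestAlphabet S) → H →ₗ[K] NCPoly K A.carrier) (𝔸 : ForestAlphabet S) : Prop where
  sum_assoc : ∀ A B C : ForestAlphabet S,
    ForestAlphabet.IsIso ((A.sum B).sum C) (A.sum (B.sum C)) (Equiv.sumAssoc _ _ _)
  graded : ∀ (A : ForestAlphabet S) (n : ℕ), ∀ x ∈ gr n, NCPoly.IsHomogeneous n (r A x)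
  doubling : ∀ (A B : ForestAlphabet S) (x : H),
    NCPoly.theta (A := A.carrier) (B := B.carrier) (r (A.sum B) x) =
      NCPoly.tensorCoeff (TensorProduct.map (r A) (r B) (Δ x))
  injective : Function.Injective (r 𝔸)

/-!
The multiset of the decorations of the nodes of a tree is additive under grafting and constant on
the classes of `≡`, which are therefore finite, and the degree is its cardinality. When no generator
is a constant, the relations let a generator slide to any position, so that this multiset
determines the class of a tree. The antipode is the geometric series of `η ∘ ε - id`, which is
locally finite because the bialgebra is graded and connected.

Realizations are multiplicative, and so is `theta`, since a word that restricts to `u` on `A` and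
to `v` on `B` splits uniquely along a factorization of the word. The compatibility of the
realizations with the coproducts is thus checked on one tree `t`, by induction: the first letter of
a word is the one of the root of `t`; if it is in `B` then so is the whole word, which accounts for
the trivial factorization of `t`, and if it is in `A` then the other factorizations of `t` are the
tuples of factorizations of its children.

For the injectivity, number the nodes of a forest so that the indices increase along each tree and
decrease from one tree to the next. The resulting word is not compatible with a forest with fewer
trees, and if it is compatible with a forest with as many trees, then the trees of the two forests
have pairwise the same decorations, hence the same classes. The matrix of coefficients is thus
triangular, and its diagonal entries are positive integers.
-/

section OrderedProducts

theorem list_prod_ofFn_sum {R : Type*} [Semiring R] : ∀ {n : ℕ} (κ : Fin n → Type*)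
    [∀ i, Fintype (κ i)] (f : ∀ i, κ i → R),
    (List.ofFn fun i => ∑ k, f i k).prod = ∑ p : ∀ i, κ i, (List.ofFn fun i => f i (p i)).prod
  | 0, _, _, _ => by simp
  | n + 1, κ, _, f => by
    rw [List.ofFn_succ, List.prod_cons, list_prod_ofFn_sum fun i => κ i.succ, Finset.sum_mul_sum,
      ← Fintype.sum_prod_type', ← (Fin.consEquiv κ).sum_comp]
    refine Finset.sum_congr rfl fun p _ => ?_
    simp only [List.ofFn_succ, List.prod_cons, Fin.consEquiv_apply, Fin.cons_zero, Fin.cons_succ]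

theorem val_finSigmaFinEquiv_succ {n : ℕ} {m : Fin (n + 1) → ℕ} (i : Fin n) (j : Fin (m i.succ)) :
    (finSigmaFinEquiv ⟨i.succ, j⟩ : ℕ) =
      m 0 + finSigmaFinEquiv (n := fun i => m i.succ) ⟨i, j⟩ := by
  simp only [finSigmaFinEquiv_apply, ← add_assoc]
  exact congrArg (· + (j : ℕ)) (Fin.sum_univ_succ (n := i) fun i' => m (Fin.castLE i.succ.2.le i'))

theorem list_prod_ofFn_finSigma {M : Type*} [Monoid M] : ∀ {n : ℕ} (m : Fin n → ℕ) {N : ℕ}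
    (h : N = ∑ i, m i) (w : Fin N → M), (List.ofFn w).prod = (List.ofFn fun i =>
      (List.ofFn fun j => w (Fin.cast h.symm (finSigmaFinEquiv ⟨i, j⟩))).prod).prod
  | 0, _, _, rfl, _ => rfl
  | n + 1, m, N, h, w => by
    obtain rfl : N = m 0 + ∑ i : Fin n, m i.succ := h.trans (Fin.sum_univ_succ m)
    rw [List.ofFn_add, List.prod_append, List.ofFn_succ, List.prod_cons,
      list_prod_ofFn_finSigma (fun i => m i.succ) rfl]
    congr 1
    · congr 2
      funext j
      exact congrArg w (Fin.ext (finSigmaFinEquiv_apply (n := m) ⟨0, j⟩ ▸ by simp))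
    · congr 2
      funext i
      congr 2
      funext j
      exact congrArg w (Fin.ext (val_finSigmaFinEquiv_succ i j).symm)

theorem list_prod_ofFn_tmul {R A B : Type*} [CommSemiring R] [Semiring A] [Algebra R A]
    [Semiring B] [Algebra R B] : ∀ {n : ℕ} (f : Fin n → A) (g : Fin n → B),
    (List.ofFn fun i => f i ⊗ₜ[R] g i).prod = (List.ofFn f).prod ⊗ₜ[R] (List.ofFn g).prod
  | 0, _, _ => rfl
  | n + 1, f, g => by
    simp only [List.ofFn_succ, List.prod_cons, list_prod_ofFn_tmul fun i => f (Fin.succ i),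
      Algebra.TensorProduct.tmul_mul_tmul]

theorem map_list_prod_ofFn {M N F : Type*} [Monoid M] [Monoid N] [FunLike F M N]
    [MonoidHomClass F M N] (f : F) {n : ℕ} (x : Fin n → M) :
    f (List.ofFn x).prod = (List.ofFn fun i => f (x i)).prod := by
  rw [map_list_prod, List.map_ofFn]
  rfl

end OrderedProducts

namespace NSOperad

section Words

variable (K : Type v) [Field K] {O : NSOperad.{u}}

theorem rd_append (l l' : List O.carrier) : rd (l ++ l') = rd l * rd l' := by
  unfold rd
  rw [List.filterMap_append]
  rfl

theorem rd_singleton_one : rd [O.one] = 1 := by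
  unfold rd
  rw [List.filterMap_cons_none (by simp)]
  rfl

theorem rd_singleton_nonUnit (x : O.NonUnit) : rd [x.1] = FreeMonoid.of x := by
  unfold rd
  rw [List.filterMap_cons_some (b := x) (by simp [x.2])]
  rfl

theorem E_one : E K (1 : O.RedWord) = 1 := rfl

theorem E_mul (w w' : O.RedWord) : E K (w * w') = E K w * E K w' := by
  rw [E, E, E, MonoidAlgebra.single_mul_single, one_mul]

/-- The element `E_x` of the natural Hopf algebra, with the convention `E_1 = 1` which makes
`E_{rd(x₁ ⋯ x_n)}` the product of the `E_{x_i}`. -/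
noncomputable def letter (x : O.carrier) : O.Natural K := E K (rd [x])

theorem letter_one : letter K O.one = 1 := by
  rw [letter, rd_singleton_one, E_one]

theorem letter_nonUnit (x : O.NonUnit) : letter K x.1 = E K (FreeMonoid.of x) := by
  rw [letter, rd_singleton_nonUnit]

theorem E_rd (l : List O.carrier) : E K (rd l) = (l.map (letter K)).prod := by
  induction l with
  | nil => rfl
  | cons x l ih => rw [← List.singleton_append, rd_append, E_mul, ih]; rfl

theorem E_rd_ofFn {n : ℕ} (z : Fin n → O.carrier) :
    E K (rd (List.ofFn z)) = (List.ofFn fun i => letter K (z i)).prod := by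
  rw [E_rd, List.map_ofFn]
  rfl

theorem E_eq_prod (w : O.RedWord) : E K w = (w.toList.map fun x => letter K x.1).prod := by
  induction w using FreeMonoid.inductionOn' with
  | one => rfl
  | of_mul x w ih =>
    rw [E_mul, ih, FreeMonoid.toList_of_mul, List.map_cons, List.prod_cons, letter_nonUnit]

variable {K}

theorem Natural.linearMap_ext {M : Type*} [AddCommMonoid M] [Module K M] {f g : O.Natural K →ₗ[K] M}
    (h : ∀ w : O.RedWord, f (E K w) = g (E K w)) : f = g :=
  (MonoidAlgebra.basis O.RedWord K).ext fun w => by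
    rw [MonoidAlgebra.basis_apply]; exact h w

theorem Natural.algHom_ext {A : Type*} [Semiring A] [Algebra K A] {f g : O.Natural K →ₐ[K] A}
    (h : ∀ x : O.NonUnit, f (letter K x.1) = g (letter K x.1)) : f = g := by
  refine AlgHom.toLinearMap_injective (Natural.linearMap_ext fun w => ?_)
  simp only [AlgHom.toLinearMap_apply, E_eq_prod, map_list_prod, List.map_map, Function.comp_def, h]

end Words

section IteratedFactorizations

variable {O : NSOperad.{u}}

/-- The families indexed by the inputs of `p[q]` are the families of families indexed by the inputs
of the `q i`. -/
def arityCurry (p : O.carrier) (q : Fin (O.ar p) → O.carrier) :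
    (Fin (O.ar (O.comp p q)) → O.carrier) ≃ (∀ i, Fin (O.ar (q i)) → O.carrier) where
  toFun w i j := w (Fin.cast (O.ar_comp p q).symm (finSigmaFinEquiv ⟨i, j⟩))
  invFun v k := v (finSigmaFinEquiv.symm (Fin.cast (O.ar_comp p q) k)).1
    (finSigmaFinEquiv.symm (Fin.cast (O.ar_comp p q) k)).2
  left_inv w := by
    funext k
    dsimp only
    rw [Sigma.eta, Equiv.apply_symm_apply, Fin.cast_cast, Fin.cast_eq_self]
  right_inv v := by
    funext i j
    dsimp only
    rw [Fin.cast_cast, Fin.cast_eq_self, Equiv.symm_apply_apply]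

/-- The iterated factorizations `x = (p[q])[w]`. -/
def LeftFactorization (x : O.carrier) : Type u :=
  {t : Σ (p : O.carrier) (q : Fin (O.ar p) → O.carrier), (Fin (O.ar (O.comp p q)) → O.carrier) //
    O.comp (O.comp t.1 t.2.1) t.2.2 = x}

/-- The iterated factorizations `x = p[q₁[w₁], …, q_n[w_n]]`. -/
def RightFactorization (x : O.carrier) : Type u :=
  {t : Σ (p : O.carrier) (q : Fin (O.ar p) → O.carrier), (∀ i, Fin (O.ar (q i)) → O.carrier) //
    O.comp t.1 (fun i => O.comp (t.2.1 i) (t.2.2 i)) = x}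

/-- The associativity of the composition, as a bijection between iterated factorizations. -/
def leftEquivRight (x : O.carrier) : LeftFactorization x ≃ RightFactorization x :=
  Equiv.subtypeEquiv
    (Equiv.sigmaCongrRight fun p => Equiv.sigmaCongrRight fun q => arityCurry p q) fun t => by
      rw [O.assoc]; rfl

/-- A factorization `x = y[w]` followed by a factorization `y = p[q]`. -/
def leftFactorizationEquiv (x : O.carrier) :
    LeftFactorization x ≃ Σ p : O.Factorization x, O.Factorization p.1.1 where
  toFun t := ⟨⟨⟨O.comp t.1.1 t.1.2.1, t.1.2.2⟩, t.2⟩, ⟨⟨t.1.1, t.1.2.1⟩, rfl⟩⟩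
  invFun s := ⟨⟨s.2.1.1, s.2.1.2, fun i => s.1.1.2 (Fin.cast (congrArg O.ar s.2.2) i)⟩, by
    obtain ⟨⟨⟨y, w⟩, h⟩, ⟨⟨p, q⟩, h'⟩⟩ := s
    dsimp only at h' w
    subst h'
    exact h⟩
  left_inv _ := rfl
  right_inv s := by
    obtain ⟨⟨⟨y, w⟩, h⟩, ⟨⟨p, q⟩, h'⟩⟩ := s
    dsimp only at h' w
    subst h'
    rfl

/-- A factorization `x = p[z]` followed by factorizations of all the `z i`. -/
def rightFactorizationEquiv (x : O.carrier) :
    RightFactorization x ≃ Σ p : O.Factorization x, ∀ i, O.Factorization (p.1.2 i) where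
  toFun t := ⟨⟨⟨t.1.1, fun i => O.comp (t.1.2.1 i) (t.1.2.2 i)⟩, t.2⟩,
    fun i => ⟨⟨t.1.2.1 i, t.1.2.2 i⟩, rfl⟩⟩
  invFun s := ⟨⟨s.1.1.1, fun i => (s.2 i).1.1, fun i => (s.2 i).1.2⟩,
    (congrArg (O.comp s.1.1.1) (funext fun i => (s.2 i).2)).trans s.1.2⟩
  left_inv _ := rfl
  right_inv s := by
    obtain ⟨⟨⟨p, z⟩, h⟩, k⟩ := s
    obtain ⟨q, w, hk, rfl⟩ : ∃ (q : Fin (O.ar p) → O.carrier)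
      (w : ∀ i, Fin (O.ar (q i)) → O.carrier) (hk : ∀ i, O.comp (q i) (w i) = z i),
      k = fun i => ⟨⟨q i, w i⟩, hk i⟩ := ⟨_, _, _, rfl⟩
    obtain rfl : (fun i => O.comp (q i) (w i)) = z := funext hk
    rfl

end IteratedFactorizations

section TrivialFactorizations

variable {O : NSOperad.{u}} {dg : O.carrier → ℕ}

/-- The factorization `x = 1[x]`. -/
def oneFactorization (x : O.carrier) : O.Factorization x := ⟨⟨O.one, fun _ => x⟩, O.one_comp x⟩

/-- The factorization `x = x[1, …, 1]`. -/
def factorizationOne (x : O.carrier) : O.Factorization x := ⟨⟨x, fun _ => O.one⟩, O.comp_one x⟩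

theorem Factorization.eq_oneFactorization {x : O.carrier} (p : O.Factorization x)
    (h : p.1.1 = O.one) : p = oneFactorization x := by
  obtain ⟨⟨y, z⟩, hp⟩ := p
  obtain rfl : y = O.one := h
  have : Subsingleton (Fin (O.ar O.one)) := by rw [O.ar_one]; infer_instance
  have hz : z = fun _ => x := by
    funext i
    rw [← hp, ← O.one_comp (z i)]
    exact congrArg (O.comp O.one) (funext fun j => congrArg z (Subsingleton.elim i j))
  subst hz
  rfl

theorem Factorization.eq_factorizationOne {x : O.carrier} (p : O.Factorization x)
    (h : ∀ i, p.1.2 i = O.one) : p = factorizationOne x := by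
  obtain ⟨⟨y, z⟩, hp⟩ := p
  obtain rfl : z = fun _ => O.one := funext h
  obtain rfl : y = x := (O.comp_one y).symm.trans hp
  rfl

theorem IsGrading.factorization_one_eq (hg : O.IsGrading dg) (p : O.Factorization O.one) :
    p = oneFactorization O.one := by
  refine p.eq_oneFactorization ((hg.1 _).1 ?_)
  have hdeg : dg p.1.1 + ∑ i, dg (p.1.2 i) = 0 := by rw [← hg.2, p.2, (hg.1 _).2 rfl]
  exact (Nat.add_eq_zero_iff.1 hdeg).1

/-- A statistic on an operad which is additive under the full composition maps. -/
def IsAdditive {M : Type*} [AddCommMonoid M] (c : O.carrier → M) : Prop :=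
  ∀ y z, c (O.comp y z) = c y + ∑ i, c (z i)

theorem IsAdditive.finitelyFactorizable {M : Type*} [AddCommMonoid M] [PartialOrder M]
    [CanonicallyOrderedAdd M] [IsOrderedAddMonoid M] {c : O.carrier → M} (hc : IsAdditive c)
    (hfin : ∀ m, {x | c x ≤ m}.Finite) : O.FinitelyFactorizable := by
  intro x
  have : Finite {y | c y ≤ c x} := hfin (c x)
  have hsum (p : O.Factorization x) : c p.1.1 + ∑ i, c (p.1.2 i) = c x := by rw [← hc, p.2]
  have hle (p : O.Factorization x) (i) : c (p.1.2 i) ≤ c x := calc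
    c (p.1.2 i) ≤ ∑ i, c (p.1.2 i) := Finset.single_le_sum_of_canonicallyOrdered
      (f := fun i => c (p.1.2 i)) (Finset.mem_univ i)
    _ ≤ c x := hsum p ▸ le_add_self
  let parts (p : O.Factorization x) :
      Σ y : {y | c y ≤ c x}, (Fin (O.ar y.1) → {y | c y ≤ c x}) :=
    ⟨⟨p.1.1, hsum p ▸ le_self_add⟩, fun i => ⟨p.1.2 i, hle p i⟩⟩
  let forget (q : Σ y : {y | c y ≤ c x}, (Fin (O.ar y.1) → {y | c y ≤ c x})) :
      (y : O.carrier) × (Fin (O.ar y) → O.carrier) := ⟨q.1.1, fun i => (q.2 i).1⟩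
  exact Finite.of_injective parts fun p p' h => Subtype.ext (congrArg forget h)

end TrivialFactorizations

section Bialgebra

variable {K : Type v} [Field K] {O : NSOperad.{u}} {dg : O.carrier → ℕ}

theorem comulGen_eq_sum (x : O.carrier) [Fintype (O.Factorization x)] :
    O.comulGen K x = ∑ p : O.Factorization x,
      letter K p.1.1 ⊗ₜ[K] (List.ofFn fun i => letter K (p.1.2 i)).prod := by
  rw [comulGen, finsum_eq_sum_of_fintype]
  simp only [E_rd_ofFn, letter]

theorem comul_letter_nonUnit (x : O.NonUnit) : O.comul K (letter K x.1) = O.comulGen K x.1 := by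
  rw [letter_nonUnit, E, comul, MonoidAlgebra.lift_single, one_smul, FreeMonoid.lift_eval_of]

theorem counit_letter_of_ne_one {x : O.carrier} (hx : x ≠ O.one) :
    O.counit K (letter K x) = 0 := by
  rw [letter_nonUnit K ⟨x, hx⟩, E, counit, MonoidAlgebra.lift_single, one_smul,
    FreeMonoid.lift_eval_of]

theorem counit_prod_ofFn_letter {n : ℕ} (z : Fin n → O.carrier) {i : Fin n} (hi : z i ≠ O.one) :
    O.counit K (List.ofFn fun i => letter K (z i)).prod = 0 := by
  rw [map_list_prod_ofFn]
  exact List.prod_eq_zero (List.mem_ofFn.2 ⟨i, counit_letter_of_ne_one hi⟩)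

theorem prod_ofFn_letter_one (n : ℕ) : (List.ofFn fun _ : Fin n => letter K O.one).prod = 1 := by
  rw [letter_one, List.ofFn_const, List.prod_replicate, one_pow]

theorem comulGen_one (hg : O.IsGrading dg) : O.comulGen K O.one = 1 := by
  have : Unique (O.Factorization O.one) := ⟨⟨oneFactorization _⟩, hg.factorization_one_eq⟩
  rw [comulGen_eq_sum, Fintype.sum_unique, hg.factorization_one_eq default]
  exact congrArg₂ _ (letter_one K) (prod_ofFn_letter_one _)

theorem comul_letter (hg : O.IsGrading dg) (x : O.carrier) :
    O.comul K (letter K x) = O.comulGen K x := by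
  by_cases h : x = O.one
  · rw [h, letter_one, map_one, comulGen_one hg]
  · exact comul_letter_nonUnit ⟨x, h⟩

theorem comul_prod_ofFn_letter (hg : O.IsGrading dg) [∀ x, Fintype (O.Factorization x)] {n : ℕ}
    (z : Fin n → O.carrier) :
    O.comul K (List.ofFn fun i => letter K (z i)).prod = ∑ q : ∀ i, O.Factorization (z i),
      (List.ofFn fun i => letter K (q i).1.1).prod ⊗ₜ[K]
        (List.ofFn fun i => (List.ofFn fun j => letter K ((q i).1.2 j)).prod).prod := by
  simp only [map_list_prod_ofFn, comul_letter hg, comulGen_eq_sum]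
  rw [list_prod_ofFn_sum fun i => O.Factorization (z i)]
  simp only [list_prod_ofFn_tmul]

theorem comul_coassoc (hg : O.IsGrading dg) (hf : O.FinitelyFactorizable) :
    (Algebra.TensorProduct.assoc K K K (O.Natural K) (O.Natural K) (O.Natural K)).toAlgHom.comp
      ((Algebra.TensorProduct.map (O.comul K) (.id K (O.Natural K))).comp (O.comul K))
      = (Algebra.TensorProduct.map (.id K (O.Natural K)) (O.comul K)).comp (O.comul K) := by
  have (x : O.carrier) : Finite (O.Factorization x) := hf x
  have (x : O.carrier) : Fintype (O.Factorization x) := Fintype.ofFinite _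
  have (x : O.carrier) : Fintype (LeftFactorization x) := .ofEquiv _ (leftFactorizationEquiv x).symm
  have (x : O.carrier) : Fintype (RightFactorization x) :=
    .ofEquiv _ (rightFactorizationEquiv x).symm
  refine Natural.algHom_ext fun x => ?_
  simp only [AlgHom.comp_apply, comul_letter hg, comulGen_eq_sum, map_sum,
    Algebra.TensorProduct.map_tmul, AlgHom.id_apply, comul_prod_ofFn_letter hg,
    TensorProduct.sum_tmul, TensorProduct.tmul_sum]
  rw [← Fintype.sum_sigma', ← Fintype.sum_sigma', ← (leftFactorizationEquiv x.1).sum_comp,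
    ← (rightFactorizationEquiv x.1).sum_comp, ← (leftEquivRight x.1).sum_comp]
  refine Finset.sum_congr rfl fun t _ => ?_
  refine congrArg (fun c => letter K t.1.1 ⊗ₜ[K] (_ ⊗ₜ[K] c)) ?_
  exact list_prod_ofFn_finSigma _ (O.ar_comp t.1.1 t.1.2.1) fun k => letter K (t.1.2.2 k)

theorem rTensor_counit_comul (hf : O.FinitelyFactorizable) :
    (Algebra.TensorProduct.map (O.counit K) (.id K (O.Natural K))).comp (O.comul K)
      = (Algebra.TensorProduct.lid K (O.Natural K)).symm := by
  refine Natural.algHom_ext fun x => ?_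
  have := hf x.1
  have := Fintype.ofFinite (O.Factorization x.1)
  rw [AlgHom.comp_apply, comul_letter_nonUnit, comulGen_eq_sum, map_sum,
    Fintype.sum_eq_single (oneFactorization x.1)]
  · have hprod : ∀ {n : ℕ}, n = 1 →
        (List.ofFn fun _ : Fin n => letter K x.1).prod = letter K x.1 := by
      rintro _ rfl
      exact List.prod_singleton
    refine (Algebra.TensorProduct.map_tmul ..).trans (congrArg₂ (· ⊗ₜ[K] ·) ?_ (hprod O.ar_one))
    exact (congrArg (O.counit K) (letter_one K)).trans (map_one _)
  · intro p hp
    have hp1 : p.1.1 ≠ O.one := fun h => hp (p.eq_oneFactorization h)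
    rw [Algebra.TensorProduct.map_tmul, counit_letter_of_ne_one hp1, TensorProduct.zero_tmul]

theorem lTensor_counit_comul (hf : O.FinitelyFactorizable) :
    (Algebra.TensorProduct.map (.id K (O.Natural K)) (O.counit K)).comp (O.comul K)
      = (Algebra.TensorProduct.rid K K (O.Natural K)).symm := by
  refine Natural.algHom_ext fun x => ?_
  have := hf x.1
  have := Fintype.ofFinite (O.Factorization x.1)
  rw [AlgHom.comp_apply, comul_letter_nonUnit, comulGen_eq_sum, map_sum,
    Fintype.sum_eq_single (factorizationOne x.1)]
  · refine (Algebra.TensorProduct.map_tmul ..).trans (congrArg (letter K x.1 ⊗ₜ[K] ·) ?_)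
    exact (congrArg (O.counit K) (prod_ofFn_letter_one _)).trans (map_one _)
  · intro p hp
    obtain ⟨i, hi⟩ : ∃ i, p.1.2 i ≠ O.one := by
      by_contra! h
      exact hp (p.eq_factorizationOne h)
    rw [Algebra.TensorProduct.map_tmul, counit_prod_ofFn_letter _ hi, TensorProduct.tmul_zero]

end Bialgebra

end NSOperad

section Antipode

open Coalgebra WithConv

variable {R : Type v} [CommRing R] {H : Type w} [Ring H] [Bialgebra R H] {I : Type w'}

/-- The basis `b` of a bialgebra is homogeneous, with degrees `d`, for a connected grading of the
bialgebra. Only the compatibility of the grading with the coproduct is required. -/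
structure IsConnectedGradedBasis (b : Module.Basis I R H) (d : I → ℕ) : Prop where
  comul_mem : ∀ i, comul (R := R) (b i) ∈
    Submodule.span R {x | ∃ j k, d j + d k = d i ∧ x = b j ⊗ₜ[R] b k}
  algebraMap_counit : ∀ i, d i = 0 → algebraMap R H (counit (R := R) (b i)) = b i

variable (R H) in
/-- The difference `η ∘ ε - id` in the convolution algebra of a bialgebra. -/
noncomputable def convDefect : WithConv (H →ₗ[R] H) := 1 - toConv LinearMap.id

/-- The antipode of a connected graded bialgebra: the inverse `∑ (η ∘ ε - id)ⁿ` of the identity for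
the convolution product, the sum being finite on each element of the basis. -/
noncomputable def convInverse (b : Module.Basis I R H) (d : I → ℕ) : H →ₗ[R] H :=
  b.constr R fun i => (∑ n ∈ Finset.range (d i + 1), convDefect R H ^ n).ofConv (b i)

namespace IsConnectedGradedBasis

variable {b : Module.Basis I R H} {d : I → ℕ} (hb : IsConnectedGradedBasis b d)

include hb

theorem map_comul_eq {M : Type*} [AddCommGroup M] [Module R M] (i : I) {f g : H ⊗[R] H →ₗ[R] M}
    (h : ∀ j k, d j + d k = d i → f (b j ⊗ₜ b k) = g (b j ⊗ₜ b k)) :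
    f (comul (R := R) (b i)) = g (comul (R := R) (b i)) := by
  refine LinearMap.eqOn_span ?_ (hb.comul_mem i)
  rintro _ ⟨j, k, hjk, rfl⟩
  exact h j k hjk

theorem convDefect_pow_apply {n : ℕ} {i : I} (hi : d i < n) :
    (convDefect R H ^ n).ofConv (b i) = 0 := by
  induction n generalizing i with
  | zero => exact absurd hi (Nat.not_lt_zero _)
  | succ n ih =>
    rw [pow_succ]
    refine hb.map_comul_eq i
      (f := LinearMap.mul' R H ∘ₗ TensorProduct.map (convDefect R H ^ n).ofConv
        (convDefect R H).ofConv) (g := 0) fun j k hjk => ?_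
    change (convDefect R H ^ n).ofConv (b j) * (convDefect R H).ofConv (b k) = 0
    rcases Nat.eq_zero_or_pos (d k) with hk | hk
    · have hdefect : (convDefect R H).ofConv (b k) = 0 := sub_eq_zero.2 (hb.algebraMap_counit k hk)
      rw [hdefect, mul_zero]
    · rw [ih (by omega), zero_mul]

theorem convInverse_apply {N : ℕ} {i : I} (hi : d i ≤ N) :
    convInverse b d (b i) = (∑ n ∈ Finset.range (N + 1), convDefect R H ^ n).ofConv (b i) := by
  rw [convInverse, b.constr_basis, ofConv_sum, ofConv_sum, LinearMap.sum_apply,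
    LinearMap.sum_apply]
  refine Finset.sum_subset (Finset.range_subset_range.2 (by omega)) fun n _ hn => ?_
  rw [Finset.mem_range] at hn
  exact hb.convDefect_pow_apply (by omega)

theorem one_sub_convDefect_pow_apply (i : I) :
    (1 - convDefect R H ^ (d i + 1)).ofConv (b i) = (Algebra.linearMap R H ∘ₗ counit) (b i) := by
  rw [ofConv_sub, LinearMap.sub_apply, hb.convDefect_pow_apply (Nat.lt_succ_self _), sub_zero]
  rfl

theorem mul_convInverse_rTensor_comul :
    LinearMap.mul' R H ∘ₗ (convInverse b d).rTensor H ∘ₗ comul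
      = Algebra.linearMap R H ∘ₗ counit := by
  refine b.ext fun i => ?_
  have hid : 1 - convDefect R H = toConv LinearMap.id := sub_sub_cancel _ _
  rw [← hb.one_sub_convDefect_pow_apply, ← geom_sum_mul_neg, hid]
  refine hb.map_comul_eq i (f := LinearMap.mul' R H ∘ₗ (convInverse b d).rTensor H)
    (g := LinearMap.mul' R H ∘ₗ TensorProduct.map
      (∑ n ∈ Finset.range (d i + 1), convDefect R H ^ n).ofConv LinearMap.id) fun j k hjk => ?_
  exact congrArg (· * b k) (hb.convInverse_apply (by omega))

theorem mul_convInverse_lTensor_comul :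
    LinearMap.mul' R H ∘ₗ (convInverse b d).lTensor H ∘ₗ comul
      = Algebra.linearMap R H ∘ₗ counit := by
  refine b.ext fun i => ?_
  have hid : 1 - convDefect R H = toConv LinearMap.id := sub_sub_cancel _ _
  rw [← hb.one_sub_convDefect_pow_apply, ← mul_neg_geom_sum, hid]
  refine hb.map_comul_eq i (f := LinearMap.mul' R H ∘ₗ (convInverse b d).lTensor H)
    (g := LinearMap.mul' R H ∘ₗ TensorProduct.map LinearMap.id
      (∑ n ∈ Finset.range (d i + 1), convDefect R H ^ n).ofConv) fun j k hjk => ?_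
  exact congrArg (b j * ·) (hb.convInverse_apply (by omega))

end IsConnectedGradedBasis

end Antipode

namespace NSOperad

section Grading

variable {O : NSOperad.{u}} {dg : O.carrier → ℕ}

/-- The additive extension of `dg` to reduced words. -/
def wordDeg (dg : O.carrier → ℕ) (w : O.RedWord) : ℕ := (w.toList.map fun y => dg y.1).sum

theorem wordDeg_mul (w w' : O.RedWord) : wordDeg dg (w * w') = wordDeg dg w + wordDeg dg w' := by
  simp only [wordDeg, FreeMonoid.toList_mul, List.map_append, List.sum_append]

theorem wordDeg_of (x : O.NonUnit) : wordDeg dg (FreeMonoid.of x) = dg x.1 := by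
  simp only [wordDeg, FreeMonoid.toList_of, List.map_singleton, List.sum_singleton]

theorem IsGrading.wordDeg_rd_singleton (hg : O.IsGrading dg) (x : O.carrier) :
    wordDeg dg (rd [x]) = dg x := by
  by_cases h : x = O.one
  · rw [h, rd_singleton_one, (hg.1 _).2 rfl]; rfl
  · rw [rd_singleton_nonUnit ⟨x, h⟩, wordDeg_of]

theorem IsGrading.wordDeg_rd (hg : O.IsGrading dg) (l : List O.carrier) :
    wordDeg dg (rd l) = (l.map dg).sum := by
  induction l with
  | nil => rfl
  | cons x l ih =>
    rw [← List.singleton_append, rd_append, wordDeg_mul, ih, hg.wordDeg_rd_singleton,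
      List.map_append, List.sum_append, List.map_singleton, List.sum_singleton]

theorem IsGrading.eq_one_of_wordDeg_eq_zero (hg : O.IsGrading dg) {w : O.RedWord}
    (h : wordDeg dg w = 0) : w = 1 := by
  induction w using FreeMonoid.inductionOn' with
  | one => rfl
  | of_mul x w _ =>
    rw [wordDeg_mul, wordDeg_of] at h
    exact absurd ((hg.1 x.1).1 (by omega)) x.2

variable {K : Type v} [Field K]

theorem IsGrading.comulGen_mem (hg : O.IsGrading dg) (hf : O.FinitelyFactorizable)
    (x : O.carrier) : O.comulGen K x ∈ Submodule.span K {y | ∃ j k : O.RedWord,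
      wordDeg dg j + wordDeg dg k = dg x ∧ y = E K j ⊗ₜ[K] E K k} := by
  have := hf x
  have := Fintype.ofFinite (O.Factorization x)
  rw [comulGen, finsum_eq_sum_of_fintype]
  refine Submodule.sum_mem _ fun p _ => Submodule.subset_span ⟨_, _, ?_, rfl⟩
  rw [hg.wordDeg_rd_singleton, hg.wordDeg_rd, List.map_ofFn, List.sum_ofFn]
  exact (hg.2 p.1.1 p.1.2).symm.trans (congrArg dg p.2)

theorem IsGrading.comul_E_mem (hg : O.IsGrading dg) (hf : O.FinitelyFactorizable) (w : O.RedWord) :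
    O.comul K (E K w) ∈ Submodule.span K {x | ∃ j k : O.RedWord,
      wordDeg dg j + wordDeg dg k = wordDeg dg w ∧ x = E K j ⊗ₜ[K] E K k} := by
  induction w using FreeMonoid.inductionOn' with
  | one =>
    rw [E_one, map_one]
    exact Submodule.subset_span ⟨1, 1, rfl, rfl⟩
  | of_mul x w ih =>
    have hx := hg.comulGen_mem (K := K) hf x.1
    have hmul := Submodule.mul_mem_mul hx ih
    rw [Submodule.span_mul_span] at hmul
    rw [E_mul, map_mul, ← letter_nonUnit, comul_letter_nonUnit]
    refine Submodule.span_mono ?_ hmul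
    rintro _ ⟨_, ⟨j, k, hjk, rfl⟩, _, ⟨j', k', hjk', rfl⟩, rfl⟩
    refine ⟨j * j', k * k', ?_, ?_⟩
    · simp only [wordDeg_mul, wordDeg_of]; omega
    · simp only [Algebra.TensorProduct.tmul_mul_tmul, E_mul]

theorem IsGrading.isHopfAlgebra (hg : O.IsGrading dg) (hf : O.FinitelyFactorizable) :
    IsHopfAlgebra (O.comul K) (O.counit K) where
  coassoc := comul_coassoc hg hf
  rTensor_counit := rTensor_counit_comul hf
  lTensor_counit := lTensor_counit_comul hf
  exists_antipode := by
    let _ : Bialgebra K (O.Natural K) := Bialgebra.ofAlgHom (O.comul K) (O.counit K)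
      (comul_coassoc hg hf) (rTensor_counit_comul hf) (lTensor_counit_comul hf)
    let b := MonoidAlgebra.basis O.RedWord K
    have hE : ∀ w, b w = E K w := fun w => MonoidAlgebra.basis_apply ..
    have hb : IsConnectedGradedBasis b (wordDeg dg) :=
      { comul_mem := fun w => by
          simp only [hE]
          exact hg.comul_E_mem hf w
        algebraMap_counit := fun w hw => by
          rw [hE, hg.eq_one_of_wordDeg_eq_zero hw, E_one]
          exact (congrArg _ (map_one (O.counit K))).trans (map_one _) }
    exact ⟨_, hb.mul_convInverse_rTensor_comul, hb.mul_convInverse_lTensor_comul⟩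

end Grading

end NSOperad

section Content

namespace NSOperad

variable {O : NSOperad.{u}} {M : Type*} [AddCommMonoid M] {c : O.carrier → M}

theorem sum_congr_of_val_eq {m n : ℕ} (h : m = n) (f : Fin m → M) (g : Fin n → M)
    (hfg : ∀ (i : Fin m) (i' : Fin n), (i : ℕ) = i' → f i = g i') : ∑ i, f i = ∑ i, g i :=
  Fintype.sum_equiv (finCongr h) f g fun i => hfg i _ rfl

theorem IsAdditive.pcomp (hc : IsAdditive c) (h1 : c O.one = 0) (x : O.carrier)
    (i : Fin (O.ar x)) (y : O.carrier) : c (O.pcomp x i y) = c x + c y := by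
  rw [NSOperad.pcomp, hc, Fintype.sum_eq_single i, if_pos rfl]
  intro k hk
  rw [if_neg hk, h1]

theorem IsAdditive.eq_of_congrGen (hc : IsAdditive c) {R : O.carrier → O.carrier → Prop}
    (har : ∀ x y, R x y → O.ar x = O.ar y) (hR : ∀ x y, R x y → c x = c y) {x y : O.carrier}
    (h : CongrGen O R x y) : c x = c y := by
  induction h with
  | of h => exact hR _ _ h
  | refl => rfl
  | symm _ ih => exact ih.symm
  | trans _ _ ih ih' => exact ih.trans ih'
  | comp z z' h _ ih ih' =>
    rw [hc, hc, ih, sum_congr_of_val_eq ((O.congrGen R har).ar_eq h) _ _ ih']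

theorem IsAdditive.lift (hc : IsAdditive c) (C : O.Congruence)
    (hrel : ∀ x y, C.rel x y → c x = c y) :
    IsAdditive (O := C.quotient) (Quotient.lift (s := C.toSetoid) c hrel) := by
  intro y z
  obtain ⟨t, rfl⟩ := C.exists_rep y
  have hcomp := C.quoComp_cls t (fun i => C.out (z i)) z fun i i' hi =>
    (congrArg z (Fin.ext hi)).trans (C.cls_out (z i')).symm
  refine (congrArg (Quotient.lift c hrel) hcomp).trans ((hc _ _).trans ?_)
  exact congrArg (c t + ·) (Finset.sum_congr rfl fun i _ =>
    congrArg (Quotient.lift c hrel) (C.cls_out (z i)))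

end NSOperad

namespace STerm

variable {S : ℕ → Type u}

/-- The multiset of the decorations of the internal nodes of a term. -/
def content (t : STerm S) : Multiset (Σ n, S n) := t.nodes

theorem content_node {n : ℕ} (g : S n) (ts : Fin n → STerm S) :
    content (node g ts) = ⟨n, g⟩ ::ₘ ∑ i, content (ts i) := by
  have hflatten : ∀ {n : ℕ} (l : Fin n → List (Σ n, S n)),
      ((List.ofFn l).flatten : Multiset (Σ n, S n)) = ∑ i, (l i : Multiset (Σ n, S n)) := by
    intro n l
    induction n with
    | zero => rfl
    | succ n ih =>
      rw [List.ofFn_succ, List.flatten_cons, ← Multiset.coe_add, ih, Fin.sum_univ_succ]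
  rw [content, nodes, ← Multiset.cons_coe, hflatten]
  rfl

theorem content_graft (t : STerm S) (s : Fin t.ar → STerm S) :
    content (graft t s) = content t + ∑ i, content (s i) := by
  induction t with
  | leaf =>
    exact (Fin.sum_univ_one fun i : Fin 1 => content (s i)).symm.trans (zero_add _).symm
  | node g ts ih =>
    have hsum : ∑ p : Fin (∑ i, (ts i).ar), content (s p) =
        ∑ i, ∑ j, content (s (finSigmaFinEquiv (n := fun i => (ts i).ar) ⟨i, j⟩)) := by
      rw [← Fintype.sum_sigma', ← finSigmaFinEquiv.sum_comp]
    rw [graft, content_node, content_node, Multiset.cons_add]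
    simp only [ih, Finset.sum_add_distrib]
    exact congrArg (fun m => _ ::ₘ (_ + m)) hsum.symm

theorem isAdditive_content : NSOperad.IsAdditive (O := freeOperad S) content := content_graft

theorem finite_setOf_content_le (m : Multiset (Σ n, S n)) :
    {t : STerm S | t.content ≤ m}.Finite := by
  classical
  induction m using Multiset.strongInductionOn with
  | ih m ih =>
    have hfin : (⋃ g ∈ m.toFinset, node g.2 '' Set.univ.pi fun _ : Fin g.1 =>
        {t : STerm S | t.content ≤ m.erase g}).Finite :=
      m.toFinset.finite_toSet.biUnion fun g hg =>
        (Set.Finite.pi fun _ => ih _ (Multiset.erase_lt.2 (Multiset.mem_toFinset.1 hg))).image _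
    refine ((Set.finite_singleton leaf).union hfin).subset fun t ht => ?_
    cases t with
    | leaf => exact Or.inl rfl
    | @node n g ts =>
      obtain ⟨m, rfl⟩ := Multiset.le_iff_exists_add.1 ((content_node g ts).symm.trans_le ht)
      refine Or.inr (Set.mem_biUnion (x := (⟨n, g⟩ : Σ n, S n)) ?_ ⟨ts, fun i _ => ?_, rfl⟩)
      · simp
      · rw [Set.mem_ofPred_eq, Multiset.cons_add, Multiset.erase_cons_head]
        exact (Finset.single_le_sum_of_canonicallyOrdered (f := fun i => content (ts i))
          (Finset.mem_univ i)).trans le_self_add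

theorem deg_eq_zero {t : STerm S} : t.deg = 0 ↔ t = leaf := by
  cases t with
  | leaf => exact iff_of_true rfl rfl
  | node g ts => exact iff_of_false (by rw [deg]; omega) nofun

end STerm

section MultiMultiassociative

variable {S : ℕ → Type u}

theorem masCongr_content {x y : STerm S} (h : (masCongr S).rel x y) : x.content = y.content := by
  refine STerm.isAdditive_content.eq_of_congrGen (masRel_ar S) ?_ h
  rintro _ _ ⟨n, n', g, g', i, i', rfl, rfl⟩
  exact (STerm.isAdditive_content.pcomp rfl _ _ _).trans
    ((add_comm _ _).trans (STerm.isAdditive_content.pcomp rfl _ _ _).symm)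

theorem masCongr_finiteType : (masCongr S).FiniteType := fun x =>
  (STerm.finite_setOf_content_le (STerm.content x)).subset fun _ h => (masCongr_content h).ge

theorem masCongr_rel_leaf {t : STerm S} : (masCongr S).rel t STerm.leaf ↔ t = STerm.leaf :=
  ⟨fun h => STerm.deg_eq_zero.1 (masCongr_deg h), fun h => h ▸ (masCongr S).iseqv.refl _⟩

theorem freeOperad_isGrading (S : ℕ → Type u) : (freeOperad S).IsGrading STerm.deg :=
  ⟨fun _ => STerm.deg_eq_zero, STerm.deg_graft⟩

theorem MAs.isGrading (S : ℕ → Type u) : (MAs S).IsGrading (MAs.deg S) := by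
  have hdeg : NSOperad.IsAdditive (O := freeOperad S) STerm.deg := STerm.deg_graft
  refine ⟨fun x => ?_, hdeg.lift (masCongr S) fun _ _ => masCongr_deg⟩
  obtain ⟨t, rfl⟩ := (masCongr S).exists_rep x
  exact (STerm.deg_eq_zero (t := t)).trans
    (masCongr_rel_leaf.symm.trans (masCongr S).cls_eq.symm)

theorem freeOperad_finitelyFactorizable (S : ℕ → Type u) : (freeOperad S).FinitelyFactorizable :=
  STerm.isAdditive_content.finitelyFactorizable STerm.finite_setOf_content_le

theorem MAs.finitelyFactorizable (S : ℕ → Type u) : (MAs S).FinitelyFactorizable := by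
  refine (STerm.isAdditive_content.lift (masCongr S) fun _ _ =>
    masCongr_content).finitelyFactorizable fun m => ?_
  refine ((STerm.finite_setOf_content_le m).image (masCongr S).cls).subset fun x hx => ?_
  obtain ⟨t, rfl⟩ := (masCongr S).exists_rep x
  exact ⟨t, hx, rfl⟩

end MultiMultiassociative

end Content

section Preorder

theorem sum_Iio_fin_zero {M : Type*} [AddCommMonoid M] {n : ℕ} (d : Fin (n + 1) → M) :
    ∑ k ∈ Finset.Iio 0, d k = 0 :=
  Finset.sum_eq_zero fun k hk => absurd (Finset.mem_Iio.1 hk) (Fin.not_lt_zero k)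

theorem sum_Iio_fin_succ {M : Type*} [AddCommMonoid M] {n : ℕ} (d : Fin (n + 1) → M) (i : Fin n) :
    ∑ k ∈ Finset.Iio i.succ, d k = d 0 + ∑ k ∈ Finset.Iio i, d k.succ := by
  have h : ∀ {m : ℕ} (j : Fin m) (e : Fin m → M),
      ∑ k ∈ Finset.Iio j, e k = ∑ k, if k < j then e k else 0 := by
    intro m j e
    rw [← Finset.sum_filter]
    congr 1
    ext
    simp
  rw [h, h, Fin.sum_univ_succ]
  simp

theorem sum_Iio_add_le_sum {n : ℕ} (d : Fin n → ℕ) (i : Fin n) :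
    ∑ k ∈ Finset.Iio i, d k + d i ≤ ∑ k, d k := by
  rw [add_comm, ← Finset.sum_insert (by simp)]
  exact Finset.sum_le_sum_of_subset (Finset.subset_univ _)

theorem getElem?_flatten_ofFn {α : Type*} : ∀ {n : ℕ} (L : Fin n → List α) (m : ℕ) (a : α),
    (List.ofFn L).flatten[m]? = some a ↔
      ∃ i k, m = ∑ j ∈ Finset.Iio i, (L j).length + k ∧ (L i)[k]? = some a
  | 0, L, m, a => by simp
  | n + 1, L, m, a => by
    rw [List.ofFn_succ, List.flatten_cons, Fin.exists_fin_succ, List.getElem?_append]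
    simp only [sum_Iio_fin_zero, sum_Iio_fin_succ fun j => (L j).length, zero_add]
    split_ifs with h
    · refine ⟨fun hm => Or.inl ⟨m, rfl, hm⟩, ?_⟩
      rintro (⟨k, rfl, hk⟩ | ⟨i, k, rfl, -⟩)
      · exact hk
      · omega
    · rw [getElem?_flatten_ofFn fun i => L i.succ]
      constructor
      · rintro ⟨i, k, h1, h2⟩
        exact Or.inr ⟨i, k, by omega, h2⟩
      · rintro (⟨k, rfl, h1⟩ | ⟨i, k, rfl, h1⟩)
        · exact absurd (List.getElem?_eq_some_iff.1 h1).1 h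
        · exact ⟨i, k, by omega, h1⟩

theorem getElem?_take_eq_some {α : Type*} {w : List α} {d i : ℕ} {a : α} :
    (w.take d)[i]? = some a ↔ i < d ∧ w[i]? = some a := by
  rw [List.getElem?_take]
  split_ifs with h <;> simp [h]

namespace STerm

variable {S : ℕ → Type u}

theorem deg_pos {t : STerm S} (ht : t ≠ leaf) : 0 < t.deg :=
  Nat.pos_of_ne_zero fun h => ht (deg_eq_zero.1 h)

theorem offset_add_deg_le {n : ℕ} (g : S n) (ts : Fin n → STerm S) (i : Fin n) :
    offset ts i + (ts i).deg ≤ (node g ts).deg := by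
  have := sum_Iio_add_le_sum (fun i => (ts i).deg) i
  simp only [offset, deg] at this ⊢
  omega

theorem length_nodes (t : STerm S) : t.nodes.length = t.deg := by
  induction t with
  | leaf => rfl
  | node g ts ih =>
    simp only [nodes, deg, List.length_cons, List.length_flatten, List.map_ofFn, List.sum_ofFn,
      Function.comp_def, ih]
    omega

theorem getElem?_nodes_node {n : ℕ} (g : S n) (ts : Fin n → STerm S) (m : ℕ) (h : Σ n, S n) :
    (node g ts).nodes[m]? = some h ↔
      (m = 0 ∧ h = ⟨n, g⟩) ∨ ∃ i k, m = offset ts i + k ∧ (ts i).nodes[k]? = some h := by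
  rw [nodes]
  rcases m with _ | m
  · simp only [List.getElem?_cons_zero, Option.some.injEq, true_and, offset]
    refine ⟨fun h => Or.inl h.symm, ?_⟩
    rintro (h | ⟨i, k, h, -⟩)
    · exact h.symm
    · omega
  · rw [List.getElem?_cons_succ, getElem?_flatten_ofFn]
    simp only [length_nodes, offset, Nat.succ_ne_zero, false_and, false_or]
    refine exists₂_congr fun i k => and_congr_left fun _ => ?_
    omega

theorem Edge.lt {t : STerm S} {j : ℕ+} {a b : ℕ} (h : t.Edge j a b) : a < b ∧ b < t.deg := by
  induction t generalizing a b with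
  | leaf => exact h.elim
  | node g ts ih =>
    obtain ⟨i, ⟨hi, -, rfl, rfl⟩ | ⟨a', b', he, rfl, rfl⟩⟩ := h
    · have hle := offset_add_deg_le g ts i
      have hpos := deg_pos hi
      have : 0 < offset ts i := Nat.add_pos_left one_pos _
      omega
    · have hle := offset_add_deg_le g ts i
      have := ih i he
      omega

end STerm

/-- The alphabet `A` with another root relation. -/
abbrev ForestAlphabet.withRoot {S : ℕ → Type u} (A : ForestAlphabet S) (Q : A.carrier → Prop) :
    ForestAlphabet S where
  carrier := A.carrier
  root := Q
  deco := A.deco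
  edge := A.edge

namespace SForest

variable {S : ℕ → Type u}

theorem isRoot_singleton {t : STerm S} {a : ℕ} :
    IsRoot [t] a ↔ t ≠ STerm.leaf ∧ a = 0 := by simp [IsRoot]

theorem edge_singleton {t : STerm S} {j : ℕ+} {a b : ℕ} :
    Edge [t] j a b ↔ t.Edge j a b := by simp [Edge]

theorem nodes_singleton (t : STerm S) : nodes [t] = t.nodes := by simp [nodes]

theorem nodes_cons (t : STerm S) (f : SForest S) : nodes (t :: f) = t.nodes ++ nodes f := by
  simp [nodes]

theorem deg_cons (t : STerm S) (f : SForest S) : deg (t :: f) = t.deg + deg f := by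
  simp [deg]

theorem deg_singleton (t : STerm S) : deg [t] = t.deg := by simp [deg]

variable {A : ForestAlphabet S} {w : List A.carrier} {t : STerm S} {f : SForest S}

theorem Compatible.take (h : Compatible A w (t :: f)) : Compatible A (w.take t.deg) [t] := by
  have hl := h.length_eq
  rw [deg_cons] at hl
  refine ⟨?_, ?_, ?_, ?_⟩
  · rw [List.length_take, deg_singleton]
    omega
  · intro i a hi ha
    exact h.root i a (Or.inl (isRoot_singleton.1 hi)) (getElem?_take_eq_some.1 ha).2
  · intro i a g hi ha
    obtain ⟨hlt, ha⟩ := getElem?_take_eq_some.1 ha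
    refine h.deco i a g ?_ ha
    rwa [nodes_cons, List.getElem?_append_left (hlt.trans_eq t.length_nodes.symm),
      ← nodes_singleton]
  · intro i i' j a a' he ha ha'
    exact h.edge i i' j a a' (Or.inl (edge_singleton.1 he)) (getElem?_take_eq_some.1 ha).2
      (getElem?_take_eq_some.1 ha').2

theorem Compatible.drop (h : Compatible A w (t :: f)) : Compatible A (w.drop t.deg) f := by
  have hl := h.length_eq
  rw [deg_cons] at hl
  refine ⟨?_, ?_, ?_, ?_⟩
  · rw [List.length_drop]
    omega
  · intro i a hi ha
    rw [List.getElem?_drop] at ha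
    exact h.root _ a (Or.inr ⟨i, hi, rfl⟩) ha
  · intro i a g hi ha
    rw [List.getElem?_drop] at ha
    refine h.deco _ a g ?_ ha
    rw [nodes_cons, ← STerm.length_nodes, List.getElem?_append_right (Nat.le_add_right _ _),
      Nat.add_sub_cancel_left, hi]
  · intro i i' j a a' he ha ha'
    rw [List.getElem?_drop] at ha ha'
    exact h.edge _ _ j a a' (Or.inr ⟨i, i', he, rfl, rfl⟩) ha ha'

theorem Compatible.cons (ht : Compatible A (w.take t.deg) [t])
    (hf : Compatible A (w.drop t.deg) f) : Compatible A w (t :: f) := by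
  have hlt := ht.length_eq
  have hlf := hf.length_eq
  rw [List.length_take, deg_singleton] at hlt
  rw [List.length_drop] at hlf
  refine ⟨?_, ?_, ?_, ?_⟩
  · rw [deg_cons]
    omega
  · rintro i a (⟨hne, rfl⟩ | ⟨i, hi, rfl⟩) ha
    · exact ht.root 0 a (isRoot_singleton.2 ⟨hne, rfl⟩)
        (getElem?_take_eq_some.2 ⟨STerm.deg_pos hne, ha⟩)
    · exact hf.root i a hi (by rwa [List.getElem?_drop])
  · intro i a g hi ha
    rw [nodes_cons, List.getElem?_append, STerm.length_nodes] at hi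
    split_ifs at hi with h
    · exact ht.deco i a g (by rwa [nodes_singleton]) (getElem?_take_eq_some.2 ⟨h, ha⟩)
    · refine hf.deco _ a g hi ?_
      rwa [List.getElem?_drop, Nat.add_sub_of_le (not_lt.1 h)]
  · rintro i i' j a a' (he | ⟨i, i', he, rfl, rfl⟩) ha ha'
    · have := he.lt
      exact ht.edge i i' j a a' (edge_singleton.2 he) (getElem?_take_eq_some.2 ⟨by omega, ha⟩)
        (getElem?_take_eq_some.2 ⟨by omega, ha'⟩)
    · exact hf.edge i i' j a a' he (by rwa [List.getElem?_drop]) (by rwa [List.getElem?_drop])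

theorem compatible_cons : Compatible A w (t :: f) ↔
    Compatible A (w.take t.deg) [t] ∧ Compatible A (w.drop t.deg) f :=
  ⟨fun h => ⟨h.take, h.drop⟩, fun h => h.1.cons h.2⟩

theorem compatible_nil : Compatible A w [] ↔ w = [] := by
  refine ⟨fun h => List.length_eq_zero_iff.1 h.length_eq, ?_⟩
  rintro rfl
  exact ⟨rfl, by simp, by simp, by simp⟩

theorem compatible_leaf : Compatible A w [STerm.leaf] ↔ w = [] := by
  refine ⟨fun h => List.length_eq_zero_iff.1 h.length_eq, ?_⟩
  rintro rfl
  exact ⟨rfl, by simp, by simp, by simp⟩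

theorem not_compatible_node_nil {n : ℕ} (g : S n) (ts : Fin n → STerm S) :
    ¬ Compatible A [] [STerm.node g ts] := by
  intro h
  have := h.length_eq
  rw [deg_singleton, STerm.deg, List.length_nil] at this
  omega

variable {n : ℕ} {g : S n} {ts : Fin n → STerm S} {a : A.carrier}

theorem getElem?_slice_eq_some {i : Fin n} {k : ℕ} {b : A.carrier} :
    ((w.drop (∑ k ∈ Finset.Iio i, (ts k).deg)).take (ts i).deg)[k]? = some b ↔
      k < (ts i).deg ∧ (a :: w)[STerm.offset ts i + k]? = some b := by
  rw [getElem?_take_eq_some, STerm.offset, add_assoc, add_comm 1, List.getElem?_cons_succ,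
    List.getElem?_drop]

theorem Compatible.slice (h : Compatible A (a :: w) [STerm.node g ts]) (i : Fin n) :
    Compatible (A.withRoot (A.edge (Nat.succPNat i) a))
      ((w.drop (∑ k ∈ Finset.Iio i, (ts k).deg)).take (ts i).deg) [ts i] := by
  refine ⟨?_, ?_, ?_, ?_⟩
  · have hl := h.length_eq
    have hle := sum_Iio_add_le_sum (fun i => (ts i).deg) i
    rw [deg_singleton, STerm.deg, List.length_cons] at hl
    rw [deg_singleton, List.length_take, List.length_drop]
    exact min_eq_left (by omega)
  · intro k b hk hb
    obtain ⟨hne, rfl⟩ := isRoot_singleton.1 hk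
    exact h.edge 0 (STerm.offset ts i) _ a b
      (edge_singleton.2 ⟨i, Or.inl ⟨hne, rfl, rfl, rfl⟩⟩) rfl (getElem?_slice_eq_some.1 hb).2
  · intro k b g' hk hb
    rw [nodes_singleton] at hk
    refine h.deco (STerm.offset ts i + k) b g' ?_ (getElem?_slice_eq_some.1 hb).2
    rw [nodes_singleton]
    exact (STerm.getElem?_nodes_node g ts _ _).2 (Or.inr ⟨i, k, rfl, hk⟩)
  · intro k k' j b b' he hb hb'
    exact h.edge (STerm.offset ts i + k) (STerm.offset ts i + k') j b b'
      (edge_singleton.2 ⟨i, Or.inr ⟨k, k', edge_singleton.1 he, rfl, rfl⟩⟩)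
      (getElem?_slice_eq_some.1 hb).2 (getElem?_slice_eq_some.1 hb').2

theorem Compatible.node (hr : A.root a) (hd : A.deco g a) (hl : w.length = ∑ i, (ts i).deg)
    (h : ∀ i : Fin n, Compatible (A.withRoot (A.edge (Nat.succPNat i) a))
      ((w.drop (∑ k ∈ Finset.Iio i, (ts k).deg)).take (ts i).deg) [ts i]) :
    Compatible A (a :: w) [STerm.node g ts] := by
  refine ⟨?_, ?_, ?_, ?_⟩
  · rw [deg_singleton, STerm.deg, List.length_cons, hl, add_comm]
  · intro i b hi hb
    obtain ⟨-, rfl⟩ := isRoot_singleton.1 hi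
    obtain rfl : a = b := by simpa using hb
    exact hr
  · intro m b g' hm hb
    rw [nodes_singleton, STerm.getElem?_nodes_node] at hm
    obtain ⟨rfl, rfl⟩ | ⟨i, k, rfl, hk⟩ := hm
    · obtain rfl : a = b := by simpa using hb
      exact hd
    · have hk' : k < (ts i).deg :=
        (List.getElem?_eq_some_iff.1 hk).1.trans_eq (STerm.length_nodes _)
      exact (h i).deco k b g' (by rwa [nodes_singleton]) (getElem?_slice_eq_some.2 ⟨hk', hb⟩)
  · intro m m' j b b' he hb hb'
    obtain ⟨i, ⟨hne, hj, rfl, rfl⟩ | ⟨k, k', hi, rfl, rfl⟩⟩ := edge_singleton.1 he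
    · obtain rfl : a = b := by simpa using hb
      obtain rfl : j = Nat.succPNat i := PNat.eq hj
      exact (h i).root 0 b' (isRoot_singleton.2 ⟨hne, rfl⟩)
        (getElem?_slice_eq_some.2 ⟨STerm.deg_pos hne, hb'⟩)
    · have := hi.lt
      exact (h i).edge k k' j b b' (edge_singleton.2 hi)
        (getElem?_slice_eq_some.2 ⟨by omega, hb⟩) (getElem?_slice_eq_some.2 ⟨by omega, hb'⟩)

theorem compatible_node_cons : Compatible A (a :: w) [STerm.node g ts] ↔
    (A.root a ∧ A.deco g a) ∧ w.length = ∑ i, (ts i).deg ∧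
      ∀ i : Fin n, Compatible (A.withRoot (A.edge (Nat.succPNat i) a))
        ((w.drop (∑ k ∈ Finset.Iio i, (ts k).deg)).take (ts i).deg) [ts i] := by
  refine ⟨fun h => ⟨⟨?_, ?_⟩, ?_, h.slice⟩, fun ⟨⟨hr, hd⟩, hl, h⟩ => .node hr hd hl h⟩
  · exact h.root 0 a (isRoot_singleton.2 ⟨by simp, rfl⟩) rfl
  · exact h.deco 0 a ⟨n, g⟩ (by rw [nodes_singleton]; rfl) rfl
  · have hl := h.length_eq
    rw [deg_singleton, STerm.deg, List.length_cons] at hl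
    omega

end SForest

end Preorder

section TreePolynomials

namespace NCSeries

variable {K : Type v} [Field K] {A : Type u}

theorem coeff_mul_of_length (f g : NCSeries K A) (d : ℕ)
    (hf : ∀ w : List A, w.length ≠ d → f.coeff w = 0) (w : List A) :
    (f * g).coeff w = f.coeff (w.take d) * g.coeff (w.drop d) := by
  rw [coeff_mul]
  by_cases h : d ≤ w.length
  · refine Finset.sum_eq_single d (fun i hi hid => ?_) fun h' => absurd (Finset.mem_range.2 ?_) h'
    · rw [Finset.mem_range] at hi
      rw [hf _ (by rw [List.length_take]; omega), zero_mul]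
    · omega
  · rw [hf (w.take d) (by rw [List.length_take]; omega), zero_mul]
    refine Finset.sum_eq_zero fun i hi => ?_
    rw [Finset.mem_range] at hi
    rw [hf _ (by rw [List.length_take]; omega), zero_mul]

theorem coeff_prod_ofFn : ∀ {n : ℕ} (f : Fin n → NCSeries K A) (d : Fin n → ℕ)
    (_ : ∀ i w, w.length ≠ d i → (f i).coeff w = 0) (w : List A),
    (List.ofFn f).prod.coeff w = if w.length = ∑ i, d i then
      ∏ i, (f i).coeff ((w.drop (∑ k ∈ Finset.Iio i, d k)).take (d i)) else 0
  | 0, f, d, _, w => by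
    classical
    rw [List.ofFn_zero, List.prod_nil, coeff_one]
    simp
  | n + 1, f, d, hf, w => by
    rw [List.ofFn_succ, List.prod_cons, coeff_mul_of_length _ _ (d 0) (hf 0),
      coeff_prod_ofFn _ (fun i => d i.succ) (fun i => hf i.succ)]
    simp only [Fin.sum_univ_succ, Fin.prod_univ_succ, sum_Iio_fin_zero, sum_Iio_fin_succ d,
      List.drop_zero, List.drop_drop, List.length_drop, mul_ite, mul_zero]
    by_cases hw : d 0 ≤ w.length
    · exact if_congr (by omega) rfl rfl
    · rw [hf 0 _ (by rw [List.length_take]; omega)]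
      simp

end NCSeries

namespace NCPoly

variable {K : Type v} [Field K] {A : Type u}

/-- The left quotient of a polynomial by the letter `a`, that is, the sum of the `w` with the
coefficient of `a w`. It turns the recursion along preorder into an equality of polynomials. -/
def leftQuotient (a : A) : NCPoly K A →ₗ[K] NCPoly K A where
  toFun f := ⟨fun w => f.1.coeff (a :: w), f.2.imp fun _ hd w hw => hd (a :: w) (by
    rw [List.length_cons]; omega)⟩
  map_add' _ _ := rfl
  map_smul' _ _ := rfl

theorem leftQuotient_one (a : A) : leftQuotient a (1 : NCPoly K A) = 0 := by
  classical
  exact Subtype.ext (NCSeries.ext fun w => (NCSeries.coeff_one _).trans (if_neg (by simp)))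

end NCPoly

variable (K : Type v) [Field K] {S : ℕ → Type u} (A : ForestAlphabet S)

theorem forestPoly_nil : forestPoly K A [] = 1 := by
  classical
  exact Subtype.ext (NCSeries.ext fun w => (if_congr SForest.compatible_nil rfl rfl).trans
    (NCSeries.coeff_one w).symm)

theorem coeff_forestPoly_of_length_ne {f : SForest S} {w : List A.carrier}
    (h : w.length ≠ f.deg) : (forestPoly K A f).1.coeff w = 0 :=
  if_neg fun h' => h h'.length_eq

theorem forestPoly_cons (t : STerm S) (f : SForest S) :
    forestPoly K A (t :: f) = forestPoly K A [t] * forestPoly K A f := by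
  classical
  refine Subtype.ext (NCSeries.ext fun w => ?_)
  refine Eq.trans ?_ (NCSeries.coeff_mul_of_length _ _ t.deg (fun w hw =>
    coeff_forestPoly_of_length_ne K A (by rwa [SForest.deg_singleton])) w).symm
  refine (if_congr SForest.compatible_cons rfl rfl).trans ?_
  refine (congrArg (ite _ · 0) (mul_one (1 : K)).symm).trans ?_
  exact (ite_zero_mul_ite_zero _ _ _ _).symm

/-- The polynomial of the tree `t` on the alphabet `A`, in which the letter of the root is
constrained by `Q` instead of `A.root`. -/
noncomputable def treePoly (Q : A.carrier → Prop) (t : STerm S) : NCPoly K A.carrier :=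
  forestPoly K (A.withRoot Q) [t]

theorem forestPoly_eq_prod (f : SForest S) :
    forestPoly K A f = (f.map (treePoly K A A.root)).prod := by
  induction f with
  | nil => exact forestPoly_nil K A
  | cons t f ih => rw [forestPoly_cons, ih, List.map_cons, List.prod_cons]; rfl

theorem treePoly_leaf (Q : A.carrier → Prop) : treePoly K A Q STerm.leaf = 1 := by
  classical
  exact Subtype.ext (NCSeries.ext fun w => (if_congr SForest.compatible_leaf rfl rfl).trans
    (NCSeries.coeff_one w).symm)

theorem coeff_treePoly_of_length_ne {Q : A.carrier → Prop} {t : STerm S} {w : List A.carrier}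
    (h : w.length ≠ t.deg) : (treePoly K A Q t).1.coeff w = 0 :=
  coeff_forestPoly_of_length_ne K _ (by rwa [SForest.deg_singleton])

variable (Q : A.carrier → Prop) {n : ℕ} (g : S n) (ts : Fin n → STerm S)

theorem coeff_treePoly_node_nil : (treePoly K A Q (STerm.node g ts)).1.coeff [] = 0 :=
  if_neg (SForest.not_compatible_node_nil g ts)

open Classical in
theorem leftQuotient_treePoly_node (a : A.carrier) :
    NCPoly.leftQuotient a (treePoly K A Q (STerm.node g ts)) =
      if Q a ∧ A.deco g a then
        (List.ofFn fun i : Fin n => treePoly K A (A.edge (Nat.succPNat i) a) (ts i)).prod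
      else 0 := by
  refine Subtype.ext (NCSeries.ext fun w => ?_)
  refine (if_congr SForest.compatible_node_cons rfl rfl).trans ?_
  by_cases h : Q a ∧ A.deco g a
  · rw [if_pos h, SubmonoidClass.coe_list_prod, List.map_ofFn]
    refine Eq.trans ?_ (NCSeries.coeff_prod_ofFn _ (fun i => (ts i).deg)
      (fun i w hw => coeff_treePoly_of_length_ne K A hw) w).symm
    refine Eq.trans ?_ (if_congr Iff.rfl Finset.prod_ite_zero.symm rfl)
    simp only [Finset.mem_univ, true_imp_iff, Finset.prod_const_one, ← ite_and]
    exact if_congr (and_iff_right h) rfl rfl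
  · rw [if_neg h]
    exact if_neg fun h' => h h'.1

end TreePolynomials

namespace NCPoly

variable {K : Type v} [Field K] {A : Type u} {B : Type u'}

/-- The words on `A ⊔ B` that restrict to `u` on `A` and to `v` on `B`. -/
noncomputable def shuffles (u : List A) (v : List B) : Finset (List (A ⊕ B)) :=
  (finite_theta u v).toFinset

theorem mem_shuffles {u : List A} {v : List B} {w : List (A ⊕ B)} : w ∈ shuffles u v ↔
    w.filterMap Sum.getLeft? = u ∧ w.filterMap Sum.getRight? = v := by
  simp [shuffles]

theorem inl_cons_mem_shuffles {a : A} {w : List (A ⊕ B)} {u : List A} {v : List B} :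
    Sum.inl a :: w ∈ shuffles u v ↔ ∃ u', u = a :: u' ∧ w ∈ shuffles u' v := by
  simp only [mem_shuffles, List.filterMap_cons, Sum.getLeft?_inl, Sum.getRight?_inl]
  grind

theorem inr_cons_mem_shuffles {b : B} {w : List (A ⊕ B)} {u : List A} {v : List B} :
    Sum.inr b :: w ∈ shuffles u v ↔ ∃ v', v = b :: v' ∧ w ∈ shuffles u v' := by
  simp only [mem_shuffles, List.filterMap_cons, Sum.getLeft?_inr, Sum.getRight?_inr]
  grind

theorem sum_shuffles_cut {M : Type*} [AddCommMonoid M]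
    (F : List (A ⊕ B) → List (A ⊕ B) → M) (u : List A) (v : List B) :
    ∑ w ∈ shuffles u v, ∑ k ∈ Finset.range (w.length + 1), F (w.take k) (w.drop k) =
      ∑ p ∈ Finset.range (u.length + 1) ×ˢ Finset.range (v.length + 1),
        ∑ q ∈ shuffles (u.take p.1) (v.take p.2) ×ˢ shuffles (u.drop p.1) (v.drop p.2),
          F q.1 q.2 := by
  rw [Finset.sum_sigma', Finset.sum_sigma']
  refine Finset.sum_nbij'
    (fun p => ⟨(((p.1.take p.2).filterMap Sum.getLeft?).length,
      ((p.1.take p.2).filterMap Sum.getRight?).length), (p.1.take p.2, p.1.drop p.2)⟩)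
    (fun q => ⟨q.2.1 ++ q.2.2, q.2.1.length⟩) ?_ ?_ ?_ ?_ fun _ _ => rfl
  · rintro ⟨w, k⟩ h
    simp only [Finset.mem_sigma, mem_shuffles] at h
    obtain ⟨⟨rfl, rfl⟩, -⟩ := h
    have hl : w.filterMap Sum.getLeft? =
        (w.take k).filterMap Sum.getLeft? ++ (w.drop k).filterMap Sum.getLeft? := by
      rw [← List.filterMap_append, List.take_append_drop]
    have hr : w.filterMap Sum.getRight? =
        (w.take k).filterMap Sum.getRight? ++ (w.drop k).filterMap Sum.getRight? := by
      rw [← List.filterMap_append, List.take_append_drop]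
    simp only [Finset.mem_sigma, Finset.mem_range, Finset.mem_product, mem_shuffles]
    rw [hl, hr]
    simp
  · rintro ⟨⟨i, j⟩, ⟨w, w'⟩⟩ h
    simp only [Finset.mem_sigma, Finset.mem_range, mem_shuffles, Finset.mem_product] at h ⊢
    obtain ⟨-, ⟨hu, hv⟩, hu', hv'⟩ := h
    rw [List.filterMap_append, List.filterMap_append, hu, hv, hu', hv']
    simp
  · rintro ⟨w, k⟩ h
    simp only [Finset.mem_sigma, Finset.mem_range] at h
    simp only [List.take_append_drop, List.length_take, Sigma.mk.injEq, heq_eq_eq, true_and]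
    omega
  · rintro ⟨⟨i, j⟩, ⟨w, w'⟩⟩ h
    simp only [Finset.mem_sigma, Finset.mem_range, mem_shuffles, Finset.mem_product] at h
    obtain ⟨⟨hi, hj⟩, ⟨hu, hv⟩, -⟩ := h
    simp only [List.take_left, List.drop_left, hu, hv, List.length_take]
    rw [Nat.min_eq_left (by omega), Nat.min_eq_left (by omega)]

theorem theta_eq_sum (f : NCPoly K (A ⊕ B)) (u : List A) (v : List B) :
    theta f u v = ∑ w ∈ shuffles u v, f.1.coeff w :=
  finsum_mem_eq_finite_toFinset_sum _ _

/-- `theta` as a linear map. -/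
noncomputable def thetaLinear : NCPoly K (A ⊕ B) →ₗ[K] (List A → List B → K) where
  toFun := theta
  map_add' f g := by
    funext u v
    simp only [Pi.add_apply, theta_eq_sum, ← Finset.sum_add_distrib]
    rfl
  map_smul' c f := by
    funext u v
    simp only [Pi.smul_apply, theta_eq_sum, Finset.smul_sum]
    rfl

theorem theta_zero : theta (0 : NCPoly K (A ⊕ B)) = 0 := map_zero thetaLinear

theorem theta_mul_apply (f g : NCPoly K (A ⊕ B)) (u : List A) (v : List B) :
    theta (f * g) u v = ∑ p ∈ Finset.range (u.length + 1) ×ˢ Finset.range (v.length + 1),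
      theta f (u.take p.1) (v.take p.2) * theta g (u.drop p.1) (v.drop p.2) := by
  simp only [theta_eq_sum, Finset.sum_mul_sum, ← Finset.sum_product']
  refine (Finset.sum_congr rfl fun w _ => NCSeries.coeff_mul f.1 g.1 w).trans ?_
  exact sum_shuffles_cut (fun w w' => f.1.coeff w * g.1.coeff w') u v

theorem tensorCoeff_tmul (f : NCPoly K A) (g : NCPoly K B) (u : List A) (v : List B) :
    tensorCoeff (f ⊗ₜ[K] g) u v = f.1.coeff u * g.1.coeff v := rfl

theorem tensorCoeff_mul_apply (x y : NCPoly K A ⊗[K] NCPoly K B) (u : List A) (v : List B) :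
    tensorCoeff (x * y) u v = ∑ p ∈ Finset.range (u.length + 1) ×ˢ Finset.range (v.length + 1),
      tensorCoeff x (u.take p.1) (v.take p.2) * tensorCoeff y (u.drop p.1) (v.drop p.2) := by
  induction x with
  | zero => simp
  | add x x' hx hx' => simp only [add_mul, map_add, Pi.add_apply, hx, hx', Finset.sum_add_distrib]
  | tmul f g =>
    induction y with
    | zero => simp
    | add y y' hy hy' => simp only [mul_add, map_add, Pi.add_apply, hy, hy', Finset.sum_add_distrib]
    | tmul f' g' =>
      rw [Algebra.TensorProduct.tmul_mul_tmul, tensorCoeff_tmul]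
      refine (congrArg₂ (· * ·) (NCSeries.coeff_mul f.1 f'.1 u)
        (NCSeries.coeff_mul g.1 g'.1 v)).trans ?_
      rw [Finset.sum_mul_sum, ← Finset.sum_product']
      refine Finset.sum_congr rfl fun p _ => ?_
      rw [tensorCoeff_tmul, tensorCoeff_tmul, mul_mul_mul_comm]

theorem theta_mul {f g : NCPoly K (A ⊕ B)} {x y : NCPoly K A ⊗[K] NCPoly K B}
    (hf : theta f = tensorCoeff x) (hg : theta g = tensorCoeff y) :
    theta (f * g) = tensorCoeff (x * y) := by
  funext u v
  rw [theta_mul_apply, tensorCoeff_mul_apply, hf, hg]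

theorem shuffles_nil_nil : shuffles ([] : List A) ([] : List B) = {[]} := by
  ext w
  rw [mem_shuffles, Finset.mem_singleton]
  rcases w with _ | ⟨a | b, w⟩ <;> simp

theorem shuffles_cons_nil (a : A) (u : List A) : shuffles (a :: u) ([] : List B) =
    (shuffles u []).map ⟨(Sum.inl a :: ·), List.cons_injective⟩ := by
  ext w
  simp only [Finset.mem_map, Function.Embedding.coeFn_mk]
  rcases w with _ | ⟨a' | b', w⟩
  · simp [mem_shuffles]
  · grind [inl_cons_mem_shuffles]
  · grind [inr_cons_mem_shuffles]

theorem shuffles_nil_cons (b : B) (v : List B) : shuffles ([] : List A) (b :: v) =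
    (shuffles [] v).map ⟨(Sum.inr b :: ·), List.cons_injective⟩ := by
  ext w
  simp only [Finset.mem_map, Function.Embedding.coeFn_mk]
  rcases w with _ | ⟨a' | b', w⟩
  · simp [mem_shuffles]
  · grind [inl_cons_mem_shuffles]
  · grind [inr_cons_mem_shuffles]

open Classical in
theorem shuffles_cons_cons (a : A) (u : List A) (b : B) (v : List B) :
    shuffles (a :: u) (b :: v) =
      (shuffles u (b :: v)).map ⟨(Sum.inl a :: ·), List.cons_injective⟩ ∪
        (shuffles (a :: u) v).map ⟨(Sum.inr b :: ·), List.cons_injective⟩ := by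
  ext w
  simp only [Finset.mem_union, Finset.mem_map, Function.Embedding.coeFn_mk]
  rcases w with _ | ⟨a' | b', w⟩
  · simp [mem_shuffles]
  · grind [inl_cons_mem_shuffles]
  · grind [inr_cons_mem_shuffles]

theorem theta_nil_nil (f : NCPoly K (A ⊕ B)) : theta f [] [] = f.1.coeff [] := by
  rw [theta_eq_sum, shuffles_nil_nil, Finset.sum_singleton]

theorem theta_cons_nil (f : NCPoly K (A ⊕ B)) (a : A) (u : List A) :
    theta f (a :: u) [] = theta (leftQuotient (Sum.inl a) f) u [] := by
  rw [theta_eq_sum, theta_eq_sum, shuffles_cons_nil, Finset.sum_map]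
  rfl

theorem theta_nil_cons (f : NCPoly K (A ⊕ B)) (b : B) (v : List B) :
    theta f [] (b :: v) = theta (leftQuotient (Sum.inr b) f) [] v := by
  rw [theta_eq_sum, theta_eq_sum, shuffles_nil_cons, Finset.sum_map]
  rfl

theorem theta_cons_cons (f : NCPoly K (A ⊕ B)) (a : A) (u : List A) (b : B) (v : List B) :
    theta f (a :: u) (b :: v) = theta (leftQuotient (Sum.inl a) f) u (b :: v) +
      theta (leftQuotient (Sum.inr b) f) (a :: u) v := by
  classical
  rw [theta_eq_sum, theta_eq_sum, theta_eq_sum, shuffles_cons_cons, Finset.sum_union,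
    Finset.sum_map, Finset.sum_map]
  · rfl
  · simp [Finset.disjoint_left]

theorem theta_eq_add {f : NCPoly K (A ⊕ B)} {F G : List A → List B → K}
    (hf : f.1.coeff [] = 0) (hF : ∀ v, F [] v = 0) (hG : ∀ u, G u [] = 0)
    (hinl : ∀ a u v, theta (leftQuotient (Sum.inl a) f) u v = F (a :: u) v)
    (hinr : ∀ b u v, theta (leftQuotient (Sum.inr b) f) u v = G u (b :: v)) :
    theta f = F + G := by
  funext u v
  rcases u with _ | ⟨a, u⟩ <;> rcases v with _ | ⟨b, v⟩
  · rw [theta_nil_nil, hf, Pi.add_apply, Pi.add_apply, hF, hG, add_zero]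
  · rw [theta_nil_cons, hinr, Pi.add_apply, Pi.add_apply, hF, zero_add]
  · rw [theta_cons_nil, hinl, Pi.add_apply, Pi.add_apply, hG, add_zero]
  · rw [theta_cons_cons, hinl, hinr, Pi.add_apply, Pi.add_apply]

theorem theta_one :
    theta (1 : NCPoly K (A ⊕ B)) = tensorCoeff (1 : NCPoly K A ⊗[K] NCPoly K B) := by
  classical
  funext u v
  rw [Algebra.TensorProduct.one_def, tensorCoeff_tmul]
  change _ = (1 : NCSeries K A).coeff u * (1 : NCSeries K B).coeff v
  rcases u with _ | ⟨a, u⟩ <;> rcases v with _ | ⟨b, v⟩ <;>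
    simp [theta_nil_nil, theta_nil_cons, theta_cons_nil, theta_cons_cons, leftQuotient_one,
      theta_zero, NCSeries.coeff_one]

theorem theta_prod_ofFn : ∀ {n : ℕ} (f : Fin n → NCPoly K (A ⊕ B))
    (x : Fin n → NCPoly K A ⊗[K] NCPoly K B) (_ : ∀ i, theta (f i) = tensorCoeff (x i)),
    theta (List.ofFn f).prod = tensorCoeff (List.ofFn x).prod
  | 0, f, x, _ => by simpa using theta_one
  | n + 1, f, x, h => by
    rw [List.ofFn_succ, List.prod_cons, List.ofFn_succ, List.prod_cons]
    exact theta_mul (h 0) (theta_prod_ofFn _ _ fun i => h i.succ)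

theorem tensorCoeff_cons_right (f : NCPoly K A) (g : NCPoly K B) (u : List A) (b : B)
    (v : List B) : tensorCoeff (f ⊗ₜ[K] g) u (b :: v) =
      tensorCoeff (f ⊗ₜ[K] leftQuotient b g) u v := rfl

end NCPoly

section SumTree

open NCPoly

variable (K : Type v) [Field K] {S : ℕ → Type u} {A B : ForestAlphabet S}

theorem sum_edge_inl (A B : ForestAlphabet S) (j : ℕ+) (a : A.carrier) :
    (A.sum B).edge j (Sum.inl a) = Sum.elim (A.edge j a) B.root := by
  funext x
  cases x <;> rfl

theorem sum_edge_inr (A B : ForestAlphabet S) (j : ℕ+) (b : B.carrier) :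
    (A.sum B).edge j (Sum.inr b) = Sum.elim (fun _ => False) (B.edge j b) := by
  funext x
  cases x <;> rfl

/-- The polynomial of the tree `t` on `A.sum B`, in which the letter of the root is constrained by
`Q` if it is in `A` and by `Q'` if it is in `B`. -/
noncomputable def sumTreePoly (Q : A.carrier → Prop) (Q' : B.carrier → Prop) (t : STerm S) :
    NCPoly K (A.carrier ⊕ B.carrier) :=
  treePoly K (A.sum B) (Sum.elim Q Q') t

variable (Q : A.carrier → Prop) (Q' : B.carrier → Prop) {n : ℕ} (g : S n) (ts : Fin n → STerm S)

theorem sumTreePoly_leaf : sumTreePoly K Q Q' STerm.leaf = 1 :=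
  treePoly_leaf K (A.sum B) (Sum.elim Q Q')

open Classical in
theorem leftQuotient_inl_sumTreePoly (a : A.carrier) :
    leftQuotient (Sum.inl a) (sumTreePoly K Q Q' (STerm.node g ts)) =
      if Q a ∧ A.deco g a then
        (List.ofFn fun i : Fin n =>
          sumTreePoly K (A.edge (Nat.succPNat i) a) B.root (ts i)).prod
      else 0 := by
  refine (leftQuotient_treePoly_node K (A.sum B) _ g ts (Sum.inl a)).trans ?_
  simp only [sum_edge_inl]
  rfl

open Classical in
theorem leftQuotient_inr_sumTreePoly (b : B.carrier) :
    leftQuotient (Sum.inr b) (sumTreePoly K Q Q' (STerm.node g ts)) =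
      if Q' b ∧ B.deco g b then
        (List.ofFn fun i : Fin n =>
          sumTreePoly K (A := A) (fun _ => False) (B.edge (Nat.succPNat i) b) (ts i)).prod
      else 0 := by
  refine (leftQuotient_treePoly_node K (A.sum B) _ g ts (Sum.inr b)).trans ?_
  simp only [sum_edge_inr]
  rfl

variable {ts}

theorem theta_leftQuotient_inr_sumTreePoly
    (hts : ∀ i P, theta (sumTreePoly K (A := A) (B := B) (fun _ => False) P (ts i)) =
      tensorCoeff (1 ⊗ₜ[K] treePoly K B P (ts i))) (b : B.carrier) :
    theta (leftQuotient (Sum.inr b) (sumTreePoly K Q Q' (STerm.node g ts))) =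
      tensorCoeff ((1 : NCPoly K A.carrier) ⊗ₜ[K]
        leftQuotient b (treePoly K B Q' (STerm.node g ts))) := by
  rw [leftQuotient_inr_sumTreePoly, leftQuotient_treePoly_node]
  split_ifs
  · rw [theta_prod_ofFn _ _ fun i => hts i _, list_prod_ofFn_tmul]
    simp
  · rw [theta_zero, TensorProduct.tmul_zero, map_zero]

theorem theta_sumTreePoly_false (t : STerm S) :
    theta (sumTreePoly K (A := A) (fun _ => False) Q' t) =
      tensorCoeff (1 ⊗ₜ[K] treePoly K B Q' t) := by
  induction t generalizing Q' with
  | leaf =>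
    rw [sumTreePoly_leaf, treePoly_leaf]
    exact theta_one
  | node g ts ih =>
    rw [← zero_add (tensorCoeff _)]
    refine theta_eq_add (coeff_treePoly_node_nil K _ _ g ts) (fun _ => rfl) (fun u => ?_)
      (fun a u v => ?_) (fun b u v => ?_)
    · rw [tensorCoeff_tmul, coeff_treePoly_node_nil, mul_zero]
    · rw [leftQuotient_inl_sumTreePoly, if_neg fun h => h.1, theta_zero]
      rfl
    · rw [theta_leftQuotient_inr_sumTreePoly K _ _ g ih, tensorCoeff_cons_right]

end SumTree

/-- A factorization of a tree: a tree together with the trees to be grafted on its leaves. -/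
abbrev TreeFactorization {S : ℕ → Type u} (t : STerm S) : Type u := (freeOperad S).Factorization t

namespace TreeFactorization

variable {S : ℕ → Type u} {n : ℕ} (g : S n) {ts : Fin n → STerm S}

/-- The left factor of a factorization of a tree. -/
def top {t : STerm S} (p : TreeFactorization t) : STerm S := p.1.1

/-- The forest of the right factors of a factorization of a tree. -/
def bottom {t : STerm S} (p : TreeFactorization t) : SForest S := List.ofFn p.1.2

/-- The trivial factorization of a tree, whose left factor is a leaf. -/
def ofLeaf (t : STerm S) : TreeFactorization t := ⟨⟨STerm.leaf, fun _ => t⟩, rfl⟩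

/-- The concatenation of the tuples of right factors of the pairs `d i`. -/
def joinRight (d : Fin n → (y : STerm S) × (Fin y.ar → STerm S)) (k : Fin (∑ i, (d i).1.ar)) :
    STerm S :=
  (d (finSigmaFinEquiv.symm k).1).2 (finSigmaFinEquiv.symm k).2

theorem joinRight_apply (d : Fin n → (y : STerm S) × (Fin y.ar → STerm S)) (i : Fin n)
    (j : Fin (d i).1.ar) : joinRight d (finSigmaFinEquiv ⟨i, j⟩) = (d i).2 j := by
  rw [joinRight, Equiv.symm_apply_apply]

theorem joinRight_split (ys : Fin n → STerm S) (z : Fin (∑ i, (ys i).ar) → STerm S) :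
    joinRight (fun i => ⟨ys i, fun j => z (finSigmaFinEquiv ⟨i, j⟩)⟩) = z :=
  funext fun k => congrArg z (Equiv.apply_symm_apply finSigmaFinEquiv k)

/-- The factorization of the tree `node g ts` obtained from factorizations of the trees `ts i`. -/
def ofNode (q : ∀ i, TreeFactorization (ts i)) : TreeFactorization (STerm.node g ts) :=
  ⟨⟨STerm.node g fun i => (q i).top, joinRight fun i => (q i).1⟩,
    congrArg (STerm.node g) <| funext fun i => Eq.trans
      (congrArg (STerm.graft _) (funext fun j => joinRight_apply (fun i => (q i).1) i j)) (q i).2⟩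

theorem top_ofNode (q : ∀ i, TreeFactorization (ts i)) :
    (ofNode g q).top = STerm.node g fun i => (q i).top := rfl

theorem node_joinRight_injective : Function.Injective
    fun d : Fin n → (y : STerm S) × (Fin y.ar → STerm S) =>
      (⟨STerm.node g fun i => (d i).1, joinRight d⟩ : (y : STerm S) × (Fin y.ar → STerm S)) := by
  intro d d' h
  obtain ⟨ys, zs, rfl⟩ : ∃ (ys : Fin n → STerm S) (zs : ∀ i, Fin (ys i).ar → STerm S),
    d = fun i => ⟨ys i, zs i⟩ := ⟨_, fun i => (d i).2, rfl⟩
  obtain ⟨ys', zs', rfl⟩ : ∃ (ys : Fin n → STerm S) (zs : ∀ i, Fin (ys i).ar → STerm S),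
    d' = fun i => ⟨ys i, zs i⟩ := ⟨_, fun i => (d' i).2, rfl⟩
  obtain ⟨hy, hz⟩ := Sigma.ext_iff.1 h
  obtain rfl : ys = ys' := eq_of_heq (STerm.node.inj hy).2.2
  obtain rfl : zs = zs' := by
    funext i j
    exact (joinRight_apply (fun i => ⟨ys i, zs i⟩) i j).symm.trans <|
      (congrFun (eq_of_heq hz) _).trans (joinRight_apply (fun i => ⟨ys i, zs' i⟩) i j)
  rfl

theorem eq_ofLeaf {t : STerm S} (p : TreeFactorization t) (hp : p.top = STerm.leaf) :
    p = ofLeaf t :=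
  NSOperad.Factorization.eq_oneFactorization p hp

/-- The factorizations of `node g ts`: the trivial one, and those obtained from factorizations of
the trees `ts i`. -/
def ofOption : Option (∀ i, TreeFactorization (ts i)) → TreeFactorization (STerm.node g ts)
  | none => ofLeaf _
  | some q => ofNode g q

theorem ofOption_bijective : Function.Bijective (ofOption g (ts := ts)) := by
  constructor
  · rintro (_ | q) (_ | q') h
    · rfl
    · exact absurd (congrArg top h) (by rintro ⟨⟩)
    · exact absurd (congrArg top h) (by rintro ⟨⟩)
    · have hq := node_joinRight_injective g (congrArg Subtype.val h)
      exact congrArg some (funext fun i => Subtype.ext (congrFun hq i))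
  · intro p
    rcases hp : p.top with _ | ⟨g', ys⟩
    · exact ⟨none, (p.eq_ofLeaf hp).symm⟩
    · obtain ⟨⟨y, z⟩, h⟩ := p
      obtain rfl : y = STerm.node g' ys := hp
      cases h
      exact ⟨some fun i => ⟨⟨ys i, fun j => z (finSigmaFinEquiv ⟨i, j⟩)⟩, rfl⟩,
        Subtype.ext (Sigma.ext rfl (heq_of_eq (joinRight_split ys z)))⟩

/-- The factorizations of the tree `node g ts` in terms of those of the trees `ts i`. -/
noncomputable def nodeEquiv :
    Option (∀ i, TreeFactorization (ts i)) ≃ TreeFactorization (STerm.node g ts) :=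
  Equiv.ofBijective _ (ofOption_bijective g)

variable (K : Type v) [Field K] (A : ForestAlphabet S)

theorem forestPoly_bottom {t : STerm S} (p : TreeFactorization t) :
    forestPoly K A p.bottom = (List.ofFn fun j => treePoly K A A.root (p.1.2 j)).prod := by
  rw [forestPoly_eq_prod, bottom]
  exact congrArg List.prod (List.map_ofFn ..)

theorem forestPoly_bottom_ofNode (q : ∀ i, TreeFactorization (ts i)) :
    forestPoly K A (ofNode g q).bottom =
      (List.ofFn fun i => forestPoly K A (q i).bottom).prod := by
  rw [forestPoly_bottom]
  refine (list_prod_ofFn_finSigma (fun i => (q i).top.ar) rfl _).trans ?_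
  congr 2
  funext i
  rw [forestPoly_bottom]
  congr 2
  exact funext fun j => congrArg _ (joinRight_apply (fun i => (q i).1) i j)

end TreeFactorization

section TreeDoubling

open NCPoly

variable (K : Type v) [Field K] {S : ℕ → Type u} {A B : ForestAlphabet S}
  [∀ t : STerm S, Fintype (TreeFactorization t)] (Q : A.carrier → Prop) {n : ℕ} (g : S n)
  {ts : Fin n → STerm S}

theorem theta_leftQuotient_inl_sumTreePoly
    (hts : ∀ i (P : A.carrier → Prop), theta (sumTreePoly K P B.root (ts i)) =
      tensorCoeff (∑ p : TreeFactorization (ts i),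
        treePoly K A P p.top ⊗ₜ[K] forestPoly K B p.bottom)) (a : A.carrier) :
    theta (leftQuotient (Sum.inl a) (sumTreePoly K Q B.root (STerm.node g ts))) =
      tensorCoeff (∑ q : ∀ i, TreeFactorization (ts i),
        leftQuotient a (treePoly K A Q (TreeFactorization.ofNode g q).top) ⊗ₜ[K]
          forestPoly K B (TreeFactorization.ofNode g q).bottom) := by
  have hq (q : ∀ i, TreeFactorization (ts i)) := leftQuotient_treePoly_node K A Q g
    (fun i => (q i).top) a
  simp only [leftQuotient_inl_sumTreePoly, TreeFactorization.forestPoly_bottom_ofNode,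
    TreeFactorization.top_ofNode, hq]
  split_ifs
  · rw [theta_prod_ofFn _ _ fun i => hts i _, list_prod_ofFn_sum fun i => TreeFactorization (ts i)]
    simp only [list_prod_ofFn_tmul]
  · simp only [theta_zero, TensorProduct.zero_tmul, Finset.sum_const_zero, map_zero]

theorem theta_sumTreePoly (t : STerm S) :
    theta (sumTreePoly K Q B.root t) = tensorCoeff (∑ p : TreeFactorization t,
      treePoly K A Q p.top ⊗ₜ[K] forestPoly K B p.bottom) := by
  induction t generalizing Q with
  | leaf =>
    have hleaf (p : TreeFactorization (STerm.leaf (S := S))) : p = .ofLeaf _ :=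
      (freeOperad_isGrading S).factorization_one_eq p
    rw [sumTreePoly_leaf, theta_one,
      Fintype.sum_eq_single (.ofLeaf _) fun p hp => absurd (hleaf p) hp]
    refine congrArg tensorCoeff (Algebra.TensorProduct.one_def.trans ?_)
    exact (congrArg₂ (· ⊗ₜ[K] ·) (treePoly_leaf K A Q) (treePoly_leaf K B B.root)).symm
  | node g ts ih =>
    rw [← (TreeFactorization.nodeEquiv g).sum_comp, Fintype.sum_option, add_comm, map_add]
    refine theta_eq_add (coeff_treePoly_node_nil K _ _ g ts) (fun v => ?_) (fun u => ?_)
      (fun a u v => ?_) (fun b u v => ?_)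
    · rw [map_sum, Finset.sum_apply, Finset.sum_apply]
      refine Finset.sum_eq_zero fun q _ => (congrArg (· * _) ?_).trans (zero_mul _)
      exact coeff_treePoly_node_nil K A Q g _
    · refine (congrArg (_ * ·) ?_).trans (mul_zero _)
      exact coeff_treePoly_node_nil K B B.root g ts
    · rw [theta_leftQuotient_inl_sumTreePoly K Q g fun i P => ih i P]
      simp only [map_sum, Finset.sum_apply]
      rfl
    · rw [theta_leftQuotient_inr_sumTreePoly K Q _ g fun i P => theta_sumTreePoly_false K P _]
      exact congrArg (fun f => tensorCoeff (f ⊗ₜ[K] _) u v) (treePoly_leaf K A Q).symm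

end TreeDoubling

section ListFibers

variable {α β : Type*} (φ : α → β)

/-- The lists mapped by `φ` to `x :: l` are made of a head in the fiber of `x` and of a tail mapped
to `l`. -/
def listFiberCons (x : β) (l : List β) :
    {a // φ a = x} × {f : List α // f.map φ = l} ≃ {f : List α // f.map φ = x :: l} where
  toFun p := ⟨p.1.1 :: p.2.1, congrArg₂ List.cons p.1.2 p.2.2⟩
  invFun f :=
    match f with
    | ⟨[], h⟩ => (List.cons_ne_nil x l h.symm).elim
    | ⟨a :: f, h⟩ => ⟨⟨a, (List.cons.inj h).1⟩, ⟨f, (List.cons.inj h).2⟩⟩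
  left_inv _ := rfl
  right_inv f := by
    obtain ⟨_ | ⟨a, f⟩, h⟩ := f
    · exact (List.cons_ne_nil x l h.symm).elim
    · rfl

theorem finite_listFiber (h : ∀ x, Finite {a // φ a = x}) (l : List β) :
    Finite {f : List α // f.map φ = l} := by
  induction l with
  | nil => simpa only [List.map_eq_nil_iff] using inferInstanceAs (Finite {f : List α // f = []})
  | cons x l _ => exact Finite.of_equiv _ (listFiberCons φ x l)

theorem sum_listFiber_prod {R : Type*} [Semiring R] [∀ x, Fintype {a // φ a = x}]
    [∀ l : List β, Fintype {f : List α // f.map φ = l}] (g : α → R) (l : List β) :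
    ∑ f : {f : List α // f.map φ = l}, (f.1.map g).prod =
      (l.map fun x => ∑ a : {a // φ a = x}, g a).prod := by
  induction l with
  | nil =>
    exact Fintype.sum_eq_single (⟨[], rfl⟩ : {f : List α // f.map φ = []}) fun f hf =>
      absurd (Subtype.ext (List.map_eq_nil_iff.1 f.2)) hf
  | cons x l ih =>
    rw [← (listFiberCons φ x l).sum_comp, List.map_cons, List.prod_cons, ← ih, Finset.sum_mul_sum,
      ← Fintype.sum_prod_type']
    rfl

end ListFibers

namespace NSOperad

section QuotientEmbedding

variable (K : Type v) [Field K] {O : NSOperad.{u}} (C : O.Congruence)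

namespace Congruence

/-- The type of the representatives of an equivalence class. -/
abbrev Fiber (x : C.quotient.carrier) : Type u := {t : O.carrier // C.cls t = x}

variable {C} in
theorem FiniteType.finite_fiber (h : C.FiniteType) (x : C.quotient.carrier) :
    Finite (C.Fiber x) := by
  obtain ⟨t, rfl⟩ := C.exists_rep x
  exact (h t).subset fun s hs => C.iseqv.symm (C.cls_eq.1 hs)

/-- The representatives of the classes other than the unit are other than the unit. -/
def nonUnitFiberEquiv (x : C.quotient.NonUnit) :
    {t : O.NonUnit // C.cls t.1 = x.1} ≃ C.Fiber x.1 :=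
  Equiv.subtypeSubtypeEquivSubtype fun {t} (ht : C.cls t = x.1) (h : t = O.one) =>
    x.2 (ht.symm.trans (congrArg C.cls h))

/-- Pairs of a representative of a class and of a factorization of this representative correspond
to factorizations of the class together with representatives of the factors. -/
noncomputable def fiberFactorizationEquiv (x : C.quotient.carrier) :
    (Σ t : C.Fiber x, O.Factorization t.1) ≃
      (Σ P : C.quotient.Factorization x, C.Fiber P.1.1 × (∀ i, C.Fiber (P.1.2 i))) where
  toFun s := ⟨⟨⟨C.cls s.2.1.1, fun i => C.cls (s.2.1.2 i)⟩,
    (C.quoComp_cls s.2.1.1 s.2.1.2 _ fun i i' h => by rw [Fin.ext h]).trans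
      ((congrArg C.cls s.2.2).trans s.1.2)⟩, ⟨s.2.1.1, rfl⟩, fun i => ⟨s.2.1.2 i, rfl⟩⟩
  invFun r := ⟨⟨O.comp r.2.1.1 fun i =>
      (r.2.2 (Fin.cast (congrArg C.quoAr r.2.1.2) i)).1, by
        obtain ⟨⟨⟨Y, W⟩, h⟩, ⟨y, hy⟩, z⟩ := r
        dsimp only at hy z
        subst hy
        refine Eq.trans (Eq.symm (C.quoComp_cls y _ _ fun i i' hi => ?_)) h
        rw [Fin.ext hi]
        exact (z i').2.symm⟩,
    ⟨⟨r.2.1.1, fun i => (r.2.2 (Fin.cast (congrArg C.quoAr r.2.1.2) i)).1⟩, rfl⟩⟩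
  left_inv s := by
    obtain ⟨⟨t, ht⟩, ⟨⟨y, z⟩, h⟩⟩ := s
    dsimp only at h
    subst h
    rfl
  right_inv r := by
    obtain ⟨⟨⟨Y, W⟩, h⟩, ⟨y, hy⟩, z⟩ := r
    dsimp only at hy z
    subst hy
    obtain ⟨z', hz, rfl⟩ : ∃ (z' : Fin (C.quoAr (C.cls y)) → O.carrier)
      (hz : ∀ i, C.cls (z' i) = W i), z = fun i => ⟨z' i, hz i⟩ := ⟨_, fun i => (z i).2, rfl⟩
    obtain rfl : (fun i => C.cls (z' i)) = W := funext hz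
    rfl

end Congruence

variable [∀ x, Fintype (C.Fiber x)]

/-- The embedding `quotEmbed` as a morphism of algebras. -/
noncomputable def quotEmbedHom : C.quotient.Natural K →ₐ[K] O.Natural K :=
  MonoidAlgebra.lift K (O.Natural K) C.quotient.RedWord
    (FreeMonoid.lift fun x => ∑ t : C.Fiber x.1, letter K t.1)

theorem quotEmbedHom_letter_nonUnit (x : C.quotient.NonUnit) :
    quotEmbedHom K C (letter K x.1) = ∑ t : C.Fiber x.1, letter K t.1 := by
  rw [letter_nonUnit, E, quotEmbedHom, MonoidAlgebra.lift_single, one_smul, FreeMonoid.lift_eval_of]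

theorem quotEmbedHom_letter (h1 : ∀ t, C.rel t O.one → t = O.one) (x : C.quotient.carrier) :
    quotEmbedHom K C (letter K x) = ∑ t : C.Fiber x, letter K t.1 := by
  by_cases hx : x = C.quotient.one
  · subst hx
    rw [letter_one, map_one, ← letter_one]
    exact (Fintype.sum_eq_single (f := fun t : C.Fiber C.quotient.one => letter K t.1)
      ⟨O.one, rfl⟩ fun t ht => absurd (Subtype.ext (h1 _ (C.cls_eq.1 t.2))) ht).symm
  · exact quotEmbedHom_letter_nonUnit K C ⟨x, hx⟩

theorem quotEmbedHom_E (w : C.quotient.RedWord) : quotEmbedHom K C (E K w) =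
    ∑ᶠ f ∈ {f : O.RedWord | f.toList.map (fun y => C.cls y.1) = w.toList.map Subtype.val},
      E K f := by
  let φ (t : O.NonUnit) : C.quotient.carrier := C.cls t.1
  have hfib (x : C.quotient.carrier) : Finite {t // φ t = x} :=
    Finite.of_injective (fun t => (⟨t.1.1, t.2⟩ : C.Fiber x)) fun t t' h =>
      Subtype.ext (Subtype.ext (Subtype.mk.inj h))
  have (x : C.quotient.carrier) : Fintype {t // φ t = x} := Fintype.ofFinite _
  have (l : List C.quotient.carrier) : Fintype {f : List O.NonUnit // f.map φ = l} :=
    @Fintype.ofFinite _ (finite_listFiber φ hfib l)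
  have hx (x : C.quotient.NonUnit) :
      quotEmbedHom K C (letter K x.1) = ∑ t : {t // φ t = x.1}, letter K t.1.1 :=
    let e : {t // φ t = x.1} ≃ C.Fiber x.1 := C.nonUnitFiberEquiv x
    (quotEmbedHom_letter_nonUnit K C x).trans (e.sum_comp fun t => letter K t.1).symm
  rw [E_eq_prod, map_list_prod, List.map_map]
  calc
    _ = ((w.toList.map Subtype.val).map fun x => ∑ t : {t // φ t = x}, letter K t.1.1).prod := by
      simp only [List.map_map, Function.comp_def, hx]
    _ = ∑ f : {f : List O.NonUnit // f.map φ = w.toList.map Subtype.val},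
          (f.1.map fun t => letter K t.1).prod :=
      (sum_listFiber_prod φ (fun t => letter K t.1) _).symm
    _ = ∑ᶠ f : {f : O.RedWord | f.toList.map φ = w.toList.map Subtype.val}, E K f.1 := by
      simp only [E_eq_prod]
      exact (finsum_eq_sum_of_fintype _).symm
    _ = _ := finsum_set_coe_eq_finsum_mem _

theorem quotEmbed_eq : quotEmbed K C = (quotEmbedHom K C).toLinearMap := by
  refine Natural.linearMap_ext fun w => ?_
  rw [AlgHom.toLinearMap_apply, quotEmbedHom_E, E, ← MonoidAlgebra.basis_apply]
  exact Module.Basis.constr_basis _ _ _ _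

theorem comul_quotEmbedHom (h1 : ∀ t, C.rel t O.one → t = O.one) (hf : O.FinitelyFactorizable)
    (hf' : C.quotient.FinitelyFactorizable) (x : C.quotient.Natural K) :
    O.comul K (quotEmbedHom K C x) = Algebra.TensorProduct.map (quotEmbedHom K C)
      (quotEmbedHom K C) (C.quotient.comul K x) := by
  have (x : O.carrier) : Fintype (O.Factorization x) := @Fintype.ofFinite _ (hf x)
  have (x : C.quotient.carrier) : Fintype (C.quotient.Factorization x) :=
    @Fintype.ofFinite _ (hf' x)
  suffices (O.comul K).comp (quotEmbedHom K C) = (Algebra.TensorProduct.map (quotEmbedHom K C)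
    (quotEmbedHom K C)).comp (C.quotient.comul K) from DFunLike.congr_fun this x
  refine Natural.algHom_ext fun x => ?_
  have hcomul (t : C.Fiber x.1) : O.comul K (letter K t.1) = ∑ p : O.Factorization t.1,
      letter K p.1.1 ⊗ₜ[K] (List.ofFn fun i => letter K (p.1.2 i)).prod := by
    rw [← comulGen_eq_sum]
    exact comul_letter_nonUnit ((C.nonUnitFiberEquiv x).symm t).1
  have hmap (P : C.quotient.Factorization x.1) :
      Algebra.TensorProduct.map (quotEmbedHom K C) (quotEmbedHom K C)
        (letter K P.1.1 ⊗ₜ[K] (List.ofFn fun i => letter K (P.1.2 i)).prod) =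
      ∑ r : C.Fiber P.1.1 × (∀ i, C.Fiber (P.1.2 i)),
        letter K r.1.1 ⊗ₜ[K] (List.ofFn fun i => letter K (r.2 i).1).prod := by
    rw [Algebra.TensorProduct.map_tmul, map_list_prod_ofFn]
    simp only [quotEmbedHom_letter K C h1]
    rw [list_prod_ofFn_sum fun i => C.Fiber (P.1.2 i), TensorProduct.sum_tmul,
      Fintype.sum_prod_type]
    simp only [TensorProduct.tmul_sum]
  rw [AlgHom.comp_apply, AlgHom.comp_apply, quotEmbedHom_letter_nonUnit, comul_letter_nonUnit,
    comulGen_eq_sum, map_sum, map_sum]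
  simp only [hcomul, hmap]
  rw [← Fintype.sum_sigma', ← Fintype.sum_sigma', ← (C.fiberFactorizationEquiv x.1).sum_comp]
  rfl

end QuotientEmbedding

end NSOperad

section Realization

open NSOperad

variable (K : Type v) [Field K] {S : ℕ → Type u}

/-- The `A`-realization map of the free operad as a morphism of algebras. -/
noncomputable def realizationHom (A : ForestAlphabet S) :
    (freeOperad S).Natural K →ₐ[K] NCPoly K A.carrier :=
  MonoidAlgebra.lift K (NCPoly K A.carrier) (freeOperad S).RedWord
    (FreeMonoid.lift fun t => treePoly K A A.root t.1)

theorem realizationHom_letter (A : ForestAlphabet S) (t : (freeOperad S).carrier) :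
    realizationHom K A (letter K t) = treePoly K A A.root t := by
  by_cases ht : t = (freeOperad S).one
  · rw [ht, letter_one, map_one]
    exact (treePoly_leaf K A A.root).symm
  · rw [letter_nonUnit K ⟨t, ht⟩, E, realizationHom, MonoidAlgebra.lift_single, one_smul,
      FreeMonoid.lift_eval_of]

theorem realizationHom_E (A : ForestAlphabet S) (f : (freeOperad S).RedWord) :
    realizationHom K A (E K f) = forestPoly K A (redForest f) := by
  rw [E_eq_prod, map_list_prod, List.map_map, Function.comp_def]
  simp only [realizationHom_letter]
  refine Eq.trans (congrArg List.prod ?_) (forestPoly_eq_prod K A (redForest f)).symm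
  exact (List.map_map (g := treePoly K A A.root) (f := Subtype.val) (l := f.toList)).symm

theorem realization_eq (A : ForestAlphabet S) :
    realization K A = (realizationHom K A).toLinearMap := by
  refine Natural.linearMap_ext fun f => ?_
  rw [AlgHom.toLinearMap_apply, realizationHom_E, E, ← MonoidAlgebra.basis_apply]
  exact Module.Basis.constr_basis _ _ _ _

theorem theta_realizationHom_letter (A B : ForestAlphabet S) (t : (freeOperad S).carrier) :
    NCPoly.theta (A := A.carrier) (B := B.carrier) (realizationHom K (A.sum B) (letter K t)) =
      NCPoly.tensorCoeff (Algebra.TensorProduct.map (realizationHom K A) (realizationHom K B)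
        ((freeOperad S).comul K (letter K t))) := by
  have (t : (freeOperad S).carrier) : Fintype ((freeOperad S).Factorization t) :=
    @Fintype.ofFinite _ (freeOperad_finitelyFactorizable S t)
  rw [realizationHom_letter, comul_letter (freeOperad_isGrading S), comulGen_eq_sum, map_sum]
  simp only [Algebra.TensorProduct.map_tmul, map_list_prod_ofFn, realizationHom_letter]
  let _ (t : STerm S) : Fintype (TreeFactorization t) := this t
  refine (theta_sumTreePoly K A.root t).trans (congrArg _ (Finset.sum_congr rfl fun p _ => ?_))
  exact congrArg _ (TreeFactorization.forestPoly_bottom K B p)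

theorem theta_realizationHom (A B : ForestAlphabet S) (x : (freeOperad S).Natural K) :
    NCPoly.theta (A := A.carrier) (B := B.carrier) (realizationHom K (A.sum B) x) =
      NCPoly.tensorCoeff (Algebra.TensorProduct.map (realizationHom K A) (realizationHom K B)
        ((freeOperad S).comul K x)) := by
  let R : (freeOperad S).Natural K →ₐ[K] NCPoly K (A.carrier ⊕ B.carrier) :=
    realizationHom K (A.sum B)
  let D := (Algebra.TensorProduct.map (realizationHom K A) (realizationHom K B)).comp
    ((freeOperad S).comul K)
  suffices NCPoly.thetaLinear ∘ₗ R.toLinearMap = NCPoly.tensorCoeff ∘ₗ D.toLinearMap from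
    LinearMap.congr_fun this x
  refine Natural.linearMap_ext fun w => ?_
  change NCPoly.theta (R (E K w)) = NCPoly.tensorCoeff (D (E K w))
  induction w using FreeMonoid.inductionOn' with
  | one =>
    rw [E_one, map_one, map_one]
    exact NCPoly.theta_one
  | of_mul t w ih =>
    rw [E_mul, map_mul, map_mul, ← letter_nonUnit]
    exact NCPoly.theta_mul (theta_realizationHom_letter K A B t.1) ih

end Realization

section MasRealization

open NSOperad

variable (K : Type v) [Field K] {S : ℕ → Type u}

noncomputable instance MAs.fintypeFiber (x : (masCongr S).quotient.carrier) :
    Fintype ((masCongr S).Fiber x) :=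
  @Fintype.ofFinite _ (masCongr_finiteType.finite_fiber x)

/-- The `A`-realization map of `MAs S` as a morphism of algebras. -/
noncomputable def masRealizationHom (A : ForestAlphabet S) :
    (MAs S).Natural K →ₐ[K] NCPoly K A.carrier :=
  (realizationHom K A).comp (quotEmbedHom K (masCongr S))

theorem masRealization_eq (A : ForestAlphabet S) :
    masRealization K A = (masRealizationHom K A).toLinearMap := by
  rw [masRealization, realization_eq, quotEmbed_eq]
  rfl

theorem theta_masRealizationHom (A B : ForestAlphabet S) (x : (MAs S).Natural K) :
    NCPoly.theta (A := A.carrier) (B := B.carrier) (masRealizationHom K (A.sum B) x) =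
      NCPoly.tensorCoeff (Algebra.TensorProduct.map (masRealizationHom K A)
        (masRealizationHom K B) ((MAs S).comul K x)) := by
  have hcomul := comul_quotEmbedHom K (masCongr S) (fun t => masCongr_rel_leaf.1)
    (freeOperad_finitelyFactorizable S) (MAs.finitelyFactorizable S) x
  have hmap := Algebra.TensorProduct.map_comp (realizationHom K A) (quotEmbedHom K (masCongr S))
    (realizationHom K B) (quotEmbedHom K (masCongr S))
  exact (theta_realizationHom K A B _).trans (congrArg NCPoly.tensorCoeff
    ((congrArg _ hcomul).trans (DFunLike.congr_fun hmap ((MAs S).comul K x)).symm))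

end MasRealization

namespace NSOperad

variable (O : NSOperad.{u})

/-- The partial composition `x ∘ᵢ y`, where the position `i` is a natural number so that equal
operations `x` may be substituted for one another; it is `x` if `i` is at least the arity of `x`. -/
def insertAt (x : O.carrier) (i : ℕ) (y : O.carrier) : O.carrier :=
  O.comp x fun k => if (k : ℕ) = i then y else O.one

variable {O} {x y z : O.carrier} {i j k : ℕ}

theorem insertAt_val (i : Fin (O.ar x)) : O.insertAt x i y = O.pcomp x i y := by
  simp only [insertAt, pcomp, Fin.ext_iff]

theorem insertAt_one : O.insertAt x i O.one = x := by
  simp only [insertAt, ite_self, O.comp_one]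

theorem comp_eq_self {z : Fin (O.ar x) → O.carrier} (h : ∀ i, z i = O.one) : O.comp x z = x :=
  (congrArg (O.comp x) (funext h)).trans (O.comp_one x)

theorem comp_congr_apply_val (h : x = y) (T : ℕ → O.carrier) :
    O.comp x (fun p => T p) = O.comp y fun p => T p :=
  O.comp_congr h _ _ fun _ _ hp => congrArg T hp

theorem one_comp_apply_val (T : ℕ → O.carrier) : O.comp O.one (fun p => T p) = T 0 := by
  refine Eq.trans (O.comp_congr rfl _ _ fun k k' _ => congrArg T ?_) (O.one_comp (T 0))
  exact Nat.lt_one_iff.1 (k.2.trans_eq O.ar_one)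

theorem one_insertAt : O.insertAt O.one 0 x = x :=
  one_comp_apply_val fun p => if p = 0 then x else O.one

theorem ar_insertAt (h : i < O.ar x) : O.ar (O.insertAt x i y) + 1 = O.ar x + O.ar y := by
  rw [insertAt_val ⟨i, h⟩, O.ar_pcomp]

theorem comp_comp_apply_val (x : O.carrier) (z T : ℕ → O.carrier) :
    O.comp (O.comp x fun i => z i) (fun p => T p) =
      O.comp x fun i => O.comp (z i) fun j => T (∑ l ∈ Finset.range i, O.ar (z l) + j) := by
  refine (O.assoc _ _ _).trans (congrArg (O.comp x) (funext fun i => ?_))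
  refine congrArg (O.comp (z i)) (funext fun j => congrArg T ((finSigmaFinEquiv_apply _).trans ?_))
  rw [Finset.sum_range]
  rfl

theorem sum_range_ar_ite (y : O.carrier) (k i : ℕ) :
    ∑ l ∈ Finset.range i, O.ar (if l = k then y else O.one) =
      if k < i then i + O.ar y - 1 else i := by
  induction i with
  | zero => rfl
  | succ i ih =>
    rw [Finset.sum_range_succ, ih, apply_ite O.ar, O.ar_one]
    split_ifs <;> omega

theorem comp_insertAt (x : O.carrier) (k : ℕ) (y : O.carrier) (T : ℕ → O.carrier) :
    O.comp (O.insertAt x k y) (fun p => T p) =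
      O.comp x fun i =>
        if (i : ℕ) < k then T i
        else if (i : ℕ) = k then O.comp y fun j => T (k + j) else T (i + O.ar y - 1) := by
  refine (comp_comp_apply_val x (fun i => if i = k then y else O.one) T).trans ?_
  refine congrArg (O.comp x) (funext fun i => ?_)
  simp only [sum_range_ar_ite]
  let T' (j : ℕ) : O.carrier := T ((if k < (i : ℕ) then i + O.ar y - 1 else i : ℕ) + j)
  rcases lt_trichotomy (i : ℕ) k with hi | hi | hi
  · refine (comp_congr_apply_val (if_neg hi.ne) T').trans ((one_comp_apply_val T').trans ?_)
    rw [if_pos hi]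
    exact congrArg T (if_neg hi.not_gt)
  · refine (comp_congr_apply_val (if_pos hi) T').trans ?_
    rw [if_neg hi.not_lt, if_pos hi]
    refine congrArg (O.comp y) (funext fun j => congrArg (fun p => T (p + j)) ?_)
    rw [if_neg hi.not_gt, hi]
  · refine (comp_congr_apply_val (if_neg hi.ne') T').trans ((one_comp_apply_val T').trans ?_)
    rw [if_neg hi.not_gt, if_neg hi.ne']
    exact congrArg T (if_pos hi)

theorem insertAt_insertAt (hj : j < O.ar y) :
    O.insertAt (O.insertAt x i y) (i + j) z = O.insertAt x i (O.insertAt y j z) := by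
  refine (comp_insertAt x i y fun p => if p = i + j then z else O.one).trans ?_
  refine congrArg (O.comp x) (funext fun k => ?_)
  rcases lt_trichotomy (k : ℕ) i with hk | hk | hk
  · rw [if_pos hk, if_neg (by omega), if_neg hk.ne]
  · rw [if_neg hk.not_lt, if_pos hk, if_pos hk]
    simp only [Nat.add_left_cancel_iff]
    rfl
  · rw [if_neg hk.not_gt, if_neg hk.ne', if_neg (by omega), if_neg hk.ne']

theorem insertAt_insertAt_comm (h : i < k) :
    O.insertAt (O.insertAt x i y) (k + O.ar y - 1) z = O.insertAt (O.insertAt x k z) i y := by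
  refine (comp_insertAt x i y fun p => if p = k + O.ar y - 1 then z else O.one).trans
    (Eq.trans (congrArg (O.comp x) (funext fun l => ?_))
      (comp_insertAt x k z fun p => if p = i then y else O.one).symm)
  have hy : (O.comp y fun j => if i + j = k + O.ar y - 1 then z else O.one) = y :=
    comp_eq_self fun j => if_neg (by omega)
  have hz : (O.comp z fun j => if k + j = i then y else O.one) = z :=
    comp_eq_self fun j => if_neg (by omega)
  rw [hy, hz]
  split_ifs <;> first | rfl | omega

theorem comp_eq_insertAt (x : O.carrier) (z : ℕ → O.carrier) (k : ℕ) :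
    O.comp x (fun i => if (i : ℕ) < k then O.one else z i) =
      O.insertAt (O.comp x fun i => if (i : ℕ) < k + 1 then O.one else z i) k (z k) := by
  let z' (i : ℕ) : O.carrier := if i < k + 1 then O.one else z i
  have ar_z' {i : ℕ} (hi : i ≤ k) : O.ar (z' i) = 1 :=
    (congrArg O.ar (if_pos (Nat.lt_succ_of_le hi))).trans O.ar_one
  have sum_ar_z' {i : ℕ} (hi : i ≤ k + 1) : ∑ l ∈ Finset.range i, O.ar (z' l) = i := by
    refine (Finset.sum_congr rfl fun l hl => ar_z' ?_).trans (by simp)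
    have := Finset.mem_range.1 hl
    omega
  refine Eq.symm ((comp_comp_apply_val x z' fun p => if p = k then z k else O.one).trans ?_)
  refine congrArg (O.comp x) (funext fun i => ?_)
  by_cases hi : (i : ℕ) ≤ k
  · let T (p : ℕ) : O.carrier := if i + p = k then z k else O.one
    rw [sum_ar_z' (by omega)]
    refine (comp_congr_apply_val (if_pos (Nat.lt_succ_of_le hi)) T).trans
      ((one_comp_apply_val T).trans ?_)
    simp only [T, add_zero]
    rcases hi.lt_or_eq with hi | hi
    · rw [if_neg hi.ne, if_pos hi]
    · rw [if_pos hi, if_neg hi.not_lt, hi]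
  · rw [if_neg (by omega)]
    refine (comp_eq_self fun j => if_neg ?_).trans (if_neg (by omega))
    have := Finset.sum_le_sum_of_subset (f := fun l => O.ar (z' l))
      (Finset.range_subset_range.2 (show k + 1 ≤ i by omega))
    rw [sum_ar_z' le_rfl] at this
    omega

end NSOperad

namespace STerm

variable {S : ℕ → Type u}

theorem ar_corolla {n : ℕ} (g : S n) : (corolla g).ar = n := by
  simp only [corolla, ar, Finset.sum_const, Finset.card_univ, Fintype.card_fin, smul_eq_mul,
    mul_one]

theorem graft_corolla {n : ℕ} (g : S n) (T : ℕ → STerm S) :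
    graft (corolla g) (fun p => T p) = node g fun i => T i := by
  refine congrArg (node g) (funext fun i => congrArg T ?_)
  refine (finSigmaFinEquiv_apply _).trans ?_
  simp only [ar, Finset.sum_const, Finset.card_univ, Fintype.card_fin, smul_eq_mul, mul_one,
    add_zero]

theorem ar_pos [IsEmpty (S 0)] (t : STerm S) : 0 < t.ar := by
  induction t with
  | leaf => exact Nat.one_pos
  | @node n g ts ih =>
    have : NeZero n := ⟨by rintro rfl; exact isEmptyElim g⟩
    exact (ih 0).trans_le (Finset.single_le_sum_of_canonicallyOrdered (f := fun i => (ts i).ar)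
      (Finset.mem_univ 0))

end STerm

namespace MAs

open STerm

variable {S : ℕ → Type u}

/-- The operation of `MAs S` represented by a tree. -/
def mk (t : STerm S) : (MAs S).carrier := (masCongr S).cls t

/-- The operation of `MAs S` represented by a tree with a single internal node. -/
def gen (g : Σ n, S n) : (MAs S).carrier := mk (corolla g.2)

theorem ar_gen (g : Σ n, S n) : (MAs S).ar (gen g) = g.1 := ar_corolla g.2

theorem mk_graft (t : STerm S) (s : ℕ → STerm S) :
    mk (graft t fun i => s i) = (MAs S).comp (mk t) fun i => mk (s i) :=
  ((masCongr S).quoComp_cls t _ _ fun _ _ hi => congrArg (fun i => mk (s i)) hi).symm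

theorem gen_insertAt_gen (g h : Σ n, S n) {i j : ℕ} (hi : i < g.1) (hj : j < h.1) :
    (MAs S).insertAt (gen g) i (gen h) = (MAs S).insertAt (gen h) j (gen g) := by
  have insertAt_gen (a b : Σ n, S n) {k : ℕ} (hk : k < (freeOperad S).ar (corolla a.2)) :
      (MAs S).insertAt (gen a) k (gen b) =
        mk ((freeOperad S).pcomp (corolla a.2) ⟨k, hk⟩ (corolla b.2)) := by
    refine Eq.trans (congrArg ((MAs S).comp (gen a)) (funext fun i => ?_))
      ((mk_graft (corolla a.2) fun i => if i = k then corolla b.2 else leaf).symm.trans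
        (congrArg mk (NSOperad.insertAt_val (O := freeOperad S) ⟨k, hk⟩)))
    exact (apply_ite mk _ _ _).symm
  have hi' := hi.trans_eq (ar_corolla g.2).symm
  have hj' := hj.trans_eq (ar_corolla h.2).symm
  rw [insertAt_gen g h hi', insertAt_gen h g hj']
  exact (masCongr S).cls_eq.2 (.of ⟨_, _, g.2, h.2, ⟨i, hi'⟩, ⟨j, hj'⟩, rfl, rfl⟩)

variable [IsEmpty (S 0)]

theorem ar_pos (x : (MAs S).carrier) : 0 < (MAs S).ar x := by
  obtain ⟨t, rfl⟩ := (masCongr S).exists_rep x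
  exact t.ar_pos

theorem fst_pos (g : Σ n, S n) : 0 < g.1 := (ar_pos (gen g)).trans_eq (ar_gen g)

instance : LeftCommutative fun (g : Σ n, S n) x => (MAs S).insertAt x 0 (gen g) where
  left_comm g h x := by
    have insert_gen_gen (a b : Σ n, S n) : (MAs S).insertAt ((MAs S).insertAt x 0 (gen a)) 0 (gen b)
        = (MAs S).insertAt x 0 ((MAs S).insertAt (gen a) 0 (gen b)) :=
      NSOperad.insertAt_insertAt (ar_pos _)
    rw [insert_gen_gen, insert_gen_gen, gen_insertAt_gen h g (fst_pos h) (fst_pos g)]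

/-- The operation of `MAs S` that is the composite, in any order and at any positions, of the
generators in the multiset `M`. -/
noncomputable def ofContent (M : Multiset (Σ n, S n)) : (MAs S).carrier :=
  M.foldr (fun g x => (MAs S).insertAt x 0 (gen g)) (MAs S).one

theorem ofContent_cons (g : Σ n, S n) (M : Multiset (Σ n, S n)) :
    ofContent (g ::ₘ M) = (MAs S).insertAt (ofContent M) 0 (gen g) :=
  Multiset.foldr_cons _ _ _ _

theorem insertAt_ofContent_gen (M : Multiset (Σ n, S n)) (g : Σ n, S n) {i : ℕ}
    (hi : i < (MAs S).ar (ofContent M)) :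
    (MAs S).insertAt (ofContent M) i (gen g) = ofContent (g ::ₘ M) := by
  induction M using Multiset.induction_on generalizing i with
  | empty =>
    obtain rfl : i = 0 := Nat.lt_one_iff.1 hi
    rfl
  | cons h M ih =>
    rw [Multiset.cons_swap, ofContent_cons h, ofContent_cons h]
    rw [ofContent_cons] at hi
    rcases lt_or_ge i h.1 with hih | hih
    · calc (MAs S).insertAt ((MAs S).insertAt (ofContent M) 0 (gen h)) i (gen g)
          = (MAs S).insertAt (ofContent M) 0 ((MAs S).insertAt (gen h) i (gen g)) := by
            rw [← NSOperad.insertAt_insertAt (hih.trans_eq (ar_gen h).symm), zero_add]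
        _ = (MAs S).insertAt (ofContent M) 0 ((MAs S).insertAt (gen g) 0 (gen h)) := by
            rw [gen_insertAt_gen h g hih (fst_pos g)]
        _ = (MAs S).insertAt ((MAs S).insertAt (ofContent M) 0 (gen g)) 0 (gen h) :=
            (NSOperad.insertAt_insertAt (ar_pos _)).symm
        _ = (MAs S).insertAt (ofContent (g ::ₘ M)) 0 (gen h) := by rw [ofContent_cons]
    · obtain ⟨k, rfl⟩ := Nat.exists_eq_add_of_le hih
      have har := NSOperad.ar_insertAt (y := gen h) (ar_pos (ofContent M))
      rw [ar_gen] at har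
      rw [← ih (i := k + 1) (by omega),
        ← NSOperad.insertAt_insertAt_comm (Nat.succ_pos k), ar_gen]
      congr 1
      omega

theorem insertAt_ofContent (M N : Multiset (Σ n, S n)) {i : ℕ}
    (hi : i < (MAs S).ar (ofContent M)) :
    (MAs S).insertAt (ofContent M) i (ofContent N) = ofContent (M + N) := by
  induction N using Multiset.induction_on with
  | empty => exact NSOperad.insertAt_one.trans (congrArg ofContent (add_zero M).symm)
  | cons g N ih =>
    have hpos := ar_pos (ofContent N)
    have har := NSOperad.ar_insertAt (y := ofContent N) hi
    rw [ih] at har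
    rw [ofContent_cons, ← NSOperad.insertAt_insertAt hpos, ih, Multiset.add_cons,
      insertAt_ofContent_gen _ _ (by omega)]

theorem comp_ofContent (M : Multiset (Σ n, S n)) (N : ℕ → Multiset (Σ n, S n)) :
    (MAs S).comp (ofContent M) (fun i => ofContent (N i)) =
      ofContent (M + ∑ i ∈ Finset.range ((MAs S).ar (ofContent M)), N i) := by
  set a := (MAs S).ar (ofContent M)
  suffices key : ∀ k ≤ a, (MAs S).comp (ofContent M)
      (fun i => if (i : ℕ) < k then (MAs S).one else ofContent (N i)) =
        ofContent (M + ∑ i ∈ Finset.Ico k a, N i) by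
    simpa only [not_lt_zero, if_false, Finset.range_eq_Ico] using key 0 a.zero_le
  intro k hk
  induction hk using Nat.decreasingInduction with
  | self =>
    rw [Finset.Ico_self, Finset.sum_empty, add_zero]
    exact NSOperad.comp_eq_self fun i => if_pos i.2
  | of_succ k hk ih =>
    have hk' : k < (MAs S).ar (ofContent (M + ∑ i ∈ Finset.Ico (k + 1) a, N i)) := by
      rw [← ih, (MAs S).ar_comp]
      refine hk.trans_le ?_
      calc a = ∑ _ : Fin a, 1 := by simp
        _ ≤ _ := Finset.sum_le_sum fun i _ => ar_pos _
    refine (NSOperad.comp_eq_insertAt (ofContent M) (fun i => ofContent (N i)) k).trans ?_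
    rw [ih, insertAt_ofContent _ _ hk', add_assoc,
      Finset.sum_eq_sum_Ico_succ_bot hk, add_comm (N k)]

theorem mk_eq_ofContent (t : STerm S) : mk t = ofContent t.content := by
  induction t with
  | leaf => rfl
  | @node n g ts ih =>
    let T (i : ℕ) : STerm S := if h : i < n then ts ⟨i, h⟩ else leaf
    have mk_T (i : ℕ) : mk (T i) = ofContent (T i).content := by
      by_cases h : i < n
      · rw [show T i = ts ⟨i, h⟩ from dif_pos h]
        exact ih _
      · rw [show T i = leaf from dif_neg h]
        rfl
    have T_val : (fun i : Fin n => T i) = ts := funext fun i => dif_pos i.2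
    have gen_eq : gen ⟨n, g⟩ = ofContent {⟨n, g⟩} := NSOperad.one_insertAt.symm
    calc mk (node g ts)
        = mk (graft (corolla g) fun p => T p) := by rw [graft_corolla, T_val]
      _ = (MAs S).comp (gen ⟨n, g⟩) fun p => ofContent (T p).content := by
          refine (mk_graft (corolla g) T).trans ?_
          exact congrArg ((MAs S).comp (gen ⟨n, g⟩)) (funext fun p => mk_T p)
      _ = (MAs S).comp (ofContent {⟨n, g⟩}) fun p => ofContent (T p).content :=
          NSOperad.comp_congr_apply_val gen_eq fun p => ofContent (T p).content
      _ = ofContent ({⟨n, g⟩} + ∑ p ∈ Finset.range n, (T p).content) := by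
          refine (comp_ofContent {⟨n, g⟩} fun p => (T p).content).trans ?_
          rw [← gen_eq, ar_gen]
      _ = ofContent (node g ts).content := by
          rw [content_node, ← Multiset.singleton_add, Finset.sum_range, ← T_val]

end MAs

section TestWords

variable {S : ℕ → Type u}

theorem STerm.exists_edge {t : STerm S} {k : ℕ} (hk : 0 < k) (hkt : k < t.deg) :
    ∃ j a, t.Edge j a k := by
  induction t generalizing k with
  | leaf => exact absurd hkt (Nat.not_lt_zero _)
  | node g ts ih =>
    have hx := List.getElem?_eq_getElem (hkt.trans_eq (length_nodes _).symm)
    obtain ⟨rfl, -⟩ | ⟨i, k', rfl, hx'⟩ := (getElem?_nodes_node g ts k _).1 hx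
    · exact absurd hk (lt_irrefl 0)
    have hk' : k' < (ts i).deg := by
      rw [← length_nodes]
      exact (List.getElem?_eq_some_iff.1 hx').1
    rcases Nat.eq_zero_or_pos k' with rfl | h0
    · exact ⟨Nat.succPNat i, 0, i, Or.inl ⟨fun h => hk'.ne' (deg_eq_zero.2 h), rfl, rfl, rfl⟩⟩
    · obtain ⟨j, a, h⟩ := ih i h0 hk'
      exact ⟨j, offset ts i + a, i, Or.inr ⟨a, k', h, rfl, rfl⟩⟩

namespace SForest

open ForestAlphabet (lengthAlphabet)

theorem Compatible.root_lt {w : List ((Σ n, S n) × ℕ)} {t : STerm S}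
    (h : Compatible (lengthAlphabet S) w [t]) {k : ℕ} (hk : 0 < k) (hkw : k < w.length) :
    w[0].2 < w[k].2 := by
  induction k using Nat.strong_induction_on with
  | _ k ih =>
    obtain ⟨j, m, he⟩ := STerm.exists_edge hk (hkw.trans_eq (h.length_eq.trans (deg_singleton t)))
    have hmk := he.lt.1
    have parent_lt : w[m].2 < w[k].2 := h.edge m k j _ _ (edge_singleton.2 he)
      (List.getElem?_eq_getElem _) (List.getElem?_eq_getElem _)
    rcases Nat.eq_zero_or_pos m with rfl | hm
    · exact parent_lt
    · exact (ih m hmk hm _).trans parent_lt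

/-- A word compatible with `f`, such that the indices increase along each tree of `f` and decrease
from one tree to the next. -/
def testWord : SForest S → List ((Σ n, S n) × ℕ)
  | [] => []
  | t :: f => t.nodes.zipIdx (deg f) ++ testWord f

theorem length_zipIdx_nodes (t : STerm S) (d : ℕ) : (t.nodes.zipIdx d).length = t.deg := by
  rw [List.length_zipIdx, STerm.length_nodes]

theorem zipIdx_nodes_ne_nil {t : STerm S} (ht : t ≠ STerm.leaf) (d : ℕ) :
    t.nodes.zipIdx d ≠ [] :=
  List.length_pos_iff.1 ((STerm.deg_pos ht).trans_eq (length_zipIdx_nodes t d).symm)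

theorem lt_of_mem_testWord {f : SForest S} {a : (Σ n, S n) × ℕ} (ha : a ∈ testWord f) :
    a.2 < f.deg := by
  induction f with
  | nil => exact absurd ha List.not_mem_nil
  | cons t f ih =>
    rw [deg_cons]
    rcases List.mem_append.1 ha with h | h
    · have := List.snd_lt_add_of_mem_zipIdx h
      rw [STerm.length_nodes] at this
      omega
    · have := ih h
      omega

theorem compatible_zipIdx (t : STerm S) (d : ℕ) :
    Compatible (lengthAlphabet S) (t.nodes.zipIdx d) [t] := by
  have eq_of_getElem? {i : ℕ} {a : (Σ n, S n) × ℕ} (h : (t.nodes.zipIdx d)[i]? = some a) :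
      t.nodes[i]? = some a.1 ∧ a.2 = d + i := by
    rw [List.getElem?_zipIdx] at h
    obtain ⟨b, hb, rfl⟩ := Option.map_eq_some_iff.1 h
    exact ⟨hb, rfl⟩
  refine ⟨?_, fun _ _ _ _ => trivial, fun i a g hg ha => ?_, fun i i' j a a' he ha ha' => ?_⟩
  · exact (length_zipIdx_nodes t d).trans (deg_singleton t).symm
  · rw [nodes_singleton] at hg
    exact Option.some.inj ((eq_of_getElem? ha).1.symm.trans hg)
  · have hlt := (edge_singleton.1 he).lt.1
    have ha := (eq_of_getElem? ha).2
    have ha' := (eq_of_getElem? ha').2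
    change a.2 < a'.2
    omega

theorem compatible_testWord (f : SForest S) : Compatible (lengthAlphabet S) (testWord f) f := by
  induction f with
  | nil => exact compatible_nil.2 rfl
  | cons t f ih =>
    have hl := length_zipIdx_nodes t (deg f)
    refine compatible_cons.2 ⟨?_, ?_⟩
    · exact (List.take_left' hl : (testWord (t :: f)).take t.deg = _) ▸ compatible_zipIdx t _
    · exact (List.drop_left' hl : (testWord (t :: f)).drop t.deg = _) ▸ ih

variable {s : List ((Σ n, S n) × ℕ)} {f f' : SForest S} {t : STerm S}

/- The first letter of `s` is the one of the root of `t`, and the letters of `t` that follow it have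
a larger index, contrary to those of `testWord f`. -/
theorem Compatible.deg_le_of_append_testWord (hs : s ≠ []) (hsf : ∀ a ∈ s, f.deg ≤ a.2)
    (h : Compatible (lengthAlphabet S) (s ++ testWord f) (t :: f')) : t.deg ≤ s.length := by
  by_contra! hlt
  have hpos := List.length_pos_iff.2 hs
  have hlen : s.length < ((s ++ testWord f).take t.deg).length :=
    hlt.trans_eq (h.take.length_eq.trans (deg_singleton t)).symm
  have root_lt := Compatible.root_lt (w := (s ++ testWord f).take t.deg) h.take hpos hlen
  rw [List.getElem_take, List.getElem_take, List.getElem_append_left hpos,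
    List.getElem_append_right le_rfl] at root_lt
  have := hsf _ (List.getElem_mem hpos)
  exact (lt_of_mem_testWord (List.getElem_mem _)).not_ge (this.trans root_lt.le)

theorem Compatible.drop_append_testWord (ht : t.deg ≤ s.length)
    (h : Compatible (lengthAlphabet S) (s ++ testWord f) (t :: f')) :
    Compatible (lengthAlphabet S) (s.drop t.deg ++ testWord f) f' :=
  (List.drop_append_of_le_length ht : (s ++ testWord f).drop t.deg = _) ▸ h.drop

theorem Compatible.length_lt_of_append_testWord (hs : s ≠ []) (hsf : ∀ a ∈ s, f.deg ≤ a.2)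
    (hf : ∀ t ∈ f, t ≠ STerm.leaf)
    (h : Compatible (lengthAlphabet S) (s ++ testWord f) f') : f.length < f'.length := by
  induction f' generalizing s f with
  | nil => exact absurd (List.append_eq_nil_iff.1 (compatible_nil.1 h)).1 hs
  | cons t' f' ih =>
    have hdrop := h.drop_append_testWord (h.deg_le_of_append_testWord hs hsf)
    rw [List.length_cons]
    by_cases hs' : s.drop t'.deg = []
    · rw [hs'] at hdrop
      rcases f with _ | ⟨t, f⟩
      · exact Nat.succ_pos _
      · rw [List.forall_mem_cons] at hf
        exact Nat.succ_lt_succ (ih (zipIdx_nodes_ne_nil hf.1 _)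
          (fun _ => List.le_snd_of_mem_zipIdx) hf.2 hdrop)
    · exact (ih hs' (fun a ha => hsf a (List.mem_of_mem_drop ha)) hf hdrop).trans
        (Nat.lt_succ_self _)

theorem Compatible.nodes_eq_of_zipIdx {d : ℕ} {t' : STerm S}
    (h : Compatible (lengthAlphabet S) (t.nodes.zipIdx d) [t']) : t'.nodes = t.nodes := by
  have hdeg : t'.deg = t.deg :=
    ((length_zipIdx_nodes t d).symm.trans (h.length_eq.trans (deg_singleton t'))).symm
  refine List.ext_getElem (by rw [STerm.length_nodes, STerm.length_nodes, hdeg]) fun i hi hi' => ?_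
  refine (h.deco i (t.nodes[i], d + i) t'.nodes[i] ?_ (List.getElem?_zipIdx.trans ?_)).symm
  · rw [nodes_singleton, List.getElem?_eq_getElem hi]
  · rw [List.getElem?_eq_getElem hi']
    rfl

theorem Compatible.map_nodes_eq_of_testWord (hf : ∀ t ∈ f, t ≠ STerm.leaf)
    (hl : f'.length ≤ f.length) (h : Compatible (lengthAlphabet S) (testWord f) f') :
    f'.map STerm.nodes = f.map STerm.nodes := by
  induction f generalizing f' with
  | nil => rw [List.length_eq_zero_iff.1 (Nat.le_zero.1 hl)]
  | cons t f ih =>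
    rw [List.forall_mem_cons] at hf
    have hs := zipIdx_nodes_ne_nil hf.1 (deg f)
    have hsf : ∀ a ∈ t.nodes.zipIdx (deg f), deg f ≤ a.2 := fun _ => List.le_snd_of_mem_zipIdx
    rcases f' with _ | ⟨t', f'⟩
    · exact absurd (List.append_eq_nil_iff.1 (compatible_nil.1 h)).1 hs
    have hle := h.deg_le_of_append_testWord hs hsf
    have hdrop := h.drop_append_testWord hle
    have hl' := Nat.le_of_succ_le_succ hl
    have hnil : (t.nodes.zipIdx (deg f)).drop t'.deg = [] := by
      by_contra hne
      have := hdrop.length_lt_of_append_testWord hne (fun a ha => hsf a (List.mem_of_mem_drop ha))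
        hf.2
      omega
    have hdeg := hle.antisymm (List.drop_eq_nil_iff.1 hnil)
    have htake := (List.take_left' hdeg.symm : (testWord (t :: f)).take t'.deg = _) ▸ h.take
    rw [hnil] at hdrop
    rw [List.map_cons, List.map_cons, ih hf.2 hl' hdrop, htake.nodes_eq_of_zipIdx]

end SForest

end TestWords

section Coefficients

namespace NCPoly

variable {K : Type v} [Field K] {A : Type u}

/-- The coefficient of a word as a linear form on polynomials. -/
def coeffLinear (w : List A) : NCPoly K A →ₗ[K] K where
  toFun f := f.1.coeff w
  map_add' _ _ := rfl
  map_smul' _ _ := rfl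

end NCPoly

/-- The forests whose trees represent the operations of the list `l`. -/
abbrev MAs.ForestRep {S : ℕ → Type u} (l : List (MAs S).carrier) : Type u :=
  {f : SForest S // f.map MAs.mk = l}

open NSOperad

variable (K : Type v) [Field K] {S : ℕ → Type u}

noncomputable instance (x : (MAs S).carrier) : Fintype {t : STerm S // MAs.mk t = x} :=
  MAs.fintypeFiber x

noncomputable instance (l : List (MAs S).carrier) : Fintype (MAs.ForestRep l) :=
  @Fintype.ofFinite _ (finite_listFiber MAs.mk masCongr_finiteType.finite_fiber l)

theorem masRealizationHom_letter_nonUnit (A : ForestAlphabet S) (x : (MAs S).NonUnit) :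
    masRealizationHom K A (letter K x.1) =
      ∑ t : {t : STerm S // MAs.mk t = x.1}, treePoly K A A.root t.1 := by
  refine (congrArg (realizationHom K A) (quotEmbedHom_letter_nonUnit K (masCongr S) x)).trans ?_
  rw [map_sum]
  exact Finset.sum_congr rfl fun t _ => realizationHom_letter K A t.1

theorem masRealizationHom_E (A : ForestAlphabet S) (w : (MAs S).RedWord) :
    masRealizationHom K A (E K w) =
      ∑ f : MAs.ForestRep (w.toList.map Subtype.val), forestPoly K A f.1 := by
  have hfib := sum_listFiber_prod MAs.mk (treePoly K A A.root) (w.toList.map Subtype.val)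
  simp only [← forestPoly_eq_prod, List.map_map, Function.comp_def] at hfib
  rw [E_eq_prod, map_list_prod, List.map_map, Function.comp_def]
  simp only [masRealizationHom_letter_nonUnit]
  exact hfib.symm

theorem coeff_masRealizationHom_E (A : ForestAlphabet S) (w : (MAs S).RedWord)
    (u : List A.carrier) :
    (masRealizationHom K A (E K w)).1.coeff u =
      Nat.card {f : MAs.ForestRep (w.toList.map Subtype.val) // SForest.Compatible A u f.1} := by
  classical
  rw [Nat.card_eq_fintype_card, Fintype.card_subtype, Finset.natCast_card_filter,
    masRealizationHom_E]
  exact map_sum (NCPoly.coeffLinear u) _ _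

theorem masRealization_isHomogeneous (A : ForestAlphabet S) (n : ℕ) {x : (MAs S).Natural K}
    (hx : x ∈ (MAs S).homogeneous K (MAs.deg S) n) :
    NCPoly.IsHomogeneous n (masRealization K A x) := by
  intro u hu
  suffices (MAs S).homogeneous K (MAs.deg S) n ≤
      LinearMap.ker (NCPoly.coeffLinear u ∘ₗ masRealization K A) from this hx
  rw [homogeneous, Submodule.span_le]
  rintro _ ⟨w, rfl, rfl⟩
  change (masRealization K A (E K w)).1.coeff u = 0
  rw [masRealization_eq, AlgHom.toLinearMap_apply, coeff_masRealizationHom_E]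
  have : IsEmpty {f : MAs.ForestRep (w.toList.map Subtype.val) // SForest.Compatible A u f.1} := by
    refine ⟨fun f => hu (f.2.length_eq.trans ?_)⟩
    have hdeg := congrArg (fun l => (l.map (MAs.deg S)).sum) f.1.2
    rw [List.map_map, List.map_map] at hdeg
    exact hdeg
  rw [Nat.card_of_isEmpty, Nat.cast_zero]

end Coefficients

section Injectivity

theorem injective_of_triangular {K V W ι α : Type*} [Field K] [AddCommGroup V] [Module K V]
    [AddCommGroup W] [Module K W] [LinearOrder α] (b : Module.Basis ι K V) (F : V →ₗ[K] W)
    (ℓ : ι → α) (c : ι → W →ₗ[K] K) (hdiag : ∀ i, c i (F (b i)) ≠ 0)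
    (hzero : ∀ i j, ℓ j ≤ ℓ i → j ≠ i → c i (F (b j)) = 0) : Function.Injective F := by
  rw [injective_iff_map_eq_zero]
  intro x hx
  by_contra hx0
  have hsupp : (b.repr x).support.Nonempty := by
    rwa [Finsupp.support_nonempty_iff, Ne, map_eq_zero_iff _ b.repr.injective]
  obtain ⟨i, hi, hmax⟩ := Finset.exists_max_image _ ℓ hsupp
  refine mul_ne_zero (Finsupp.mem_support_iff.1 hi) (hdiag i) ?_
  calc b.repr x i * c i (F (b i))
      = ∑ j ∈ (b.repr x).support, b.repr x j * c i (F (b j)) :=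
        (Finset.sum_eq_single_of_mem (f := fun j => b.repr x j * c i (F (b j))) i hi
          fun j hj hji => by rw [hzero i j (hmax j hj) hji, mul_zero]).symm
    _ = c i (F x) := by
        conv_rhs => rw [← b.linearCombination_repr x, Finsupp.linearCombination_apply]
        simp only [Finsupp.sum, map_sum, map_smul, smul_eq_mul]
    _ = 0 := by rw [hx, map_zero]

namespace MAs

variable {S : ℕ → Type u}

/-- A forest representing the reduced word `w`. -/
noncomputable def outForest (w : (MAs S).RedWord) : SForest S :=
  w.toList.map fun x => (masCongr S).out x.1

theorem map_mk_outForest (w : (MAs S).RedWord) :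
    (outForest w).map mk = w.toList.map Subtype.val := by
  refine (List.map_map ..).trans (List.map_congr_left fun x _ => ?_)
  exact (masCongr S).cls_out x.1

theorem length_outForest (w : (MAs S).RedWord) : (outForest w).length = w.toList.length :=
  List.length_map _

theorem ne_leaf_of_mem_outForest {w : (MAs S).RedWord} {t : STerm S} (ht : t ∈ outForest w) :
    t ≠ STerm.leaf := by
  rintro rfl
  obtain ⟨x, -, hx⟩ := List.mem_map.1 ht
  exact x.2 (((masCongr S).cls_out x.1).symm.trans (congrArg mk hx))

theorem map_mk_eq_of_map_nodes_eq [IsEmpty (S 0)] {f f' : SForest S}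
    (h : f.map STerm.nodes = f'.map STerm.nodes) : f.map mk = f'.map mk := by
  have map_mk (f : SForest S) :
      f.map mk = (f.map STerm.nodes).map fun l : List (Σ n, S n) => ofContent ↑l := by
    rw [List.map_map]
    exact List.map_congr_left fun t _ => mk_eq_ofContent t
  rw [map_mk, map_mk, h]

theorem eq_of_compatible_testWord [IsEmpty (S 0)] {w w' : (MAs S).RedWord} {f : SForest S}
    (hlen : w'.toList.length ≤ w.toList.length) (hf : f.map mk = w'.toList.map Subtype.val)
    (h : SForest.Compatible (ForestAlphabet.lengthAlphabet S) (outForest w).testWord f) :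
    w' = w := by
  have hlength : f.length = w'.toList.length := by
    rw [← List.length_map mk, hf, List.length_map]
  have hnodes := h.map_nodes_eq_of_testWord (fun _ => ne_leaf_of_mem_outForest)
    (hlength.trans_le (hlen.trans_eq (length_outForest w).symm))
  have hmk := (map_mk_eq_of_map_nodes_eq hnodes).trans (map_mk_outForest w)
  exact List.map_injective_iff.2 Subtype.val_injective (hf.symm.trans hmk)

end MAs

theorem masRealization_injective (K : Type v) [Field K] [CharZero K] {S : ℕ → Type u}
    [IsEmpty (S 0)] :
    Function.Injective (masRealization K (ForestAlphabet.lengthAlphabet S)) := by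
  let 𝔸 := ForestAlphabet.lengthAlphabet S
  let Rep (w w' : (MAs S).RedWord) := {f : MAs.ForestRep (w'.toList.map Subtype.val) //
    SForest.Compatible 𝔸 (MAs.outForest w).testWord f.1}
  have coeff_testWord (w w' : (MAs S).RedWord) :
      NCPoly.coeffLinear (MAs.outForest w).testWord ((masRealizationHom K 𝔸).toLinearMap
        (MonoidAlgebra.basis (MAs S).RedWord K w')) = Nat.card (Rep w w') := by
    rw [MonoidAlgebra.basis_apply]
    exact coeff_masRealizationHom_E K 𝔸 w' _
  rw [masRealization_eq]
  refine injective_of_triangular (MonoidAlgebra.basis (MAs S).RedWord K) _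
    (fun w => w.toList.length) (fun w => NCPoly.coeffLinear (MAs.outForest w).testWord)
    (fun w => (coeff_testWord w w).trans_ne (Nat.cast_ne_zero.2 ?_))
    fun w w' hlen hne => (coeff_testWord w w').trans (Nat.cast_eq_zero.2 ?_)
  · have : Nonempty (Rep w w) :=
      ⟨⟨⟨MAs.outForest w, MAs.map_mk_outForest w⟩, SForest.compatible_testWord _⟩⟩
    exact Nat.card_pos.ne'
  · have : IsEmpty (Rep w w') :=
      ⟨fun f => hne (MAs.eq_of_compatible_testWord hlen f.1.2 f.2)⟩
    exact Nat.card_of_isEmpty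

end Injectivity

section Transport

variable {K : Type v} [Field K] {H : Type w} [Ring H] [Algebra K H] {H' : Type w'} [Ring H']
  [Algebra K H']

namespace IsHopfIso

variable {Δ : H →ₐ[K] H ⊗[K] H} {ε : H →ₐ[K] K} {Δ' : H' →ₐ[K] H' ⊗[K] H'} {ε' : H' →ₐ[K] K}
  {φ : H ≃ₐ[K] H'}

theorem map_convolution (hφ : IsHopfIso Δ ε Δ' ε' φ) {α β : H →ₗ[K] H} {α' β' : H' →ₗ[K] H'}
    (hα : ∀ x, α' (φ x) = φ (α x)) (hβ : ∀ x, β' (φ x) = φ (β x)) (x : H) :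
    LinearMap.mul' K H' (TensorProduct.map α' β' (Δ' (φ x))) =
      φ (LinearMap.mul' K H (TensorProduct.map α β (Δ x))) := by
  rw [hφ.map_comul]
  induction Δ x with
  | zero => simp only [map_zero]
  | add y z hy hz => simp only [map_add, hy, hz]
  | tmul y z => simp [hα, hβ]

theorem convolution_eq_unit (hφ : IsHopfIso Δ ε Δ' ε' φ) {α β : H →ₗ[K] H} {α' β' : H' →ₗ[K] H'}
    (hα : ∀ x, α' (φ x) = φ (α x)) (hβ : ∀ x, β' (φ x) = φ (β x))
    (h : LinearMap.mul' K H ∘ₗ TensorProduct.map α β ∘ₗ Δ.toLinearMap =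
      Algebra.linearMap K H ∘ₗ ε.toLinearMap) :
    LinearMap.mul' K H' ∘ₗ TensorProduct.map α' β' ∘ₗ Δ'.toLinearMap =
      Algebra.linearMap K H' ∘ₗ ε'.toLinearMap := by
  refine LinearMap.ext fun y => ?_
  obtain ⟨x, rfl⟩ := φ.surjective y
  calc LinearMap.mul' K H' (TensorProduct.map α' β' (Δ' (φ x)))
      = φ (LinearMap.mul' K H (TensorProduct.map α β (Δ x))) := hφ.map_convolution hα hβ x
    _ = φ (algebraMap K H (ε x)) := congrArg φ (LinearMap.congr_fun h x)
    _ = algebraMap K H' (ε' (φ x)) := by rw [AlgEquiv.commutes, hφ.map_counit]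

theorem isHopfAlgebra (hφ : IsHopfIso Δ ε Δ' ε' φ) (h : IsHopfAlgebra Δ ε) :
    IsHopfAlgebra Δ' ε' := by
  let _ : HopfAlgebra K H := h.toHopfAlgebra
  let _ : CoalgebraStruct K H' := ⟨Δ'.toLinearMap, ε'.toLinearMap⟩
  let φc : H ≃ₗc[K] H' :=
    { φ.toLinearEquiv with
      counit_comp := LinearMap.ext hφ.map_counit
      map_comp_comul := LinearMap.ext fun x => (hφ.map_comul x).symm }
  let C : Coalgebra K H' := φc.toCoalgebra
  obtain ⟨α, hα, hα'⟩ := h.exists_antipode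
  have hconj (x : H) : (φ.toLinearMap ∘ₗ α ∘ₗ φ.symm.toLinearMap) (φ x) = φ (α x) :=
    congrArg (fun y => φ (α y)) (φ.symm_apply_apply x)
  exact
    { coassoc := AlgHom.ext fun x => LinearMap.congr_fun C.coassoc x
      rTensor_counit := AlgHom.ext fun x => LinearMap.congr_fun C.rTensor_counit_comp_comul x
      lTensor_counit := AlgHom.ext fun x => LinearMap.congr_fun C.lTensor_counit_comp_comul x
      exists_antipode := ⟨φ.toLinearMap ∘ₗ α ∘ₗ φ.symm.toLinearMap,
        hφ.convolution_eq_unit (β' := .id) hconj (fun _ => rfl) hα,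
        hφ.convolution_eq_unit (α' := .id) (fun _ => rfl) hconj hα'⟩ }

end IsHopfIso

/-- The coproduct transported along an isomorphism of algebras. -/
noncomputable def transportComul (Δ : H →ₐ[K] H ⊗[K] H) (φ : H ≃ₐ[K] H') : H' →ₐ[K] H' ⊗[K] H' :=
  (Algebra.TensorProduct.map φ.toAlgHom φ.toAlgHom).comp (Δ.comp φ.symm.toAlgHom)

/-- The counit transported along an isomorphism of algebras. -/
def transportCounit (ε : H →ₐ[K] K) (φ : H ≃ₐ[K] H') : H' →ₐ[K] K :=
  ε.comp φ.symm.toAlgHom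

theorem isHopfIso_transport (Δ : H →ₐ[K] H ⊗[K] H) (ε : H →ₐ[K] K) (φ : H ≃ₐ[K] H') :
    IsHopfIso Δ ε (transportComul Δ φ) (transportCounit ε φ) φ where
  map_comul x := by simp [transportComul]
  map_counit x := by simp [transportCounit]

theorem map_val_transportComul_ofInjective (Δ : H →ₐ[K] H ⊗[K] H) {ρ : H →ₐ[K] H'}
    (hρ : Function.Injective ρ) (x : H) :
    Algebra.TensorProduct.map ρ.range.val ρ.range.val
        (transportComul Δ (AlgEquiv.ofInjective ρ hρ) (AlgEquiv.ofInjective ρ hρ x)) =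
      Algebra.TensorProduct.map ρ ρ (Δ x) := by
  have hval : ρ.range.val.comp (AlgEquiv.ofInjective ρ hρ).toAlgHom = ρ := rfl
  conv_rhs => rw [← hval, Algebra.TensorProduct.map_comp]
  simp [transportComul]

end Transport

section PolynomialRealization

variable (K : Type v) [Field K] {S : ℕ → Type u}

theorem ForestAlphabet.isIso_sumAssoc (A B C : ForestAlphabet S) :
    ForestAlphabet.IsIso ((A.sum B).sum C) (A.sum (B.sum C)) (Equiv.sumAssoc _ _ _) where
  root_iff := by rintro ((a | b) | c) <;> rfl
  deco_iff g := by rintro ((a | b) | c) <;> rfl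
  edge_iff j := by rintro ((a | b) | c) ((a' | b') | c') <;> rfl

theorem theta_masRealization (A B : ForestAlphabet S) (x : (MAs S).Natural K) :
    NCPoly.theta (A := A.carrier) (B := B.carrier) (masRealization K (A.sum B) x) =
      NCPoly.tensorCoeff (TensorProduct.map (masRealization K A) (masRealization K B)
        ((MAs S).comul K x)) := by
  simp only [masRealization_eq]
  exact theta_masRealizationHom K A B x

theorem isPolynomialRealization_masRealization [CharZero K] [IsEmpty (S 0)] :
    IsPolynomialRealization ((MAs S).comul K) ((MAs S).homogeneous K (MAs.deg S))
      (masRealization K) (ForestAlphabet.lengthAlphabet S) where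
  sum_assoc := ForestAlphabet.isIso_sumAssoc
  graded A n _ hx := masRealization_isHomogeneous K A n hx
  doubling := theta_masRealization K
  injective := masRealization_injective K

end PolynomialRealization

theorem mainTheorem7_general (K : Type v) [Field K] [CharZero K] (S : ℕ → Type u)
    [IsEmpty (S 0)] :
    (MAs S).FinitelyFactorizable ∧ (MAs S).IsGrading (MAs.deg S) ∧ (masCongr S).FiniteType ∧
    IsHopfAlgebra ((MAs S).comul K) ((MAs S).counit K) ∧
    (∃ V : Subalgebra K (NCPoly K (ForestAlphabet.lengthAlphabet S).carrier),
      Subalgebra.toSubmodule V =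
        LinearMap.range (masRealization K (ForestAlphabet.lengthAlphabet S)) ∧
      ∃ (ΔV : V →ₐ[K] V ⊗[K] V) (εV : V →ₐ[K] K),
        IsHopfAlgebra ΔV εV ∧
        (∀ (x : (MAs S).Natural K) (y : V),
          masRealization K (ForestAlphabet.lengthAlphabet S) x = y →
          NCPoly.tensorCoeff (TensorProduct.map V.val.toLinearMap V.val.toLinearMap (ΔV y)) =
            NCPoly.theta (A := (ForestAlphabet.lengthAlphabet S).carrier)
              (B := (ForestAlphabet.lengthAlphabet S).carrier)
              (masRealization K
                ((ForestAlphabet.lengthAlphabet S).sum (ForestAlphabet.lengthAlphabet S)) x)) ∧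
        ∃ φ : (MAs S).Natural K ≃ₐ[K] V,
          (∀ x, (φ x : NCPoly K (ForestAlphabet.lengthAlphabet S).carrier) =
            masRealization K (ForestAlphabet.lengthAlphabet S) x) ∧
          IsHopfIso ((MAs S).comul K) ((MAs S).counit K) ΔV εV φ) ∧
    IsPolynomialRealization ((MAs S).comul K) ((MAs S).homogeneous K (MAs.deg S))
      (masRealization K) (ForestAlphabet.lengthAlphabet S) := by
  let ρ := masRealizationHom K (ForestAlphabet.lengthAlphabet S)
  have hρ : masRealization K (ForestAlphabet.lengthAlphabet S) = ρ.toLinearMap :=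
    masRealization_eq K _
  have hinj : Function.Injective ρ := fun x y h =>
    masRealization_injective K (by rw [hρ]; exact h)
  have hHopf : IsHopfAlgebra ((MAs S).comul K) ((MAs S).counit K) :=
    (MAs.isGrading S).isHopfAlgebra (MAs.finitelyFactorizable S)
  let φ := AlgEquiv.ofInjective ρ hinj
  have hφ := isHopfIso_transport ((MAs S).comul K) ((MAs S).counit K) φ
  have hφρ (x) : (φ x : NCPoly K (ForestAlphabet.lengthAlphabet S).carrier) =
      masRealization K (ForestAlphabet.lengthAlphabet S) x := (LinearMap.congr_fun hρ x).symm
  refine ⟨MAs.finitelyFactorizable S, MAs.isGrading S, masCongr_finiteType, hHopf,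
    ⟨ρ.range, by rw [hρ]; rfl, _, _, hφ.isHopfAlgebra hHopf, fun x y hxy => ?_, φ, hφρ, hφ⟩,
    isPolynomialRealization_masRealization K⟩
  obtain rfl : φ x = y := Subtype.ext ((hφρ x).trans hxy)
  rw [theta_masRealization, hρ]
  exact congrArg NCPoly.tensorCoeff (map_val_transportComul_ofInjective _ hinj x)

theorem HasProfile.isEmpty_zero {S : ℕ → Type u} {r s : ℕ} (hS : HasProfile S r s) :
    IsEmpty (S 0) := by
  have := (hS 0).1
  rw [← Finite.card_eq_zero_iff, (hS 0).2, if_neg (Nat.succ_ne_zero r).symm]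

theorem mainTheorem7 (K : Type v) [Field K] [CharZero K] (r s : ℕ) (S : ℕ → Type u)
    (hS : HasProfile S r s) :
    (MAs S).FinitelyFactorizable ∧ (MAs S).IsGrading (MAs.deg S) ∧ (masCongr S).FiniteType ∧
    IsHopfAlgebra ((MAs S).comul K) ((MAs S).counit K) ∧
    (∃ V : Subalgebra K (NCPoly K (ForestAlphabet.lengthAlphabet S).carrier),
      Subalgebra.toSubmodule V =
        LinearMap.range (masRealization K (ForestAlphabet.lengthAlphabet S)) ∧
      ∃ (ΔV : V →ₐ[K] V ⊗[K] V) (εV : V →ₐ[K] K),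
        IsHopfAlgebra ΔV εV ∧
        (∀ (x : (MAs S).Natural K) (y : V),
          masRealization K (ForestAlphabet.lengthAlphabet S) x = y →
          NCPoly.tensorCoeff (TensorProduct.map V.val.toLinearMap V.val.toLinearMap (ΔV y)) =
            NCPoly.theta (A := (ForestAlphabet.lengthAlphabet S).carrier)
              (B := (ForestAlphabet.lengthAlphabet S).carrier)
              (masRealization K
                ((ForestAlphabet.lengthAlphabet S).sum (ForestAlphabet.lengthAlphabet S)) x)) ∧
        ∃ φ : (MAs S).Natural K ≃ₐ[K] V,
          (∀ x, (φ x : NCPoly K (ForestAlphabet.lengthAlphabet S).carrier) =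
            masRealization K (ForestAlphabet.lengthAlphabet S) x) ∧
          IsHopfIso ((MAs S).comul K) ((MAs S).counit K) ΔV εV φ) ∧
    IsPolynomialRealization ((MAs S).comul K) ((MAs S).homogeneous K (MAs.deg S))
      (masRealization K) (ForestAlphabet.lengthAlphabet S) := by
  have := hS.isEmpty_zero
  exact mainTheorem7_general K S
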